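/- Let $\mathcal T$ be a tiling of the plane by squares with sides parallel to the axes (closed squares covering the plane, with disjoint interiors, only finitely many meeting any compact set). A point is \emph{singular} if it lies in exactly four squares. A \emph{choice of faces} selects at each singular point whether the horizontal direction passes through it (and the vertical one is broken there) or the vertical direction passes through it (and the horizontal one is broken there). For such a choice, a \emph{horizontal face} is a class of the equivalence relation on horizontal edges of squares generated by relating two edges that share a point at which the horizontal direction is not broken; \emph{vertical faces} are defined likewise. $\mathcal T$ is \emph{edge finite} for the choice if every horizontal and vertical face contains finitely many edges; it is edge finite if this holds for every choice, and \emph{regular} if it is edge finite and has no singular point (so that there is only one choice). A \emph{plane map} is a connected graph drawn in the plane (edges are simple polygonal arcs between distinct vertices, meeting only in vertices; multiple edges allowed) such that all faces, i.e. components of the complement, are bounded and only finitely many vertices and edges meet any compact set. A directed edge is a pair $(v,e)$ of a vertex $v$ and an edge $e$ containing $v$, directed away from $v$. A vector $w$ on the directed edges is \emph{harmonic} if its sums over the directed edges starting at any given vertex, over the two directed edges of any given edge, and over the directed edges having any given face on the right, all vanish; $w_e$ is the common absolute value of $w$ on the two directions of $e$. An isomorphism of plane maps consists of bijections of vertices,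 edges and faces respecting incidence, the sides of directed edges and the cyclic order of edges around vertices. Let a choice of faces for which $\mathcal T$ is edge finite be given (any choice, if $\mathcal T$ is edge finite). Then there are a plane map $\mathcal M$ and a harmonic vector $w$ on $\mathcal M$ such that: (i) The squares of $\mathcal T$ correspond bijectively to the edges of $\mathcal M$, and $w_e$ is the size of the square corresponding to $e$. (ii) The vertices of $\mathcal M$ correspond bijectively to the horizontal faces of $\mathcal T$ and the faces of $\mathcal M$ to the vertical faces of $\mathcal T$: the edge of a square $C$ joins the horizontal faces containing the upper and the lower edge of $C$; directed downwards it has the vertical face containing the left edge of $C$ on its right and $w$ equals the size of $C$; directed upwards it has the vertical face containing the right edge of $C$ on its right and $w$ equals minus the size. By these properties $(\mathcal M,w)$ is determined uniquely up to isomorphism, the isomorphism being compatible with the correspondences. (iii) $\mathcal M$ and $w$ can be taken invariant under all translations that preserve $\mathcal T$ and the choice of faces; in particular, if $\mathcal T$ and the choice are periodic (invariant under translations in two non-parallel directions), then so are $\mathcal M$ and $w$. (iv) If $\mathcal T$ is regular, then $(\mathcal M, w)$ is determined uniquely up to isomorphism by $\mathcal T$ alone. In that case the tiling obtained by rotating $\mathcal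 T$ by $90$ degrees is again regular, and its plane map is the dual $\mathcal M^*$ of $\mathcal M$. -/

import Mathlib

open Complex Set Filter Topology

noncomputable section

/-! ### Squares and square tilings of the plane, the plane being identified with `ℂ` -/

/-- A square with sides parallel to the axes, given by its lower left corner and its size. -/
@[ext] structure Square where
  corner : ℂ
  side : ℝ
  side_pos : 0 < side

namespace Square

/-- The closed square as a subset of the plane. -/
def region (q : Square) : Set ℂ :=
  Icc q.corner.re (q.corner.re + q.side) ×ℂ Icc q.corner.im (q.corner.im + q.side)

/-- Upper horizontal edge. -/
def top (q : Square) : Set ℂ :=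
  Icc q.corner.re (q.corner.re + q.side) ×ℂ {q.corner.im + q.side}

/-- Lower horizontal edge. -/
def bottom (q : Square) : Set ℂ :=
  Icc q.corner.re (q.corner.re + q.side) ×ℂ {q.corner.im}

/-- Left vertical edge. -/
def left (q : Square) : Set ℂ :=
  {q.corner.re} ×ℂ Icc q.corner.im (q.corner.im + q.side)

/-- Right vertical edge. -/
def right (q : Square) : Set ℂ :=
  {q.corner.re + q.side} ×ℂ Icc q.corner.im (q.corner.im + q.side)

/-- The square translated by `t`. -/
def translate (t : ℂ) (q : Square) : Square := ⟨q.corner + t, q.side, q.side_pos⟩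

/-- The square rotated counterclockwise by 90 degrees around the origin. -/
def rotate (q : Square) : Square := ⟨I * q.corner - q.side, q.side, q.side_pos⟩

theorem region_rotate (q : Square) : q.rotate.region = (fun z : ℂ => I * z) '' q.region := by
  ext z
  simp only [region, rotate, mem_image, mem_reProdIm, mem_Icc]
  constructor
  · rintro ⟨⟨h1, h2⟩, h3, h4⟩
    refine ⟨-I * z, ?_, by rw [← mul_assoc]; simp⟩
    simp at h1 h2 h3 h4 ⊢
    refine ⟨⟨?_, ?_⟩, ?_, ?_⟩ <;> linarith
  · rintro ⟨y, ⟨⟨h1, h2⟩, h3, h4⟩, rfl⟩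
    simp
    refine ⟨⟨?_, ?_⟩, ?_, ?_⟩ <;> linarith

end Square

/-- A tiling of the plane by axis-parallel squares: closed squares with pairwise disjoint
interiors that cover the plane, only finitely many of them meeting any compact set. -/
structure SquareTiling where
  squares : Set Square
  cover : ∀ p : ℂ, ∃ q ∈ squares, p ∈ q.region
  disjoint : ∀ q ∈ squares, ∀ q' ∈ squares, q ≠ q' →
    Disjoint (interior q.region) (interior q'.region)
  locallyFinite : ∀ K : Set ℂ, IsCompact K → {q ∈ squares | (q.region ∩ K).Nonempty}.Finite

namespace SquareTiling

/-- The tiling rotated counterclockwise by 90 degrees around the origin. -/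
def rotate (T : SquareTiling) : SquareTiling where
  squares := Square.rotate '' T.squares
  cover p := by
    obtain ⟨q, hq, hp⟩ := T.cover (-I * p)
    refine ⟨q.rotate, mem_image_of_mem _ hq, ?_⟩
    rw [Square.region_rotate]
    exact ⟨-I * p, hp, by simp [← mul_assoc]⟩
  disjoint := by
    rintro _ ⟨q, hq, rfl⟩ _ ⟨q', hq', rfl⟩ hne
    have h := T.disjoint q hq q' hq' (fun h => hne (by rw [h]))
    have key : ∀ s : Square,
        interior s.rotate.region = (fun z : ℂ => I * z) '' interior s.region := fun s => by
      rw [Square.region_rotate]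
      exact ((Homeomorph.mulLeft₀ I I_ne_zero).image_interior s.region).symm
    rw [key, key]
    exact (disjoint_image_iff (mul_right_injective₀ I_ne_zero)).2 h
  locallyFinite K hK := by
    have hK' : IsCompact ((fun z : ℂ => -I * z) '' K) := hK.image (by fun_prop)
    refine ((T.locallyFinite _ hK').image Square.rotate).subset ?_
    rintro _ ⟨⟨q, hq, rfl⟩, z, hz, hzK⟩
    refine ⟨q, ⟨hq, -I * z, ?_, mem_image_of_mem _ hzK⟩, rfl⟩
    rw [Square.region_rotate] at hz
    obtain ⟨y, hy, rfl⟩ := hz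
    simpa [← mul_assoc] using hy

/-- The singular vertices: the points contained in exactly four squares. -/
def singular (T : SquareTiling) : Set ℂ :=
  {p | {q ∈ T.squares | p ∈ q.region}.ncard = 4}

/-- A choice of horizontal and vertical faces: at each singular vertex either the horizontal face
passes through the vertex and the vertical faces are broken there (the vertices in `horiz`), or
the vertical face passes through and the horizontal faces are broken there (all others). -/
structure FaceChoice (T : SquareTiling) where
  horiz : Set ℂ
  horiz_subset : horiz ⊆ T.singular

variable {T : SquareTiling}

/-- Horizontal edges: the top edge `(q, true)` and the bottom edge `(q, false)` of each square. -/
def hEdge (T : SquareTiling) : T.squares × Bool → Set ℂ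
  | (q, true) => q.1.top
  | (q, false) => q.1.bottom

/-- Vertical edges: the left edge `(q, true)` and the right edge `(q, false)` of each square. -/
def vEdge (T : SquareTiling) : T.squares × Bool → Set ℂ
  | (q, true) => q.1.left
  | (q, false) => q.1.right

/-- Two horizontal edges that meet (hence lie on one line) are linked, unless they meet only at a
singular vertex where the horizontal faces are broken. -/
def HLink (c : T.FaceChoice) (a b : T.squares × Bool) : Prop :=
  ∃ p ∈ T.hEdge a ∩ T.hEdge b, p ∉ T.singular \ c.horiz

/-- Two vertical edges that meet (hence lie on one line) are linked, unless they meet only at a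
singular vertex where the vertical faces are broken. -/
def VLink (c : T.FaceChoice) (a b : T.squares × Bool) : Prop :=
  ∃ p ∈ T.vEdge a ∩ T.vEdge b, p ∉ c.horiz

/-- The horizontal faces: the classes of the equivalence relation on the horizontal edges that is
generated by linking. -/
def HFace (c : T.FaceChoice) : Type := Quot (HLink c)

/-- The vertical faces: the classes of the equivalence relation on the vertical edges that is
generated by linking. -/
def VFace (c : T.FaceChoice) : Type := Quot (VLink c)

/-- The horizontal face that contains the top edge of `q`. -/
def topFace (c : T.FaceChoice) (q : T.squares) : HFace c := Quot.mk _ (q, true)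

/-- The horizontal face that contains the bottom edge of `q`. -/
def bottomFace (c : T.FaceChoice) (q : T.squares) : HFace c := Quot.mk _ (q, false)

/-- The vertical face that contains the left edge of `q`. -/
def leftFace (c : T.FaceChoice) (q : T.squares) : VFace c := Quot.mk _ (q, true)

/-- The vertical face that contains the right edge of `q`. -/
def rightFace (c : T.FaceChoice) (q : T.squares) : VFace c := Quot.mk _ (q, false)

/-- For the choice `c`, every horizontal and every vertical face has finitely many edges. -/
def EdgeFiniteFor (c : T.FaceChoice) : Prop :=
  (∀ h : HFace c, {a : T.squares × Bool | (Quot.mk _ a : HFace c) = h}.Finite) ∧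
  (∀ f : VFace c, {a : T.squares × Bool | (Quot.mk _ a : VFace c) = f}.Finite)

/-- All horizontal and vertical faces have finitely many edges, whatever the choice at the singular
vertices. (The two constant choices give the maximal horizontal and vertical segments.) -/
def EdgeFinite (T : SquareTiling) : Prop := ∀ c : T.FaceChoice, EdgeFiniteFor c

/-- Edge finite and without singular vertices. -/
def Regular (T : SquareTiling) : Prop := T.EdgeFinite ∧ T.singular = ∅

/-- The translation by `t` preserves the tiling and the choice of faces. -/
def IsPeriod (c : T.FaceChoice) (t : ℂ) : Prop :=
  Square.translate t '' T.squares = T.squares ∧ (fun z => z + t) '' c.horiz = c.horiz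

end SquareTiling

/-- Two translations in non-parallel directions have the property `P`. -/
def TwoPeriods (P : ℂ → Prop) : Prop :=
  ∃ t₁ t₂ : ℂ, LinearIndependent ℝ ![t₁, t₂] ∧ P t₁ ∧ P t₂

/-! ### Plane graphs and plane maps -/

/-- The polygonal line with the given list of nodes, as a subset of the plane. -/
def polyLine (l : List ℂ) : Set ℂ := {x | ∃ p q, [p, q] <:+: l ∧ x ∈ segment ℝ p q}

/-- The list of nodes describes a simple (not closed) polygonal arc with at least one piece. -/
def IsPolyArc : List ℂ → Prop
  | [] => False
  | [_] => False
  | [a, b] => a ≠ b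
  | a :: b :: c :: l =>
      a ≠ b ∧ segment ℝ a b ∩ polyLine (b :: c :: l) = {b} ∧ IsPolyArc (b :: c :: l)

/-- The direction in which a polygonal line leaves its first node. -/
def initialDir : List ℂ → ℂ
  | p :: q :: _ => q - p
  | _ => 0

/-- The directions `u`, `v`, `w` are distinct and follow each other in this order in a
counterclockwise turn. -/
def Ccw (u v w : ℂ) : Prop :=
  (arg u < arg v ∧ arg v < arg w) ∨ (arg v < arg w ∧ arg w < arg u) ∨
    (arg w < arg u ∧ arg u < arg v)

/-- A graph (multiple edges allowed) drawn in the plane: each edge is drawn as a simple polygonal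
arc joining two distinct vertices and containing no other vertex, and two different edges meet in
vertices only. -/
structure PlaneGraph where
  V : Type
  E : Type
  pos : V → ℂ
  path : E → List ℂ
  pos_injective : Function.Injective pos
  isPolyArc : ∀ e, IsPolyArc (path e)
  ends : ∀ e, ∃ u v : V, (path e).head? = some (pos u) ∧ (path e).getLast? = some (pos v) ∧
    ∀ x : V, pos x ∈ polyLine (path e) → x = u ∨ x = v
  inter : ∀ e e', e ≠ e' → polyLine (path e) ∩ polyLine (path e') ⊆ range pos

namespace PlaneGraph

/-- The edge `e` as a subset of the plane. -/
def arc (M : PlaneGraph) (e : M.E) : Set ℂ := polyLine (M.path e)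

/-- The vertex `v` lies on the edge `e`. -/
def Inc (M : PlaneGraph) (v : M.V) (e : M.E) : Prop := M.pos v ∈ M.arc e

/-- Directed edges: pairs of a vertex and an edge that contains it. -/
def Dart (M : PlaneGraph) : Type := {d : M.V × M.E // M.Inc d.1 d.2}

/-- The union of all vertices and edges. -/
def support (M : PlaneGraph) : Set ℂ := range M.pos ∪ ⋃ e, M.arc e

/-- The faces: the connected components of the plane minus vertices and edges. -/
def Face (M : PlaneGraph) : Type :=
  {f : Set ℂ // ∃ x ∈ M.supportᶜ, f = connectedComponentIn M.supportᶜ x}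

open Classical in
/-- The nodes of the edge `e`, listed starting from its end `v`. -/
def pathFrom (M : PlaneGraph) (v : M.V) (e : M.E) : List ℂ :=
  if (M.path e).head? = some (M.pos v) then M.path e else (M.path e).reverse

/-- The face `f` is on the right of the directed edge `(v, e)`: from an inner point of a straight
piece of `e`, traversed from `p` to `q` when `e` is run through from `v`, a small step to the right
leads into `f`. -/
def RightOf (M : PlaneGraph) (v : M.V) (e : M.E) (f : M.Face) : Prop :=
  M.Inc v e ∧ ∃ p q, [p, q] <:+: M.pathFrom v e ∧ ∃ x ∈ openSegment ℝ p q,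
    ∀ᶠ ε : ℝ in 𝓝[>] 0, x - ε * (I * (q - p)) ∈ f.1

/-- The face `f` is on the left of the directed edge `(v, e)`, that is, on the right of the
reversed directed edge. -/
def LeftOf (M : PlaneGraph) (v : M.V) (e : M.E) (f : M.Face) : Prop :=
  M.Inc v e ∧ ∃ v', v' ≠ v ∧ M.RightOf v' e f

/-- Among the edges at `v`, the edge `e'` is the one that follows `e` counterclockwise. -/
def NextAt (M : PlaneGraph) (v : M.V) (e e' : M.E) : Prop :=
  M.Inc v e ∧ M.Inc v e' ∧ (e' = e → ∀ d, M.Inc v d → d = e) ∧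
    ∀ d, M.Inc v d → ¬ Ccw (initialDir (M.pathFrom v e)) (initialDir (M.pathFrom v d))
      (initialDir (M.pathFrom v e'))

/-- A plane map: a connected plane graph all of whose faces are bounded and such that only
finitely many vertices and edges meet any compact set. -/
structure IsPlaneMap (M : PlaneGraph) : Prop where
  nonempty : Nonempty M.V
  connected : ∀ u v : M.V, Relation.ReflTransGen (fun a b => ∃ e, M.Inc a e ∧ M.Inc b e) u v
  bounded : ∀ f : M.Face, Bornology.IsBounded f.1
  finite_verts : ∀ K : Set ℂ, IsCompact K → {v | M.pos v ∈ K}.Finite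
  finite_edges : ∀ K : Set ℂ, IsCompact K → {e | (M.arc e ∩ K).Nonempty}.Finite

/-- Harmonic vectors. For a plane map all three sums are finite. -/
structure IsHarmonic (M : PlaneGraph) (w : M.Dart → ℝ) : Prop where
  vert : ∀ v : M.V, ∑ᶠ (d : M.Dart) (_ : d.1.1 = v), w d = 0
  edge : ∀ e : M.E, ∑ᶠ (d : M.Dart) (_ : d.1.2 = e), w d = 0
  face : ∀ f : M.Face, ∑ᶠ (d : M.Dart) (_ : M.RightOf d.1.1 d.1.2 f), w d = 0

/-- The translation by `t` preserves the drawing of `M` and the vector `w`. -/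
def IsPeriod (M : PlaneGraph) (w : M.Dart → ℝ) (t : ℂ) : Prop :=
  ∃ (σ : M.V ≃ M.V) (τ : M.E ≃ M.E),
    (∀ v, M.pos (σ v) = M.pos v + t) ∧
    (∀ e, M.arc (τ e) = (fun z => z + t) '' M.arc e) ∧
    (∀ d d' : M.Dart, d'.1 = (σ d.1.1, τ d.1.2) → w d' = w d)

/-- An (orientation preserving) isomorphism of plane maps: bijections between the vertices, the
edges and the faces that respect incidence, the sides of directed edges, and the cyclic order of
the edges around each vertex. -/
structure Iso (M M' : PlaneGraph) where
  vert : M.V ≃ M'.V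
  edge : M.E ≃ M'.E
  face : M.Face ≃ M'.Face
  inc : ∀ v e, M.Inc v e ↔ M'.Inc (vert v) (edge e)
  right : ∀ v e f, M.RightOf v e f ↔ M'.RightOf (vert v) (edge e) (face f)
  next : ∀ v e e', M.NextAt v e e' ↔ M'.NextAt (vert v) (edge e) (edge e')

/-- `M'` is (isomorphic to) the dual map of `M`: its vertices, edges, faces correspond to the
faces, edges, vertices of `M`; an edge of `M'` joins the faces of `M` on the two sides of the
corresponding edge; the directed edge of `M'` that crosses a directed edge of `M` from its right to
its left has the head of the latter on its right; and the counterclockwise order of the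
edges of `M'` around a vertex is the order in which the boundary of the corresponding face of `M`
is run through with that face on the left (coming in along `e` to `v`, going out along `e'`). -/
structure DualIso (M M' : PlaneGraph) where
  vert : M'.V ≃ M.Face
  edge : M'.E ≃ M.E
  face : M'.Face ≃ M.V
  inc : ∀ f e, M'.Inc f e ↔ ∃ v, M.RightOf v (edge e) (vert f)
  right : ∀ f e v, M'.RightOf f e v ↔ M.LeftOf (face v) (edge e) (vert f)
  next : ∀ f e e', M'.NextAt f e e' ↔ ∃ v, M.RightOf v (edge e) (vert f) ∧
    M.LeftOf v (edge e') (vert f) ∧ M.NextAt v (edge e') (edge e)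

end PlaneGraph

/-- The correspondence between a square tiling with a choice `c` of faces and a plane graph `M`
with a vector `w` on its directed edges: vertices correspond to horizontal faces, edges to squares,
faces to vertical faces. The edge of a square `q` joins the horizontal faces above and below `q`;
when it is run through downwards, the vertical face at the left edge of `q` is on its right, and
when it is run through upwards, the one at the right edge of `q` is; and `w` is
the size of `q` downwards and minus the size of `q` upwards. -/
structure Corresponds {T : SquareTiling} (c : T.FaceChoice) (M : PlaneGraph)
    (w : M.Dart → ℝ) where
  vert : M.V ≃ SquareTiling.HFace c
  edge : M.E ≃ T.squares
  face : M.Face ≃ SquareTiling.VFace c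
  inc : ∀ v e, M.Inc v e ↔
    vert v = SquareTiling.topFace c (edge e) ∨ vert v = SquareTiling.bottomFace c (edge e)
  right : ∀ v e f, M.RightOf v e f ↔
    (vert v = SquareTiling.topFace c (edge e) ∧ face f = SquareTiling.leftFace c (edge e)) ∨
    (vert v = SquareTiling.bottomFace c (edge e) ∧ face f = SquareTiling.rightFace c (edge e))
  weight_top : ∀ d : M.Dart, vert d.1.1 = SquareTiling.topFace c (edge d.1.2) →
    w d = (edge d.1.2).1.side
  weight_bottom : ∀ d : M.Dart, vert d.1.1 = SquareTiling.bottomFace c (edge d.1.2) →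
    w d = -(edge d.1.2).1.side

end

/-!
Collapse every horizontal face to its midpoint, except for short pieces at its ends that lie within
the two extreme squares. The collapsing map `squash` moves points near a face horizontally, the more
the closer they are to the face. It is continuous and proper, and identifies points only on the
collapsed segments. The vertices of the plane map are the midpoints of the horizontal faces, and the
edge of a square is the image of its vertical mid-line. The complement of the mid-lines and of the
collapsed segments falls into one connected cell around each vertical face, and the images of these
cells are the faces.

The squares with their upper edge in a given horizontal face and those with their lower edge in it
have the same total size, the length of the face. This is harmonicity at the vertices, and
harmonicity at the faces is the same statement for the tiling rotated by 90 degrees.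

For uniqueness it has to be seen that the correspondence determines the cyclic order of the edges
around a vertex. The edge that follows `e` is the one that has the face to the left of `e` on its
right, and it is determined by the vertex and this face, because a square is determined by its upper
(or lower) horizontal and its left (or right) vertical face. The same description of the cyclic
order makes the map of the rotated tiling the dual map.
-/

noncomputable section

/-! ### One-sided neighbourhoods and half-open intervals -/

section HalfIn

variable {α : Type*}

/-- The right (`s = true`) or left (`s = false`) end of the interval `[l, r]`. -/
def endpoint (s : Bool) (l r : α) : α := cond s r l

/-- The interval `[l, r]` contains the points next to `x` on the right (`s = true`) or on the left
(`s = false`). -/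
def HalfIn [Preorder α] (s : Bool) (l r x : α) : Prop :=
  cond s (l ≤ x ∧ x < r) (l < x ∧ x ≤ r)

/-- The right (`s = true`) or left (`s = false`) neighbourhoods of a point. -/
def nhdsSide [TopologicalSpace α] [Preorder α] (s : Bool) (x : α) : Filter α :=
  cond s (𝓝[>] x) (𝓝[<] x)

theorem endpoint_mem_Icc [Preorder α] (s : Bool) {l r : α} (h : l ≤ r) :
    endpoint s l r ∈ Icc l r := by
  cases s
  exacts [left_mem_Icc.2 h, right_mem_Icc.2 h]

variable [LinearOrder α] {s : Bool} {l r x : α}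

theorem HalfIn.mem_Icc (h : HalfIn s l r x) : x ∈ Icc l r := by
  cases s
  exacts [⟨h.1.le, h.2⟩, ⟨h.1, h.2.le⟩]

theorem HalfIn.mono {l' r' : α} (h : HalfIn s l r x) (hl : l' ≤ l) (hr : r ≤ r') :
    HalfIn s l' r' x := by
  cases s
  exacts [⟨hl.trans_lt h.1, h.2.trans hr⟩, ⟨hl.trans h.1, h.2.trans_le hr⟩]

theorem halfIn_of_mem_Ioo (s : Bool) (h : x ∈ Ioo l r) : HalfIn s l r x := by
  cases s
  exacts [⟨h.1, h.2.le⟩, ⟨h.1.le, h.2⟩]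

theorem exists_halfIn (h : l < r) (hx : x ∈ Icc l r) : ∃ s, HalfIn s l r x := by
  rcases hx.1.eq_or_lt with rfl | hlx
  exacts [⟨true, le_rfl, h⟩, ⟨false, hlx, hx.2⟩]

theorem halfIn_endpoint (s : Bool) (h : l < r) : HalfIn (!s) l r (endpoint s l r) := by
  cases s
  exacts [⟨le_rfl, h⟩, ⟨h, le_rfl⟩]

theorem not_halfIn_endpoint (s : Bool) (l r : α) : ¬ HalfIn s l r (endpoint s l r) := by
  cases s
  exacts [fun h => h.1.false, fun h => h.2.false]

theorem HalfIn.eq_endpoint (h : HalfIn s l r x) (h' : ¬ HalfIn (!s) l r x) :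
    endpoint (!s) l r = x := by
  cases s
  · exact h.2.antisymm' (not_lt.1 fun hx => h' ⟨h.1.le, hx⟩)
  · exact h.1.antisymm (not_lt.1 fun hx => h' ⟨hx, h.2.le⟩)

variable [TopologicalSpace α]

theorem nhdsSide_le_nhds (s : Bool) (x : α) : nhdsSide s x ≤ 𝓝 x := by
  cases s <;> exact nhdsWithin_le_nhds

variable [OrderTopology α]

instance [DenselyOrdered α] [NoMaxOrder α] [NoMinOrder α] (s : Bool) (x : α) :
    (nhdsSide s x).NeBot := by
  cases s
  exacts [nhdsLT_neBot x, nhdsGT_neBot x]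

theorem HalfIn.eventually (h : HalfIn s l r x) : ∀ᶠ y in nhdsSide s x, y ∈ Ioo l r := by
  cases s
  exacts [Ioo_mem_nhdsLT_of_mem h, Ioo_mem_nhdsGT_of_mem h]

theorem HalfIn.of_frequently (h : ∃ᶠ y in nhdsSide s x, y ∈ Icc l r) : HalfIn s l r x := by
  have hx : x ∈ Icc l r :=
    isClosed_Icc.closure_subset
      (mem_closure_iff_frequently.2 (h.filter_mono (nhdsSide_le_nhds s x)))
  cases s
  · obtain ⟨y, hy, hyx⟩ := (h.and_eventually self_mem_nhdsWithin).exists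
    exact ⟨hy.1.trans_lt hyx, hx.2⟩
  · obtain ⟨y, hy, hxy⟩ := (h.and_eventually self_mem_nhdsWithin).exists
    exact ⟨hx.1, hxy.trans_le hy.2⟩

end HalfIn

/-! ### Squares and the four squares around a point -/

namespace Square

/-- Abscissa of the left edge. -/
def x0 (q : Square) : ℝ := q.corner.re

/-- Abscissa of the right edge. -/
def x1 (q : Square) : ℝ := q.corner.re + q.side

/-- Ordinate of the lower edge. -/
def y0 (q : Square) : ℝ := q.corner.im

/-- Ordinate of the upper edge. -/
def y1 (q : Square) : ℝ := q.corner.im + q.side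

/-- The square contains the points next to `p` in the open quadrant at `p` that lies east or west
according to `s` and north or south according to `t`. -/
def Germ (q : Square) (s t : Bool) (p : ℂ) : Prop :=
  HalfIn s q.x0 q.x1 p.re ∧ HalfIn t q.y0 q.y1 p.im

theorem x1_eq (q : Square) : q.x1 = q.x0 + q.side := rfl

theorem y1_eq (q : Square) : q.y1 = q.y0 + q.side := rfl

theorem x0_lt_x1 (q : Square) : q.x0 < q.x1 := lt_add_of_pos_right _ q.side_pos

theorem y0_lt_y1 (q : Square) : q.y0 < q.y1 := lt_add_of_pos_right _ q.side_pos

variable {q : Square} {p : ℂ}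

theorem mem_region : p ∈ q.region ↔ p.re ∈ Icc q.x0 q.x1 ∧ p.im ∈ Icc q.y0 q.y1 := Iff.rfl

theorem mem_interior_region :
    p ∈ interior q.region ↔ p.re ∈ Ioo q.x0 q.x1 ∧ p.im ∈ Ioo q.y0 q.y1 := by
  rw [region, interior_reProdIm, interior_Icc, interior_Icc]
  rfl

theorem isCompact_region (q : Square) : IsCompact q.region :=
  isCompact_Icc.reProdIm isCompact_Icc

theorem Germ.mem_region {s t : Bool} (h : q.Germ s t p) : p ∈ q.region :=
  ⟨h.1.mem_Icc, h.2.mem_Icc⟩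

theorem exists_germ (h : p ∈ q.region) : ∃ s t, q.Germ s t p := by
  obtain ⟨s, hs⟩ := exists_halfIn q.x0_lt_x1 (mem_region.1 h).1
  obtain ⟨t, ht⟩ := exists_halfIn q.y0_lt_y1 (mem_region.1 h).2
  exact ⟨s, t, hs, ht⟩

end Square

namespace SquareTiling

theorem exists_germ (T : SquareTiling) (p : ℂ) (s t : Bool) :
    ∃ q : T.squares, q.1.Germ s t p := by
  set F := nhdsSide s p.re ×ˢ nhdsSide t p.im
  have hF : Tendsto (fun z : ℝ × ℝ => (⟨z.1, z.2⟩ : ℂ)) F (𝓝 p) := by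
    refine equivRealProdCLM.symm.continuous.tendsto' (p.re, p.im) p rfl |>.mono_left ?_
    rw [nhds_prod_eq]
    exact Filter.prod_mono (nhdsSide_le_nhds _ _) (nhdsSide_le_nhds _ _)
  have hfin := T.locallyFinite _ (isCompact_closedBall p 1)
  obtain ⟨q, hq, hqF⟩ : ∃ q ∈ T.squares, ∃ᶠ z : ℝ × ℝ in F, (⟨z.1, z.2⟩ : ℂ) ∈ q.region := by
    by_contra! hcon
    obtain ⟨z, hz, hball⟩ := (((eventually_all_finite hfin).2 fun q hq => hcon q hq.1).and
      (hF (Metric.closedBall_mem_nhds p one_pos))).exists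
    obtain ⟨q, hq, hzq⟩ := T.cover ⟨z.1, z.2⟩
    exact hz q ⟨hq, _, hzq, hball⟩ hzq
  exact ⟨⟨q, hq⟩, .of_frequently (tendsto_fst.frequently (hqF.mono fun _ hz => hz.1)),
    .of_frequently (tendsto_snd.frequently (hqF.mono fun _ hz => hz.2))⟩

variable {T : SquareTiling} {p : ℂ} {s t : Bool}

theorem eq_of_germ {q q' : T.squares} (h : q.1.Germ s t p) (h' : q'.1.Germ s t p) : q = q' := by
  by_contra hne
  obtain ⟨x, hx, hx'⟩ := (h.1.eventually.and h'.1.eventually).exists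
  obtain ⟨y, hy, hy'⟩ := (h.2.eventually.and h'.2.eventually).exists
  exact Set.disjoint_left.1 (T.disjoint q.1 q.2 q'.1 q'.2 fun e => hne (Subtype.ext e))
    (show (⟨x, y⟩ : ℂ) ∈ _ from Square.mem_interior_region.2 ⟨hx, hy⟩)
    (Square.mem_interior_region.2 ⟨hx', hy'⟩)

/-- The square of the tiling that contains the points next to `p` in a given quadrant, with the
conventions of `Square.Germ`. -/
def germ (T : SquareTiling) (p : ℂ) (s t : Bool) : T.squares := (T.exists_germ p s t).choose

theorem germ_spec (T : SquareTiling) (p : ℂ) (s t : Bool) : (T.germ p s t).1.Germ s t p :=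
  (T.exists_germ p s t).choose_spec

theorem eq_germ {q : T.squares} (h : q.1.Germ s t p) : q = T.germ p s t :=
  eq_of_germ h (T.germ_spec p s t)

theorem exists_eq_germ {q : T.squares} (h : p ∈ q.1.region) : ∃ s t, q = T.germ p s t := by
  obtain ⟨s, t, hst⟩ := Square.exists_germ h
  exact ⟨s, t, eq_germ hst⟩

theorem germ_region (T : SquareTiling) (p : ℂ) (s t : Bool) : p ∈ (T.germ p s t).1.region :=
  (T.germ_spec p s t).mem_region

/-- The abscissa of a vertical edge. -/
def vEdgeX (a : T.squares × Bool) : ℝ := endpoint (!a.2) a.1.1.x0 a.1.1.x1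

/-- The ordinate of a horizontal edge. -/
def hEdgeY (a : T.squares × Bool) : ℝ := endpoint a.2 a.1.1.y0 a.1.1.y1

theorem mem_vEdge {a : T.squares × Bool} :
    p ∈ T.vEdge a ↔ p.re = vEdgeX a ∧ p.im ∈ Icc a.1.1.y0 a.1.1.y1 := by
  obtain ⟨q, _ | _⟩ := a <;> rfl

theorem mem_hEdge {a : T.squares × Bool} :
    p ∈ T.hEdge a ↔ p.re ∈ Icc a.1.1.x0 a.1.1.x1 ∧ p.im = hEdgeY a := by
  obtain ⟨q, _ | _⟩ := a <;> rfl

theorem vEdge_subset (a : T.squares × Bool) : T.vEdge a ⊆ a.1.1.region := fun p hp => by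
  rw [mem_vEdge] at hp
  exact Square.mem_region.2 ⟨hp.1 ▸ endpoint_mem_Icc _ a.1.1.x0_lt_x1.le, hp.2⟩

theorem hEdge_subset (a : T.squares × Bool) : T.hEdge a ⊆ a.1.1.region := fun p hp => by
  rw [mem_hEdge] at hp
  exact Square.mem_region.2 ⟨hp.1, hp.2 ▸ endpoint_mem_Icc _ a.1.1.y0_lt_y1.le⟩

theorem germ_corner (q : T.squares) (s t : Bool) :
    q.1.Germ s (!t) ⟨vEdgeX (q, s), hEdgeY (q, t)⟩ := by
  have hx := halfIn_endpoint (!s) q.1.x0_lt_x1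
  rw [Bool.not_not] at hx
  exact ⟨hx, halfIn_endpoint t q.1.y0_lt_y1⟩

theorem vEdgeX_germ (h : T.germ p s t ≠ T.germ p (!s) t) : vEdgeX (T.germ p s t, s) = p.re :=
  (T.germ_spec p s t).1.eq_endpoint fun hx => h (eq_germ ⟨hx, (T.germ_spec p s t).2⟩)

theorem hEdgeY_germ (h : T.germ p s t ≠ T.germ p s (!t)) : hEdgeY (T.germ p s t, !t) = p.im :=
  (T.germ_spec p s t).2.eq_endpoint fun hy => h (eq_germ ⟨(T.germ_spec p s t).1, hy⟩)

theorem germ_eq_of_mem_Ioo_re (hp : p.re ∈ Ioo (T.germ p s t).1.x0 (T.germ p s t).1.x1) :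
    T.germ p s t = T.germ p (!s) t :=
  eq_germ ⟨halfIn_of_mem_Ioo _ hp, (T.germ_spec p s t).2⟩

theorem germ_eq_of_mem_Ioo_im (hp : p.im ∈ Ioo (T.germ p s t).1.y0 (T.germ p s t).1.y1) :
    T.germ p s t = T.germ p s (!t) :=
  eq_germ ⟨(T.germ_spec p s t).1, halfIn_of_mem_Ioo _ hp⟩

/-! ### Singular points -/

theorem mem_singular_iff :
    p ∈ T.singular ↔ Function.Injective fun st : Bool × Bool => T.germ p st.1 st.2 := by
  have hrange : {q ∈ T.squares | p ∈ q.region} =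
      (fun st : Bool × Bool => (T.germ p st.1 st.2).1) '' univ := by
    ext q
    rw [image_univ]
    constructor
    · rintro ⟨hq, hp⟩
      obtain ⟨s, t, hst⟩ := exists_eq_germ (q := ⟨q, hq⟩) hp
      exact ⟨(s, t), (congrArg Subtype.val hst).symm⟩
    · rintro ⟨st, rfl⟩
      exact ⟨(T.germ p st.1 st.2).2, T.germ_region p _ _⟩
  have hcard : (univ : Set (Bool × Bool)).ncard = 4 := by simp [ncard_univ]
  rw [singular, mem_ofPred_eq, hrange, ← hcard, Set.ncard_image_iff (toFinite _), injOn_univ]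
  exact Subtype.val_injective.of_comp_iff _

theorem re_notMem_Ioo_of_singular (hp : p ∈ T.singular) {q : T.squares} (hq : p ∈ q.1.region) :
    p.re ∉ Ioo q.1.x0 q.1.x1 := fun hre => by
  obtain ⟨s, t, rfl⟩ := exists_eq_germ hq
  simpa using mem_singular_iff.1 hp (a₁ := (s, t)) (a₂ := (!s, t)) (germ_eq_of_mem_Ioo_re hre)

theorem im_notMem_Ioo_of_singular (hp : p ∈ T.singular) {q : T.squares} (hq : p ∈ q.1.region) :
    p.im ∉ Ioo q.1.y0 q.1.y1 := fun him => by
  obtain ⟨s, t, rfl⟩ := exists_eq_germ hq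
  simpa using mem_singular_iff.1 hp (a₁ := (s, t)) (a₂ := (s, !t)) (germ_eq_of_mem_Ioo_im him)

theorem mem_singular_of_ne (hre : ∀ s t, T.germ p s t ≠ T.germ p (!s) t)
    (him : ∀ s t, T.germ p s t ≠ T.germ p s (!t)) : p ∈ T.singular := by
  have hdiag (s t) : T.germ p s t ≠ T.germ p (!s) (!t) := fun e => by
    have hx := (T.germ_spec p (!s) (!t)).1
    rw [← e, ← vEdgeX_germ (hre s t)] at hx
    exact not_halfIn_endpoint _ _ _ hx
  refine mem_singular_iff.2 fun ⟨s, t⟩ ⟨s', t'⟩ e => ?_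
  rcases Bool.eq_or_eq_not s' s with rfl | rfl <;> rcases Bool.eq_or_eq_not t' t with rfl | rfl
  exacts [rfl, (him _ _ e).elim, (hre _ _ e).elim, (hdiag _ _ e).elim]

/-! ### Horizontal and vertical faces -/

variable {c : T.FaceChoice}

theorem iff_of_quot_mk_eq {α : Type*} {r : α → α → Prop} {P : α → Prop}
    (hP : ∀ a b, r a b → (P a ↔ P b)) {a b : α} (hab : Quot.mk r a = Quot.mk r b) : P a ↔ P b :=
  iff_of_eq (congrArg (Quot.lift P fun a b h => propext (hP a b h)) hab)

/-- The horizontal face of a horizontal edge, so `topFace c q = hFace c (q, true)` and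
`bottomFace c q = hFace c (q, false)`. -/
def hFace (c : T.FaceChoice) (a : T.squares × Bool) : HFace c := Quot.mk _ a

/-- The vertical face of a vertical edge, so `leftFace c q = vFace c (q, true)` and
`rightFace c q = vFace c (q, false)`. -/
def vFace (c : T.FaceChoice) (a : T.squares × Bool) : VFace c := Quot.mk _ a

/-- The ordinate of a horizontal face. -/
def HFace.y (h : HFace c) : ℝ :=
  Quot.lift hEdgeY (fun _ _ ⟨_, hp, _⟩ => (mem_hEdge.1 hp.1).2.symm.trans (mem_hEdge.1 hp.2).2) h

/-- The abscissa of a vertical face. -/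
def VFace.x (f : VFace c) : ℝ :=
  Quot.lift vEdgeX (fun _ _ ⟨_, hp, _⟩ => (mem_vEdge.1 hp.1).1.symm.trans (mem_vEdge.1 hp.2).1) f

theorem y_hFace (a : T.squares × Bool) : (hFace c a).y = hEdgeY a := rfl

theorem topFace_ne_bottomFace (q : T.squares) : topFace c q ≠ bottomFace c q := fun h =>
  q.1.y0_lt_y1.ne' (congrArg HFace.y h)

theorem HLink.symm {a b : T.squares × Bool} : HLink c a b → HLink c b a :=
  fun ⟨z, hz, hzc⟩ => ⟨z, hz.symm, hzc⟩

theorem VLink.symm {a b : T.squares × Bool} : VLink c a b → VLink c b a :=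
  fun ⟨z, hz, hzc⟩ => ⟨z, hz.symm, hzc⟩

theorem hFace_germ_eq (h : T.germ p s t ≠ T.germ p s (!t)) :
    hFace c (T.germ p s t, !t) = hFace c (T.germ p s (!t), t) := by
  have hgerm := T.germ_spec p s t
  have hgerm' := T.germ_spec p s (!t)
  have hy' : hEdgeY (T.germ p s (!t), t) = p.im := by
    simpa only [Bool.not_not] using
      hEdgeY_germ (t := !t) (by simpa only [Bool.not_not] using h.symm)
  obtain ⟨x, hx, hx'⟩ := (hgerm.1.eventually.and hgerm'.1.eventually).exists
  refine Quot.sound ⟨⟨x, p.im⟩, ⟨?_, ?_⟩, fun hsing => ?_⟩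
  · exact mem_hEdge.2 ⟨Ioo_subset_Icc_self hx, (hEdgeY_germ h).symm⟩
  · exact mem_hEdge.2 ⟨Ioo_subset_Icc_self hx', hy'.symm⟩
  · exact re_notMem_Ioo_of_singular hsing.1 ⟨Ioo_subset_Icc_self hx, hgerm.2.mem_Icc⟩ hx

theorem vFace_germ_eq (h : T.germ p s t ≠ T.germ p (!s) t) :
    vFace c (T.germ p s t, s) = vFace c (T.germ p (!s) t, !s) := by
  have hgerm := T.germ_spec p s t
  have hgerm' := T.germ_spec p (!s) t
  have hx' : vEdgeX (T.germ p (!s) t, !s) = p.re :=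
    vEdgeX_germ (s := !s) (by simpa only [Bool.not_not] using h.symm)
  obtain ⟨y, hy, hy'⟩ := (hgerm.2.eventually.and hgerm'.2.eventually).exists
  refine Quot.sound ⟨⟨p.re, y⟩, ⟨?_, ?_⟩, fun hsing => ?_⟩
  · exact mem_vEdge.2 ⟨(vEdgeX_germ h).symm, Ioo_subset_Icc_self hy⟩
  · exact mem_vEdge.2 ⟨hx'.symm, Ioo_subset_Icc_self hy'⟩
  · exact im_notMem_Ioo_of_singular (c.horiz_subset hsing)
      ⟨hgerm.1.mem_Icc, Ioo_subset_Icc_self hy⟩ hy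

theorem le_of_mem_Icc_of_notMem_Ioo {l r l' r' x z : ℝ} (hz : z ∈ Icc l r) (hz' : z ∈ Icc l' r')
    (hne : z ≠ x) (hx : x ∉ Ioo l' r') (hr : r ≤ x) : r' ≤ x :=
  not_lt.1 fun hxr => hx ⟨hz'.1.trans_lt (lt_of_le_of_ne (hz.2.trans hr) hne), hxr⟩

theorem x1_le_re_of_hFace_eq (hp : p ∈ T.singular \ c.horiz) {a b : T.squares × Bool}
    (hab : hFace c a = hFace c b) (ha : hEdgeY a = p.im) (ha' : a.1.1.x1 ≤ p.re) :
    b.1.1.x1 ≤ p.re := by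
  have key (a b) (hlink : HLink c a b) (ha : hEdgeY a = p.im ∧ a.1.1.x1 ≤ p.re) :
      hEdgeY b = p.im ∧ b.1.1.x1 ≤ p.re := by
    obtain ⟨z, ⟨hza, hzb⟩, hz⟩ := hlink
    rw [mem_hEdge] at hza hzb
    have him : z.im = p.im := hza.2.trans ha.1
    refine ⟨hzb.2.symm.trans him, le_of_mem_Icc_of_notMem_Ioo hza.1 hzb.1
      (fun hre => hz (Complex.ext hre him ▸ hp)) (fun hre => ?_) ha.2⟩
    have hpb : p ∈ T.hEdge b := mem_hEdge.2 ⟨Ioo_subset_Icc_self hre, him.symm.trans hzb.2⟩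
    exact re_notMem_Ioo_of_singular hp.1 (hEdge_subset b hpb) hre
  exact ((iff_of_quot_mk_eq (fun a b h => ⟨key a b h, key b a h.symm⟩) hab).1 ⟨ha, ha'⟩).2

theorem y1_le_im_of_vFace_eq (hp : p ∈ c.horiz) {a b : T.squares × Bool}
    (hab : vFace c a = vFace c b) (ha : vEdgeX a = p.re) (ha' : a.1.1.y1 ≤ p.im) :
    b.1.1.y1 ≤ p.im := by
  have key (a b) (hlink : VLink c a b) (ha : vEdgeX a = p.re ∧ a.1.1.y1 ≤ p.im) :
      vEdgeX b = p.re ∧ b.1.1.y1 ≤ p.im := by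
    obtain ⟨z, ⟨hza, hzb⟩, hz⟩ := hlink
    rw [mem_vEdge] at hza hzb
    have hre : z.re = p.re := hza.1.trans ha.1
    refine ⟨hzb.1.symm.trans hre, le_of_mem_Icc_of_notMem_Ioo hza.2 hzb.2
      (fun him => hz (Complex.ext hre him ▸ hp)) (fun him => ?_) ha.2⟩
    have hpb : p ∈ T.vEdge b := mem_vEdge.2 ⟨hre.symm.trans hzb.1, Ioo_subset_Icc_self him⟩
    exact im_notMem_Ioo_of_singular (c.horiz_subset hp) (vEdge_subset b hpb) him
  exact ((iff_of_quot_mk_eq (fun a b h => ⟨key a b h, key b a h.symm⟩) hab).1 ⟨ha, ha'⟩).2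

end SquareTiling

/-! ### The segment of a horizontal face -/

namespace SquareTiling

variable {T : SquareTiling} {c : T.FaceChoice}

theorem exists_hFace (h : HFace c) : ∃ a, hFace c a = h := Quot.exists_rep h

theorem exists_vFace (f : VFace c) : ∃ a, vFace c a = f := Quot.exists_rep f

theorem hFace_ne_hFace_not (q : T.squares) (b : Bool) : hFace c (q, b) ≠ hFace c (q, !b) := by
  cases b
  exacts [(topFace_ne_bottomFace q).symm, topFace_ne_bottomFace q]

namespace HFace

/-- The squares that have a horizontal edge in the given face. -/
def squares (h : HFace c) : Set T.squares := {q | ∃ b, hFace c (q, b) = h}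

/-- The left end of a horizontal face. -/
def lo (h : HFace c) : ℝ := sInf ((fun q => q.1.x0) '' h.squares)

/-- The right end of a horizontal face. -/
def hi (h : HFace c) : ℝ := sSup ((fun q => q.1.x1) '' h.squares)

/-- The left (`s = true`) or right (`s = false`) end of a horizontal face, with the convention of
`vEdge`. -/
def endX (h : HFace c) (s : Bool) : ℝ := endpoint (!s) h.lo h.hi

/-- A quarter of the size of the smallest square at a horizontal face. -/
def gap (h : HFace c) : ℝ := sInf ((fun q => q.1.side) '' h.squares) / 4

theorem squares_nonempty (h : HFace c) : h.squares.Nonempty := by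
  obtain ⟨⟨q, b⟩, hq⟩ := exists_hFace h
  exact ⟨q, b, hq⟩

theorem y_mem_Icc {h : HFace c} {q : T.squares} (hq : q ∈ h.squares) :
    h.y ∈ Icc q.1.y0 q.1.y1 := by
  obtain ⟨b, rfl⟩ := hq
  exact endpoint_mem_Icc _ q.1.y0_lt_y1.le

theorem not_halfIn_endX (h : HFace c) (s : Bool) : ¬ HalfIn (!s) h.lo h.hi (h.endX s) :=
  not_halfIn_endpoint _ _ _

end HFace

namespace EdgeFiniteFor

theorem finite_squares (hc : EdgeFiniteFor c) (h : HFace c) : h.squares.Finite :=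
  ((hc.1 h).image Prod.fst).subset fun q ⟨b, hb⟩ => ⟨(q, b), hb, rfl⟩

variable {h : HFace c} {q : T.squares}

theorem lo_le_x0 (hc : EdgeFiniteFor c) (hq : q ∈ h.squares) : h.lo ≤ q.1.x0 :=
  csInf_le ((hc.finite_squares h).image _).bddBelow (mem_image_of_mem _ hq)

theorem x1_le_hi (hc : EdgeFiniteFor c) (hq : q ∈ h.squares) : q.1.x1 ≤ h.hi :=
  le_csSup ((hc.finite_squares h).image _).bddAbove (mem_image_of_mem _ hq)

theorem four_gap_le_side (hc : EdgeFiniteFor c) (hq : q ∈ h.squares) : 4 * h.gap ≤ q.1.side := by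
  rw [HFace.gap, mul_div_cancel₀ _ four_ne_zero]
  exact csInf_le ((hc.finite_squares h).image _).bddBelow
    (mem_image_of_mem (fun q : T.squares => q.1.side) hq)

theorem exists_x0_eq_lo (hc : EdgeFiniteFor c) (h : HFace c) : ∃ q ∈ h.squares, q.1.x0 = h.lo :=
  (h.squares_nonempty.image _).csInf_mem ((hc.finite_squares h).image _)

theorem exists_x1_eq_hi (hc : EdgeFiniteFor c) (h : HFace c) : ∃ q ∈ h.squares, q.1.x1 = h.hi :=
  (h.squares_nonempty.image _).csSup_mem ((hc.finite_squares h).image _)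

theorem gap_pos (hc : EdgeFiniteFor c) (h : HFace c) : 0 < h.gap := by
  obtain ⟨q, -, hq⟩ := (h.squares_nonempty.image fun q => q.1.side).csInf_mem
    ((hc.finite_squares h).image _)
  exact div_pos (q.1.side_pos.trans_eq hq) four_pos

theorem lo_add_four_gap_le_hi (hc : EdgeFiniteFor c) (h : HFace c) : h.lo + 4 * h.gap ≤ h.hi := by
  obtain ⟨q, hq⟩ := h.squares_nonempty
  linarith [hc.lo_le_x0 hq, hc.x1_le_hi hq, hc.four_gap_le_side hq, q.1.x1_eq]

theorem lo_lt_hi (hc : EdgeFiniteFor c) (h : HFace c) : h.lo < h.hi := by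
  linarith [hc.lo_add_four_gap_le_hi h, hc.gap_pos h]

theorem halfIn_endX (hc : EdgeFiniteFor c) (h : HFace c) (s : Bool) :
    HalfIn s h.lo h.hi (h.endX s) := by
  simpa only [Bool.not_not, HFace.endX] using halfIn_endpoint (!s) (hc.lo_lt_hi h)

theorem exists_mem_Icc_x (hc : EdgeFiniteFor c) {x : ℝ} (hx : x ∈ Icc h.lo h.hi) :
    ∃ q ∈ h.squares, x ∈ Icc q.1.x0 q.1.x1 := by
  by_contra! hcon
  have key (a b) (hlink : HLink c a b) (ha : hFace c a = h ∧ a.1.1.x1 < x) :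
      hFace c b = h ∧ b.1.1.x1 < x := by
    have hb : hFace c b = h := (Quot.sound hlink.symm).trans ha.1
    obtain ⟨p, ⟨hpa, hpb⟩, -⟩ := hlink
    have hx0 : b.1.1.x0 ≤ x := by linarith [(mem_hEdge.1 hpa).1.2, (mem_hEdge.1 hpb).1.1]
    exact ⟨hb, not_le.1 fun hx1 => hcon b.1 ⟨b.2, hb⟩ ⟨hx0, hx1⟩⟩
  obtain ⟨q, ⟨t, hq⟩, hq0⟩ := hc.exists_x0_eq_lo h
  obtain ⟨q', ⟨t', hq'⟩, hq1⟩ := hc.exists_x1_eq_hi h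
  have hqx : q.1.x1 < x := not_le.1 fun hx1 => hcon q ⟨t, hq⟩ ⟨hq0.trans_le hx.1, hx1⟩
  have hqx' := ((iff_of_quot_mk_eq (fun a b h => ⟨key a b h, key b a h.symm⟩)
    (hq.trans hq'.symm)).1 ⟨hq, hqx⟩).2
  exact absurd hx.2 (not_le.2 (hq1 ▸ hqx'))

theorem exists_halfIn_x (hc : EdgeFiniteFor c) {s : Bool} {x : ℝ} (hx : HalfIn s h.lo h.hi x) :
    ∃ q ∈ h.squares, HalfIn s q.1.x0 q.1.x1 x := by
  by_contra! hcon
  obtain ⟨y, hy, hyh⟩ := (((eventually_all_finite (hc.finite_squares h)).2 fun q hq =>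
    not_frequently.1 fun hfr => hcon q hq (.of_frequently hfr)).and hx.eventually).exists
  obtain ⟨q, hq, hyq⟩ := hc.exists_mem_Icc_x (Ioo_subset_Icc_self hyh)
  exact hy q hq hyq

theorem hFace_germ (hc : EdgeFiniteFor c) {s : Bool} {p : ℂ} (hp : HalfIn s h.lo h.hi p.re)
    (hy : p.im = h.y) (t : Bool) : hFace c (T.germ p s t, !t) = h := by
  obtain ⟨q, ⟨b, rfl⟩, hx⟩ := hc.exists_halfIn_x hp
  have hq : q = T.germ p s (!b) := eq_germ ⟨hx, hy ▸ halfIn_endpoint b q.1.y0_lt_y1⟩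
  rcases Bool.eq_or_eq_not t b with rfl | rfl
  · rw [hFace_germ_eq, ← hq]
    intro e
    have hpy := (T.germ_spec p s t).2
    rw [e, ← hq, hy] at hpy
    exact not_halfIn_endpoint _ _ _ hpy
  · rw [← hq, Bool.not_not]

theorem germ_ne_germ_not (hc : EdgeFiniteFor c) {s : Bool} {p : ℂ}
    (hp : HalfIn s h.lo h.hi p.re) (hy : p.im = h.y) (t : Bool) :
    T.germ p s t ≠ T.germ p s (!t) := fun e => by
  have htop := hc.hFace_germ hp hy (!t)
  rw [← e, Bool.not_not] at htop
  exact hFace_ne_hFace_not _ _ (htop.trans (hc.hFace_germ hp hy t).symm)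

/-- If the vertical direction were broken at an end of `h`, then `h` would continue beyond it. -/
theorem endX_notMem_horiz (hc : EdgeFiniteFor c) (h : HFace c) (s : Bool) :
    (⟨h.endX s, h.y⟩ : ℂ) ∉ c.horiz := fun hp => by
  set p : ℂ := ⟨h.endX s, h.y⟩
  have hface : hFace c (T.germ p s true, false) = h :=
    hc.hFace_germ (hc.halfIn_endX h s) rfl true
  have hne : T.germ p (!s) true ≠ T.germ p (!s) false := fun e => by
    simpa using mem_singular_iff.1 (c.horiz_subset hp) (a₁ := (!s, true)) (a₂ := (!s, false)) e
  have hface' : hFace c (T.germ p (!s) true, false) = h := by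
    refine (Quot.sound ⟨p, ⟨?_, ?_⟩, fun hh => hh.2 hp⟩).trans hface
    · exact mem_hEdge.2 ⟨(T.germ_spec p (!s) true).1.mem_Icc, (hEdgeY_germ hne).symm⟩
    · exact mem_hEdge.2 ⟨(T.germ_spec p s true).1.mem_Icc, congrArg HFace.y hface.symm⟩
  exact h.not_halfIn_endX s ((T.germ_spec p (!s) true).1.mono
    (hc.lo_le_x0 ⟨false, hface'⟩) (hc.x1_le_hi ⟨false, hface'⟩))

theorem exists_neighbour (hc : EdgeFiniteFor c) {s : Bool} (hq : q ∈ h.squares)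
    (hx : vEdgeX (q, s) ≠ h.endX s) :
    ∃ q' ∈ h.squares, vEdgeX (q', !s) = vEdgeX (q, s) ∧ vFace c (q, s) = vFace c (q', !s) := by
  obtain ⟨t, rfl⟩ := id hq
  set p : ℂ := ⟨vEdgeX (q, s), hEdgeY (q, t)⟩
  have hgerm := germ_corner q s t
  have hqp : q = T.germ p s (!t) := eq_germ hgerm
  have hp : HalfIn (!s) (hFace c (q, t)).lo (hFace c (q, t)).hi p.re := by
    by_contra hcon
    exact hx ((hgerm.1.mono (hc.lo_le_x0 hq) (hc.x1_le_hi hq)).eq_endpoint hcon).symm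
  have hne : T.germ p s (!t) ≠ T.germ p (!s) (!t) := fun e => by
    have hpx := (T.germ_spec p (!s) (!t)).1
    rw [← e, ← hqp] at hpx
    exact not_halfIn_endpoint _ _ _ hpx
  refine ⟨T.germ p (!s) (!t), ⟨t, ?_⟩, ?_, ?_⟩
  · simpa only [Bool.not_not] using hc.hFace_germ hp rfl (!t)
  · exact vEdgeX_germ (s := !s) (by simpa only [Bool.not_not] using hne.symm)
  · rw [← vFace_germ_eq hne, ← hqp]

theorem vEdgeX_eq_endX (hc : EdgeFiniteFor c) {s : Bool} (hq : q ∈ h.squares)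
    (hx : |vEdgeX (q, s) - h.endX s| < h.gap) : vEdgeX (q, s) = h.endX s := by
  by_contra hne
  obtain ⟨q', hq', he, -⟩ := hc.exists_neighbour hq hne
  have hlo := hc.lo_le_x0 hq'
  have hhi := hc.x1_le_hi hq'
  have hgap := hc.four_gap_le_side hq'
  have hpos := hc.gap_pos h
  rw [abs_lt] at hx
  cases s <;> simp only [vEdgeX, HFace.endX, endpoint, Bool.not_true, Bool.not_false, cond_true,
    cond_false] at hx he <;> linarith [q'.1.x1_eq]

theorem vFace_eq_of_endX (hc : EdgeFiniteFor c) {s : Bool} {q' : T.squares} (hq : q ∈ h.squares)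
    (hq' : q' ∈ h.squares) (hx : vEdgeX (q, s) = h.endX s) (hx' : vEdgeX (q', s) = h.endX s) :
    vFace c (q, s) = vFace c (q', s) :=
  Quot.sound ⟨⟨h.endX s, h.y⟩, ⟨mem_vEdge.2 ⟨hx.symm, HFace.y_mem_Icc hq⟩,
    mem_vEdge.2 ⟨hx'.symm, HFace.y_mem_Icc hq'⟩⟩, hc.endX_notMem_horiz h s⟩

end EdgeFiniteFor

theorem sum_sub_eq_of_pairwiseDisjoint {ι : Type*} (s : Finset ι) (l r : ι → ℝ) (a b : ℝ)
    (hab : a ≤ b) (hlr : ∀ i ∈ s, l i ≤ r i)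
    (hd : (s : Set ι).PairwiseDisjoint fun i => Ico (l i) (r i))
    (hU : ⋃ i ∈ s, Ico (l i) (r i) = Ico a b) : ∑ i ∈ s, (r i - l i) = b - a := by
  have hvol := MeasureTheory.measure_biUnion_finset (μ := MeasureTheory.volume) hd
    fun i _ => measurableSet_Ico
  rw [hU, Real.volume_Ico, Finset.sum_congr rfl fun i _ => Real.volume_Ico,
    ← ENNReal.ofReal_sum_of_nonneg fun i hi => sub_nonneg.2 (hlr i hi)] at hvol
  exact ((ENNReal.ofReal_eq_ofReal_iff (sub_nonneg.2 hab)
    (Finset.sum_nonneg fun i hi => sub_nonneg.2 (hlr i hi))).1 hvol).symm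

theorem germ_of_mem_Ico {h : HFace c} {q : T.squares} {b : Bool} {x : ℝ}
    (hq : hFace c (q, b) = h) (hx : x ∈ Ico q.1.x0 q.1.x1) : q.1.Germ true (!b) ⟨x, h.y⟩ :=
  ⟨hx, hq ▸ halfIn_endpoint b q.1.y0_lt_y1⟩

namespace EdgeFiniteFor

theorem iUnion_Ico (hc : EdgeFiniteFor c) (h : HFace c) (b : Bool) :
    ⋃ q ∈ {q : T.squares | hFace c (q, b) = h}, Ico q.1.x0 q.1.x1 = Ico h.lo h.hi := by
  refine (iUnion₂_subset fun q hq => ?_).antisymm fun x hx => mem_iUnion₂.2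
    ⟨T.germ ⟨x, h.y⟩ true (!b), ?_, (T.germ_spec ⟨x, h.y⟩ true (!b)).1⟩
  · exact Ico_subset_Ico (hc.lo_le_x0 ⟨b, hq⟩) (hc.x1_le_hi ⟨b, hq⟩)
  · simpa only [Bool.not_not, mem_ofPred_eq] using
      hc.hFace_germ (s := true) (p := ⟨x, h.y⟩) hx rfl (!b)

theorem finsum_side (hc : EdgeFiniteFor c) (h : HFace c) (b : Bool) :
    ∑ᶠ (q : T.squares) (_ : hFace c (q, b) = h), q.1.side = h.hi - h.lo := by
  have hfin : {q : T.squares | hFace c (q, b) = h}.Finite :=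
    (hc.finite_squares h).subset fun q hq => ⟨b, hq⟩
  refine (finsum_mem_eq_finite_toFinset_sum (fun q : T.squares => q.1.side) hfin).trans ?_
  rw [Finset.sum_congr rfl fun q _ => (sub_eq_of_eq_add' q.1.x1_eq).symm]
  refine sum_sub_eq_of_pairwiseDisjoint _ _ _ _ _ (hc.lo_lt_hi h).le
    (fun q _ => q.1.x0_lt_x1.le) (fun q hq q' hq' hne => ?_) ?_
  · rw [Finite.coe_toFinset] at hq hq'
    exact Set.disjoint_left.2 fun x hx hx' =>
      hne (eq_of_germ (germ_of_mem_Ico hq hx) (germ_of_mem_Ico hq' hx'))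
  · simpa only [Finite.mem_toFinset] using hc.iUnion_Ico h b

theorem exists_rel_x0_eq_lo (hc : EdgeFiniteFor c) {r : T.squares → T.squares → Prop}
    (hr : Equivalence r) (hv : ∀ a b, vFace c a = vFace c b → r a.1 b.1) {h : HFace c}
    {q : T.squares} (hq : q ∈ h.squares) :
    ∃ q' ∈ h.squares, q'.1.x0 = h.lo ∧ r q q' := by
  obtain ⟨q', ⟨hq', hr'⟩, hmin⟩ := exists_min_image {q' ∈ h.squares | r q q'} (fun q => q.1.x0)
    ((hc.finite_squares h).subset (sep_subset _ _)) ⟨q, hq, hr.refl q⟩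
  refine ⟨q', hq', by_contra fun hne => ?_, hr'⟩
  obtain ⟨q₂, hq₂, hx, hf⟩ := hc.exists_neighbour (s := true) hq' hne
  exact (q₂.1.x0_lt_x1.trans_eq hx).not_ge (hmin q₂ ⟨hq₂, hr.trans hr' (hv _ _ hf)⟩)

theorem rel_of_hFace (hc : EdgeFiniteFor c) {r : T.squares → T.squares → Prop}
    (hr : Equivalence r) (hv : ∀ a b, vFace c a = vFace c b → r a.1 b.1) (a b : T.squares × Bool)
    (hab : hFace c a = hFace c b) : r a.1 b.1 := by
  obtain ⟨q, hq, hqx, hqr⟩ := hc.exists_rel_x0_eq_lo hr hv (q := a.1) ⟨a.2, hab⟩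
  obtain ⟨q', hq', hqx', hqr'⟩ := hc.exists_rel_x0_eq_lo hr hv (q := b.1) ⟨b.2, rfl⟩
  have hqq' := hv (q, true) (q', true) (hc.vFace_eq_of_endX hq hq' hqx hqx')
  exact hr.trans hqr (hr.trans hqq' (hr.symm hqr'))

end EdgeFiniteFor

end SquareTiling

/-! ### Rotation by 90 degrees -/

namespace Square

theorem x0_rotate (q : Square) : q.rotate.x0 = -q.y1 := by
  simp only [x0, y1, rotate, sub_re, I_mul_re, ofReal_re]
  ring

theorem x1_rotate (q : Square) : q.rotate.x1 = -q.y0 := by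
  simp only [x1, y0, rotate, sub_re, I_mul_re, ofReal_re, sub_add_cancel]

theorem y0_rotate (q : Square) : q.rotate.y0 = q.x0 := by
  simp only [y0, x0, rotate, sub_im, I_mul_im, ofReal_im, sub_zero]

theorem y1_rotate (q : Square) : q.rotate.y1 = q.x1 :=
  congrArg (· + q.side) q.y0_rotate

theorem rotate_injective : Function.Injective rotate := fun q q' h =>
  have hre : q.x0 = q'.x0 := by simpa only [y0_rotate] using congrArg y0 h
  have him : q.y0 = q'.y0 := by simpa only [x1_rotate, neg_inj] using congrArg x1 h
  Square.ext (Complex.ext hre him) (congrArg side h : q.rotate.side = q'.rotate.side)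

theorem mem_region_rotate {q : Square} {p : ℂ} : I * p ∈ q.rotate.region ↔ p ∈ q.region := by
  rw [region_rotate]
  exact (mul_right_injective₀ I_ne_zero).mem_set_image

theorem corner_mem_region (q : Square) : q.corner ∈ q.region :=
  ⟨left_mem_Icc.2 q.x0_lt_x1.le, left_mem_Icc.2 q.y0_lt_y1.le⟩

end Square

namespace SquareTiling

variable {T : SquareTiling} {p : ℂ}

/-- The correspondence between the squares of a tiling and those of the rotated tiling. -/
def rotateEquiv (T : SquareTiling) : T.squares ≃ T.rotate.squares :=
  Equiv.Set.image Square.rotate T.squares Square.rotate_injective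

theorem rotateEquiv_val (q : T.squares) : (T.rotateEquiv q).1 = q.1.rotate := rfl

theorem mem_singular_rotate : I * p ∈ T.rotate.singular ↔ p ∈ T.singular := by
  have himage : {q ∈ T.rotate.squares | I * p ∈ q.region} =
      Square.rotate '' {q ∈ T.squares | p ∈ q.region} := by
    ext q'
    constructor
    · rintro ⟨⟨q, hq, rfl⟩, hp⟩
      exact ⟨q, ⟨hq, Square.mem_region_rotate.1 hp⟩, rfl⟩
    · rintro ⟨q, ⟨hq, hp⟩, rfl⟩
      exact ⟨⟨q, hq, rfl⟩, Square.mem_region_rotate.2 hp⟩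
  rw [singular, singular, mem_ofPred_eq, mem_ofPred_eq, himage,
    Set.ncard_image_of_injective _ Square.rotate_injective]

theorem mul_I_surjective : Function.Surjective fun p : ℂ => I * p := fun z =>
  ⟨-I * z, by simp [← mul_assoc]⟩

/-- The choice of faces of the rotated tiling that corresponds to a choice of faces. -/
def FaceChoice.rotate (c : T.FaceChoice) : T.rotate.FaceChoice where
  horiz := (fun z => I * z) '' (T.singular \ c.horiz)
  horiz_subset := by
    rintro _ ⟨p, hp, rfl⟩
    exact mem_singular_rotate.2 hp.1

variable {c : T.FaceChoice}

theorem mem_horiz_rotate : I * p ∈ c.rotate.horiz ↔ p ∈ T.singular \ c.horiz :=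
  (mul_right_injective₀ I_ne_zero).mem_set_image

theorem mem_singular_diff_horiz_rotate :
    I * p ∈ T.rotate.singular \ c.rotate.horiz ↔ p ∈ c.horiz := by
  rw [Set.mem_sdiff, mem_singular_rotate, mem_horiz_rotate, Set.mem_sdiff, not_and_not_right]
  exact ⟨fun h => h.2 h.1, fun h => ⟨c.horiz_subset h, fun _ => h⟩⟩

/-- Vertical edges become horizontal edges. -/
def vEdgeRotate (T : SquareTiling) : T.squares × Bool ≃ T.rotate.squares × Bool :=
  T.rotateEquiv.prodCongr Equiv.boolNot

/-- Horizontal edges become vertical edges. -/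
def hEdgeRotate (T : SquareTiling) : T.squares × Bool ≃ T.rotate.squares × Bool :=
  T.rotateEquiv.prodCongr (Equiv.refl Bool)

theorem mem_hEdge_rotate {a : T.squares × Bool} :
    I * p ∈ T.rotate.hEdge (T.vEdgeRotate a) ↔ p ∈ T.vEdge a := by
  obtain ⟨q, b⟩ := a
  rw [mem_hEdge, mem_vEdge, and_comm]
  cases b <;>
    simp [hEdgeY, vEdgeX, endpoint, vEdgeRotate, rotateEquiv_val, Square.x0_rotate,
      Square.x1_rotate, Square.y0_rotate, Square.y1_rotate, and_comm]

theorem mem_vEdge_rotate {a : T.squares × Bool} :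
    I * p ∈ T.rotate.vEdge (T.hEdgeRotate a) ↔ p ∈ T.hEdge a := by
  obtain ⟨q, b⟩ := a
  rw [mem_hEdge, mem_vEdge, and_comm]
  cases b <;>
    simp [hEdgeY, vEdgeX, endpoint, hEdgeRotate, rotateEquiv_val, Square.x0_rotate,
      Square.x1_rotate, Square.y0_rotate, Square.y1_rotate]

theorem hLink_rotate (a b : T.squares × Bool) :
    HLink c.rotate (T.vEdgeRotate a) (T.vEdgeRotate b) ↔ VLink c a b :=
  mul_I_surjective.exists.trans (exists_congr fun _ => and_congr
    (and_congr mem_hEdge_rotate mem_hEdge_rotate) (not_congr mem_singular_diff_horiz_rotate))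

theorem vLink_rotate (a b : T.squares × Bool) :
    VLink c.rotate (T.hEdgeRotate a) (T.hEdgeRotate b) ↔ HLink c a b :=
  mul_I_surjective.exists.trans (exists_congr fun _ => and_congr
    (and_congr mem_vEdge_rotate mem_vEdge_rotate) (not_congr mem_horiz_rotate))

/-- Vertical faces become horizontal faces. -/
def vFaceRotate (c : T.FaceChoice) : VFace c ≃ HFace c.rotate :=
  Quot.congr T.vEdgeRotate fun a b => (hLink_rotate a b).symm

/-- Horizontal faces become vertical faces. -/
def hFaceRotate (c : T.FaceChoice) : HFace c ≃ VFace c.rotate :=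
  Quot.congr T.hEdgeRotate fun a b => (vLink_rotate a b).symm

/-! ### Vertical faces, by rotation -/

namespace EdgeFiniteFor

theorem rotate (hc : EdgeFiniteFor c) : EdgeFiniteFor c.rotate := by
  refine ⟨fun h => ?_, fun f => ?_⟩
  · obtain ⟨f, rfl⟩ := (vFaceRotate c).surjective h
    refine ((hc.2 f).image T.vEdgeRotate).subset fun a' ha' => ?_
    obtain ⟨a, rfl⟩ := T.vEdgeRotate.surjective a'
    exact ⟨a, (vFaceRotate c).injective ha', rfl⟩
  · obtain ⟨h, rfl⟩ := (hFaceRotate c).surjective f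
    refine ((hc.1 h).image T.hEdgeRotate).subset fun a' ha' => ?_
    obtain ⟨a, rfl⟩ := T.hEdgeRotate.surjective a'
    exact ⟨a, (hFaceRotate c).injective ha', rfl⟩

theorem finsum_side_vFace (hc : EdgeFiniteFor c) (f : VFace c) (b : Bool) :
    ∑ᶠ (q : T.squares) (_ : vFace c (q, b) = f), q.1.side =
      (vFaceRotate c f).hi - (vFaceRotate c f).lo := by
  rw [← hc.rotate.finsum_side _ (!b), ← finsum_comp_equiv T.rotateEquiv]
  refine finsum_congr fun q => ?_
  have hiff : vFace c (q, b) = f ↔ hFace c.rotate (T.rotateEquiv q, !b) = vFaceRotate c f :=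
    (vFaceRotate c).injective.eq_iff.symm
  rw [propext hiff]
  rfl

theorem rel_of_vFace (hc : EdgeFiniteFor c) {r : T.squares → T.squares → Prop}
    (hr : Equivalence r) (hh : ∀ a b, hFace c a = hFace c b → r a.1 b.1)
    (a b : T.squares × Bool) (hab : vFace c a = vFace c b) : r a.1 b.1 := by
  have hrot := hc.rotate.rel_of_hFace (hr.comap T.rotateEquiv.symm) (fun a' b' hab' => ?_)
    (T.vEdgeRotate a) (T.vEdgeRotate b) (congrArg (vFaceRotate c) hab)
  · simpa [vEdgeRotate, Function.onFun] using hrot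
  · obtain ⟨a, rfl⟩ := T.hEdgeRotate.surjective a'
    obtain ⟨b, rfl⟩ := T.hEdgeRotate.surjective b'
    simpa [hEdgeRotate, Function.onFun] using hh a b ((hFaceRotate c).injective hab')

end EdgeFiniteFor

/-! ### Connectedness of the tiling -/

theorem isClosed_iUnion_of_subset_region {ι : Type*} (T : SquareTiling) (f : ι → T.squares)
    (hf : ∀ q, (f ⁻¹' {q}).Finite) (A : ι → Set ℂ) (hA : ∀ i, A i ⊆ (f i).1.region)
    (hcl : ∀ i, IsClosed (A i)) : IsClosed (⋃ i, A i) := by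
  refine LocallyFinite.isClosed_iUnion (fun p => ⟨Metric.closedBall p 1,
    Metric.closedBall_mem_nhds p one_pos, ?_⟩) hcl
  have hfin : {q : T.squares | (q.1.region ∩ Metric.closedBall p 1).Nonempty}.Finite :=
    ((T.locallyFinite _ (isCompact_closedBall p 1)).preimage
      Subtype.val_injective.injOn).subset fun q hq => ⟨q.2, hq⟩
  exact (hfin.preimage' (f := f) fun q _ => hf q).subset fun i ⟨z, hz, hz'⟩ => ⟨z, hA i hz, hz'⟩

theorem rel_of_forall_mem_region {r : T.squares → T.squares → Prop} (hr : Equivalence r)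
    (hpt : ∀ (p : ℂ) (q q' : T.squares), p ∈ q.1.region → p ∈ q'.1.region → r q q')
    (q q' : T.squares) : r q q' := by
  have hcl (P : T.squares → Prop) : IsClosed (⋃ i : {q // P q}, i.1.1.region) :=
    T.isClosed_iUnion_of_subset_region Subtype.val
      (fun _ => (subsingleton_singleton.preimage Subtype.val_injective).finite) _
      (fun _ => subset_rfl) fun i => i.1.1.isCompact_region.isClosed
  have hcover (p : ℂ) : p ∈ (⋃ i : {q' // r q q'}, i.1.1.region) ∪
      ⋃ i : {q' // ¬ r q q'}, i.1.1.region := by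
    obtain ⟨q', hq', hp⟩ := T.cover p
    by_cases h : r q ⟨q', hq'⟩
    exacts [.inl (mem_iUnion.2 ⟨⟨_, h⟩, hp⟩), .inr (mem_iUnion.2 ⟨⟨_, h⟩, hp⟩)]
  by_contra hcon
  obtain ⟨p, -, hp, hp'⟩ := isPreconnected_closed_iff.1 (isPreconnected_univ (α := ℂ)) _ _
    (hcl (r q)) (hcl fun q' => ¬ r q q') (fun p _ => hcover p)
    ⟨_, mem_univ _, mem_iUnion.2 ⟨⟨q, hr.refl q⟩, q.1.corner_mem_region⟩⟩
    ⟨_, mem_univ _, mem_iUnion.2 ⟨⟨q', hcon⟩, q'.1.corner_mem_region⟩⟩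
  obtain ⟨⟨a, ha⟩, hpa⟩ := mem_iUnion.1 hp
  obtain ⟨⟨b, hb⟩, hpb⟩ := mem_iUnion.1 hp'
  exact hb (hr.trans ha (hpt p a b hpa hpb))

theorem EdgeFiniteFor.rel_of_hFace_rel (hc : EdgeFiniteFor c) {r : T.squares → T.squares → Prop}
    (hr : Equivalence r) (hh : ∀ a b, hFace c a = hFace c b → r a.1 b.1) (q q' : T.squares) :
    r q q' := by
  refine rel_of_forall_mem_region hr (fun p q q' hq hq' => ?_) q q'
  obtain ⟨s, t, rfl⟩ := exists_eq_germ hq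
  obtain ⟨s', t', rfl⟩ := exists_eq_germ hq'
  have hre (t) : r (T.germ p s t) (T.germ p s' t) := by
    by_cases e : T.germ p s t = T.germ p s' t
    · exact e ▸ hr.refl _
    · obtain rfl := (Bool.eq_or_eq_not s' s).resolve_left fun h => e (h ▸ rfl)
      exact hc.rel_of_vFace hr hh (_, s) (_, !s) (vFace_germ_eq e)
  have him (s) : r (T.germ p s t) (T.germ p s t') := by
    by_cases e : T.germ p s t = T.germ p s t'
    · exact e ▸ hr.refl _
    · obtain rfl := (Bool.eq_or_eq_not t' t).resolve_left fun h => e (h ▸ rfl)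
      exact hh (_, !t) (_, t) (hFace_germ_eq e)
  exact hr.trans (hre t) (him s')

/-! ### A horizontal and a vertical face determine a square -/

theorem eq_of_hFace_eq_of_vFace_eq {q q' : T.squares} {s t : Bool}
    (hh : hFace c (q, t) = hFace c (q', t)) (hv : vFace c (q, s) = vFace c (q', s)) : q = q' := by
  have hx : vEdgeX (q, s) = vEdgeX (q', s) := congrArg VFace.x hv
  have hy : hEdgeY (q, t) = hEdgeY (q', t) := congrArg HFace.y hh
  exact eq_of_germ (germ_corner q s t) (hx ▸ hy ▸ germ_corner q' s t)

theorem germ_ne_of_vEdgeX_eq {s t : Bool} (h : vEdgeX (T.germ p s t, s) = p.re) :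
    T.germ p s t ≠ T.germ p (!s) t := fun e =>
  not_halfIn_endpoint _ _ _ (h ▸ e ▸ (T.germ_spec p (!s) t).1)

theorem germ_ne_of_hEdgeY_eq {s t : Bool} (h : hEdgeY (T.germ p s t, !t) = p.im) :
    T.germ p s t ≠ T.germ p s (!t) := fun e =>
  not_halfIn_endpoint _ _ _ (h ▸ e ▸ (T.germ_spec p s (!t)).2)

/-- Otherwise `q` and `q'` would be opposite squares at a singular point through which both faces
pass. -/
theorem leftFace_ne_rightFace_of_topFace_eq {q q' : T.squares}
    (hh : topFace c q = bottomFace c q') : leftFace c q ≠ rightFace c q' := fun hv => by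
  have hx : vEdgeX (q, true) = vEdgeX (q', false) := congrArg VFace.x hv
  have hy : hEdgeY (q, true) = hEdgeY (q', false) := congrArg HFace.y hh
  set p : ℂ := ⟨vEdgeX (q, true), hEdgeY (q, true)⟩
  have hq : q = T.germ p true false := eq_germ (germ_corner q true true)
  have hq' : q' = T.germ p false true := eq_germ (by
    simpa only [p, hx, hy, Bool.not_false] using germ_corner q' false false)
  have hre := germ_ne_of_vEdgeX_eq (p := p) (s := true) (t := false) (by rw [← hq])
  have hre' := germ_ne_of_vEdgeX_eq (p := p) (s := false) (t := true) (hq' ▸ hx.symm)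
  have him := germ_ne_of_hEdgeY_eq (p := p) (s := true) (t := false) (by rw [← hq]; rfl)
  have him' := germ_ne_of_hEdgeY_eq (p := p) (s := false) (t := true) (hq' ▸ hy.symm)
  have hsing : p ∈ T.singular := by
    refine mem_singular_of_ne ?_ ?_ <;> rintro (_ | _) (_ | _)
    exacts [hre.symm, hre', hre, hre'.symm, him'.symm, him', him, him.symm]
  by_cases hp : p ∈ c.horiz
  · exact (y1_le_im_of_vFace_eq hp hv rfl le_rfl).not_gt (hy.trans_lt q'.1.y0_lt_y1)
  · exact (x1_le_re_of_hFace_eq ⟨hsing, hp⟩ hh.symm hy.symm hx.ge).not_gt q.1.x0_lt_x1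

end SquareTiling

/-! ### Polygonal lines -/

theorem polyLine_cons_cons (a b : ℂ) (l : List ℂ) :
    polyLine (a :: b :: l) = segment ℝ a b ∪ polyLine (b :: l) := by
  ext x
  constructor
  · rintro ⟨p, q, h, hx⟩
    rcases List.infix_cons_iff.1 h with h | h
    · rw [List.cons_prefix_cons, List.cons_prefix_cons] at h
      obtain ⟨rfl, rfl, -⟩ := h
      exact .inl hx
    · exact .inr ⟨p, q, h, hx⟩
  · rintro (hx | ⟨p, q, h, hx⟩)
    · exact ⟨a, b, ⟨[], l, rfl⟩, hx⟩
    · exact ⟨p, q, List.infix_cons_iff.2 (.inr h), hx⟩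

theorem polyLine_eq_empty {l : List ℂ} (hl : l.length ≤ 1) : polyLine l = ∅ :=
  eq_empty_of_forall_notMem fun _ ⟨_, _, h, _⟩ => absurd (h.length_le.trans hl) (by simp)

theorem polyLine_singleton (a : ℂ) : polyLine [a] = ∅ := polyLine_eq_empty le_rfl

theorem isCompact_polyLine : ∀ l : List ℂ, IsCompact (polyLine l)
  | [] => polyLine_eq_empty (l := []) (Nat.zero_le 1) ▸ isCompact_empty
  | [a] => polyLine_singleton a ▸ isCompact_empty
  | a :: b :: l => by
    rw [polyLine_cons_cons, ← convexHull_pair]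
    exact (((finite_singleton b).insert a).isCompact_convexHull ℝ).union
      (isCompact_polyLine (b :: l))

theorem polyLine_reverse (l : List ℂ) : polyLine l.reverse = polyLine l := by
  have key (l : List ℂ) : polyLine l ⊆ polyLine l.reverse := by
    rintro x ⟨p, q, h, hx⟩
    exact ⟨q, p, by simpa using List.reverse_infix.2 h, by rwa [segment_symm]⟩
  exact Subset.antisymm (by simpa only [List.reverse_reverse] using key l.reverse) (key l)

theorem mem_polyLine_of_mem : ∀ {l : List ℂ} {x : ℂ}, 2 ≤ l.length → x ∈ l → x ∈ polyLine l
  | [], _, h, _ => by simp at h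
  | [_], _, h, _ => by simp at h
  | [a, b], x, _, hx => by
    rw [polyLine_cons_cons]
    rcases List.mem_pair.1 hx with rfl | rfl
    exacts [.inl (left_mem_segment ℝ _ _), .inl (right_mem_segment ℝ _ _)]
  | a :: b :: c :: l, x, _, hx => by
    rw [polyLine_cons_cons]
    rcases List.mem_cons.1 hx with rfl | hx
    exacts [.inl (left_mem_segment ℝ _ _), .inr (mem_polyLine_of_mem (by simp) hx)]

namespace IsPolyArc

variable {x : ℂ}

theorem two_le_length : ∀ {l : List ℂ}, IsPolyArc l → 2 ≤ l.length
  | [], h => h.elim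
  | [_], h => h.elim
  | _ :: _ :: _, _ => by simp

theorem head_notMem : ∀ {l : List ℂ}, IsPolyArc (x :: l) → x ∉ l
  | [], _ => List.not_mem_nil
  | [_], h => mt List.mem_singleton.1 h
  | b :: _ :: _, h => fun hx => h.1 (h.2.1.subset
      ⟨left_mem_segment ℝ x b, mem_polyLine_of_mem (by simp) hx⟩)

theorem nodup : ∀ {l : List ℂ}, IsPolyArc l → l.Nodup
  | [], h => h.elim
  | [_], h => h.elim
  | [_, _], h => List.nodup_cons.2 ⟨h.head_notMem, List.nodup_singleton _⟩
  | _ :: _ :: _ :: _, h => List.nodup_cons.2 ⟨h.head_notMem, nodup h.2.2⟩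

theorem head_notMem_polyLine_tail : ∀ {l : List ℂ}, IsPolyArc l → l.head? = some x →
    x ∉ polyLine l.tail
  | [], h, _ => h.elim
  | [_], h, _ => h.elim
  | [_, b], _, _ => polyLine_singleton b ▸ notMem_empty x
  | a :: b :: _ :: _, h, hx => Option.some.inj hx ▸ fun ha =>
      h.1 (h.2.1.subset ⟨left_mem_segment ℝ a b, ha⟩)

theorem getLast_notMem_polyLine_dropLast : ∀ {l : List ℂ}, IsPolyArc l → l.getLast? = some x →
    x ∉ polyLine l.dropLast
  | [], h, _ => h.elim
  | [_], h, _ => h.elim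
  | [a, _], _, _ => polyLine_singleton a ▸ notMem_empty x
  | a :: b :: d :: l, h, hx => by
    rw [List.getLast?_cons_cons] at hx
    rw [List.dropLast_cons_cons, List.dropLast_cons_cons, polyLine_cons_cons]
    rintro (hx' | hx')
    · have hxb : x = b := h.2.1.subset
        ⟨hx', mem_polyLine_of_mem (by simp) (List.mem_of_getLast? hx)⟩
      rw [List.getLast?_cons_cons] at hx
      exact h.2.2.head_notMem (hxb ▸ List.mem_of_getLast? hx)
    · exact getLast_notMem_polyLine_dropLast h.2.2 hx hx'

end IsPolyArc

namespace PlaneGraph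

variable (M : PlaneGraph)

theorem exists_ends (e : M.E) : ∃ u v : M.V, u ≠ v ∧ (M.path e).head? = some (M.pos u) ∧
    (M.path e).getLast? = some (M.pos v) ∧ ∀ x : M.V, M.Inc x e ↔ x = u ∨ x = v := by
  obtain ⟨u, v, hu, hv, h⟩ := M.ends e
  have harc := M.isPolyArc e
  refine ⟨u, v, ?_, hu, hv, fun x => ⟨h x, ?_⟩⟩
  · rintro rfl
    match hl : M.path e, harc with
    | a :: b :: l, harc =>
      rw [hl, List.getLast?_cons_cons] at hv
      rw [hl, List.head?_cons, Option.some.injEq] at hu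
      exact harc.head_notMem (hu ▸ List.mem_of_getLast? hv)
  · rintro (rfl | rfl)
    exacts [mem_polyLine_of_mem harc.two_le_length (List.mem_of_head? hu),
      mem_polyLine_of_mem harc.two_le_length (List.mem_of_getLast? hv)]

variable {M} {v : M.V} {e : M.E}

theorem pathFrom_of_head (h : (M.path e).head? = some (M.pos v)) : M.pathFrom v e = M.path e :=
  if_pos h

theorem pathFrom_of_getLast (h : (M.path e).getLast? = some (M.pos v)) :
    M.pathFrom v e = (M.path e).reverse := by
  obtain ⟨u, v', huv, hu, hv', -⟩ := M.exists_ends e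
  refine if_neg fun h' => huv (M.pos_injective ?_)
  exact (Option.some.inj (hu.symm.trans h')).trans (Option.some.inj (h.symm.trans hv'))

theorem exists_other_end (h : M.Inc v e) :
    ∃ v', v' ≠ v ∧ M.Inc v' e ∧ M.pathFrom v' e = (M.pathFrom v e).reverse := by
  obtain ⟨u, u', huu, hu, hu', hinc⟩ := M.exists_ends e
  rcases (hinc v).1 h with rfl | rfl
  · refine ⟨u', huu.symm, (hinc u').2 (.inr rfl), ?_⟩
    rw [pathFrom_of_getLast hu', pathFrom_of_head hu]
  · refine ⟨u, huu, (hinc u).2 (.inl rfl), ?_⟩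
    rw [pathFrom_of_getLast hu', pathFrom_of_head hu, List.reverse_reverse]

theorem polyLine_pathFrom (v : M.V) (e : M.E) : polyLine (M.pathFrom v e) = M.arc e := by
  rw [pathFrom]
  split_ifs
  exacts [rfl, polyLine_reverse _]

theorem nodup_pathFrom (v : M.V) (e : M.E) : (M.pathFrom v e).Nodup := by
  rw [pathFrom]
  split_ifs
  exacts [(M.isPolyArc e).nodup, List.nodup_reverse.2 (M.isPolyArc e).nodup]

theorem two_le_length_pathFrom (v : M.V) (e : M.E) : 2 ≤ (M.pathFrom v e).length := by
  rw [pathFrom]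
  split_ifs
  exacts [(M.isPolyArc e).two_le_length, List.length_reverse.symm ▸ (M.isPolyArc e).two_le_length]

theorem head?_pathFrom (h : M.Inc v e) : (M.pathFrom v e).head? = some (M.pos v) := by
  obtain ⟨u, u', -, hu, hu', hinc⟩ := M.exists_ends e
  rcases (hinc v).1 h with rfl | rfl
  · rwa [pathFrom_of_head hu]
  · rwa [pathFrom_of_getLast hu', List.head?_reverse]

theorem notMem_polyLine_tail_pathFrom (h : M.Inc v e) :
    M.pos v ∉ polyLine (M.pathFrom v e).tail := by
  obtain ⟨u, u', -, hu, hu', hinc⟩ := M.exists_ends e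
  rcases (hinc v).1 h with rfl | rfl
  · rw [pathFrom_of_head hu]
    exact (M.isPolyArc e).head_notMem_polyLine_tail hu
  · rw [pathFrom_of_getLast hu', List.tail_reverse, polyLine_reverse]
    exact (M.isPolyArc e).getLast_notMem_polyLine_dropLast hu'

theorem exists_pathFrom_eq (h : M.Inc v e) :
    ∃ (q : ℂ) (l : List ℂ), M.pathFrom v e = M.pos v :: q :: l ∧ q ≠ M.pos v ∧
      M.pos v ∉ polyLine (q :: l) := by
  have hlen := two_le_length_pathFrom v e
  have hhead := head?_pathFrom h
  have hnodup := nodup_pathFrom v e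
  have htail := notMem_polyLine_tail_pathFrom h
  match hl : M.pathFrom v e, hlen with
  | a :: q :: l, _ =>
    rw [hl] at hhead hnodup htail
    obtain rfl : a = M.pos v := Option.some.inj hhead
    exact ⟨q, l, rfl, fun hq => (List.nodup_cons.1 hnodup).1 (hq ▸ List.mem_cons_self), htail⟩

end PlaneGraph

/-! ### The order of the edges around a vertex -/

/-- The angle, in `(0, 2π]`, of a counterclockwise turn from the direction `u` to the direction
`w`. -/
def turnAngle (u w : ℂ) : ℝ := toIocMod Real.two_pi_pos 0 (arg w - arg u)

theorem turnAngle_mem_Ioc (u w : ℂ) : turnAngle u w ∈ Ioc 0 (2 * Real.pi) := by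
  simpa only [zero_add, turnAngle] using toIocMod_mem_Ioc Real.two_pi_pos 0 (arg w - arg u)

theorem turnAngle_eq_ite (u w : ℂ) :
    turnAngle u w = if arg u < arg w then arg w - arg u else arg w - arg u + 2 * Real.pi := by
  have hu := arg_mem_Ioc u
  have hw := arg_mem_Ioc w
  simp only [mem_Ioc] at hu hw
  refine (toIocMod_eq_iff _).2 ⟨?_, ?_⟩
  · split_ifs <;> constructor <;> linarith
  · split_ifs
    exacts [⟨0, by simp⟩, ⟨-1, by simp⟩]

theorem turnAngle_eq_two_pi_iff {u w : ℂ} : turnAngle u w = 2 * Real.pi ↔ arg w = arg u := by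
  have hu := neg_pi_lt_arg u
  have hw := arg_le_pi w
  rw [turnAngle_eq_ite]
  split_ifs with h <;> constructor <;> intro <;> linarith

theorem ccw_iff {u v w : ℂ} (h : arg w ≠ arg u) : Ccw u v w ↔ turnAngle u v < turnAngle u w := by
  have hu := arg_mem_Ioc u
  have hv := arg_mem_Ioc v
  have hw := arg_mem_Ioc w
  simp only [mem_Ioc] at hu hv hw
  rw [Ccw, turnAngle_eq_ite, turnAngle_eq_ite]
  constructor
  · rintro (⟨_, _⟩ | ⟨_, _⟩ | ⟨_, _⟩) <;> split_ifs <;> linarith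
  · rcases lt_or_gt_of_ne h with h | h <;> split_ifs with huv <;> intro hlt
    · linarith
    · exact .inr (.inr ⟨h, huv⟩)
    · linarith
    · exact .inr (.inl ⟨by linarith, h⟩)
    · exact .inl ⟨huv, by linarith⟩
    · linarith

theorem not_ccw_self (u v : ℂ) : ¬ Ccw u v u := by
  rintro (⟨_, _⟩ | ⟨_, _⟩ | ⟨_, _⟩) <;> linarith

theorem turnAngle_eq_of_polar {u w : ℂ} {ρ α : ℝ} (hρ : 0 < ρ) (hα : α ∈ Ioc 0 (2 * Real.pi))
    (h : (ρ : ℂ) * exp ((arg u + α : ℝ) * I) = w) : turnAngle u w = α := by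
  have hnorm : ‖w‖ = ρ := by
    rw [← h, norm_mul, norm_exp_ofReal_mul_I, mul_one, norm_real, Real.norm_of_nonneg hρ.le]
  have hexp : exp (arg w * I) = exp ((arg u + α : ℝ) * I) := by
    refine mul_left_cancel₀ (ofReal_ne_zero.2 hρ.ne') ?_
    rw [h, ← hnorm, norm_mul_exp_arg_mul_I]
  obtain ⟨n, hn⟩ := exp_eq_exp_iff_exists_int.1 hexp
  have harg : arg w = arg u + α + n * (2 * Real.pi) := by
    have hI : (arg w : ℂ) * I = ((arg u + α + n * (2 * Real.pi) : ℝ) : ℂ) * I := by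
      rw [hn]; push_cast; ring
    exact_mod_cast mul_right_cancel₀ I_ne_zero hI
  refine (toIocMod_eq_iff _).2 ⟨by rwa [zero_add], n, ?_⟩
  rw [harg, zsmul_eq_mul]
  ring

theorem norm_mul_exp_arg_add_turnAngle (u w : ℂ) :
    (‖w‖ : ℂ) * exp ((arg u + turnAngle u w : ℝ) * I) = w := by
  rw [turnAngle_eq_ite]
  split_ifs
  · rw [add_sub_cancel, norm_mul_exp_arg_mul_I]
  · rw [show ((arg u + (arg w - arg u + 2 * Real.pi) : ℝ) : ℂ) * I =
      arg w * I + 2 * Real.pi * I by push_cast; ring, exp_periodic, norm_mul_exp_arg_mul_I]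

theorem tendsto_arg_add_mul_I {s : ℝ} (hs : 0 < s) :
    Tendsto (fun ε : ℝ => arg (s + ε * I)) (𝓝 0) (𝓝 0) := by
  have hslit : (s : ℂ) + ((0 : ℝ) : ℂ) * I ∈ slitPlane := by simp [slitPlane, hs]
  have harg : arg ((s : ℂ) + (0 : ℝ) * I) = 0 := by simp [arg_ofReal_of_nonneg hs.le]
  have h : Tendsto (fun ε : ℝ => (s : ℂ) + ε * I) (𝓝 0) (𝓝 (s + (0 : ℝ) * I)) :=
    Continuous.tendsto (by fun_prop) 0
  simpa only [harg, Function.comp_def] using (continuousAt_arg hslit).tendsto.comp h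

theorem arg_add_mul_I_pos {s ε : ℝ} (hε : 0 < ε) : 0 < arg (s + ε * I) := by
  refine lt_of_le_of_ne (arg_nonneg_iff.2 (by simpa using hε.le)) fun h => ?_
  simpa [hε.ne'] using (arg_eq_zero_iff.1 h.symm).2

theorem arg_add_mul_I_neg {s ε : ℝ} (hε : ε < 0) : arg (s + ε * I) < 0 :=
  arg_neg_iff.2 (by simpa using hε)

theorem eventually_mem_segment {u w : ℂ} (hu : u ≠ 0) (hw : w ≠ 0) (h : arg u = arg w) (z : ℂ) :
    ∀ᶠ s : ℝ in 𝓝[>] 0, z + s * u ∈ segment ℝ z (z + w) := by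
  have hκ : 0 < ‖w‖ / ‖u‖ := div_pos (norm_pos_iff.2 hw) (norm_pos_iff.2 hu)
  filter_upwards [self_mem_nhdsWithin, mem_nhdsWithin_of_mem_nhds (Iio_mem_nhds hκ)]
    with s (hs : 0 < s) (hsκ : s < ‖w‖ / ‖u‖)
  rw [segment_eq_image']
  refine ⟨s / (‖w‖ / ‖u‖), ⟨by positivity, (div_le_one hκ).2 hsκ.le⟩, ?_⟩
  have hu' : (‖u‖ : ℂ) ≠ 0 := by simpa using hu
  have hw' : (‖w‖ : ℂ) ≠ 0 := by simpa using hw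
  simp only [add_sub_cancel_left, real_smul, add_right_inj]
  push_cast
  nth_rewrite 2 [← (arg_eq_arg_iff hu hw).1 h]
  field_simp

/-- The open sector with apex `z`, radius `r` and angles between `α` and `β`. -/
def sector (z : ℂ) (r α β : ℝ) : Set ℂ :=
  (fun x : ℝ × ℝ => z + x.1 * exp (x.2 * I)) '' Ioo 0 r ×ˢ Ioo α β

theorem isPreconnected_sector (z : ℂ) (r α β : ℝ) : IsPreconnected (sector z r α β) :=
  ((convex_Ioo 0 r).prod (convex_Ioo α β)).isPreconnected.image _
    (Continuous.continuousOn (by fun_prop))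

theorem sector_nonempty {z : ℂ} {r α β : ℝ} (hr : 0 < r) (h : α < β) :
    (sector z r α β).Nonempty :=
  ((nonempty_Ioo.2 hr).prod (nonempty_Ioo.2 h)).image _

theorem add_mul_mem_sector {z w y : ℂ} {r α β θ : ℝ} (hw : (‖w‖ : ℂ) * exp (θ * I) = w)
    (hr : ‖w * y‖ ∈ Ioo 0 r) (hθ : θ + arg y ∈ Ioo α β) : z + w * y ∈ sector z r α β := by
  refine ⟨(‖w * y‖, θ + arg y), ⟨hr, hθ⟩, ?_⟩
  conv_rhs => rw [← hw, ← norm_mul_exp_arg_mul_I y]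
  push_cast [norm_mul]
  rw [add_mul, exp_add]
  ring

theorem eventually_norm_mul_mem_Ioo {w : ℂ} {s r : ℝ} (hw : w ≠ 0) (hs : 0 < s)
    (hr : ‖w‖ * s < r) : ∀ᶠ ε : ℝ in 𝓝 0, ‖w * (s + ε * I)‖ ∈ Ioo 0 r := by
  have h : Tendsto (fun ε : ℝ => ‖w * (s + ε * I)‖) (𝓝 0) (𝓝 (‖w‖ * s)) := by
    have h0 : ‖w * (s + ((0 : ℝ) : ℂ) * I)‖ = ‖w‖ * s := by
      rw [ofReal_zero, zero_mul, add_zero, norm_mul, norm_real, Real.norm_of_nonneg hs.le]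
    exact h0 ▸ Continuous.tendsto (by fun_prop) 0
  exact h (Ioo_mem_nhds (by have := norm_pos_iff.2 hw; positivity) hr)

theorem eventually_mem_sector_left {z w : ℂ} {r s θ β : ℝ} (hw : (‖w‖ : ℂ) * exp (θ * I) = w)
    (hw0 : w ≠ 0) (hs : 0 < s) (hr : ‖w‖ * s < r) (hβ : θ < β) :
    ∀ᶠ ε : ℝ in 𝓝[>] 0, z + w * (s + ε * I) ∈ sector z r θ β := by
  filter_upwards [self_mem_nhdsWithin,
    mem_nhdsWithin_of_mem_nhds (eventually_norm_mul_mem_Ioo hw0 hs hr),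
    mem_nhdsWithin_of_mem_nhds (tendsto_arg_add_mul_I hs (Iio_mem_nhds (sub_pos.2 hβ)))]
    with ε hε hnorm (harg : arg (s + ε * I) < β - θ)
  have hpos : 0 < arg (s + ε * I) := arg_add_mul_I_pos hε
  exact add_mul_mem_sector hw hnorm ⟨by linarith, by linarith⟩

theorem eventually_mem_sector_right {z w : ℂ} {r s θ α : ℝ} (hw : (‖w‖ : ℂ) * exp (θ * I) = w)
    (hw0 : w ≠ 0) (hs : 0 < s) (hr : ‖w‖ * s < r) (hα : α < θ) :
    ∀ᶠ ε : ℝ in 𝓝[<] 0, z + w * (s + ε * I) ∈ sector z r α θ := by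
  filter_upwards [self_mem_nhdsWithin,
    mem_nhdsWithin_of_mem_nhds (eventually_norm_mul_mem_Ioo hw0 hs hr),
    mem_nhdsWithin_of_mem_nhds (tendsto_arg_add_mul_I hs (Ioi_mem_nhds (sub_neg.2 hα)))]
    with ε hε hnorm (harg : α - θ < arg (s + ε * I))
  have hneg : arg (s + ε * I) < 0 := arg_add_mul_I_neg hε
  exact add_mul_mem_sector hw hnorm ⟨by linarith, by linarith⟩

namespace PlaneGraph

/-- The direction in which the edge `e` leaves the vertex `v`. -/
def dir (M : PlaneGraph) (v : M.V) (e : M.E) : ℂ := initialDir (M.pathFrom v e)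

variable {M : PlaneGraph} {v : M.V} {e e' d : M.E}

theorem exists_pathFrom_dir (h : M.Inc v e) :
    ∃ l : List ℂ, M.pathFrom v e = M.pos v :: (M.pos v + M.dir v e) :: l ∧ M.dir v e ≠ 0 ∧
      M.pos v ∉ polyLine ((M.pos v + M.dir v e) :: l) := by
  obtain ⟨q, l, hpath, hq, hv⟩ := exists_pathFrom_eq h
  have hdir : M.dir v e = q - M.pos v := by rw [dir, hpath]; rfl
  rw [hdir, add_sub_cancel]
  exact ⟨l, hpath, sub_ne_zero.2 hq, hv⟩

theorem dir_ne_zero (h : M.Inc v e) : M.dir v e ≠ 0 :=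
  let ⟨_, _, hdir, _⟩ := exists_pathFrom_dir h; hdir

theorem arc_eq_union {l : List ℂ} (h : M.pathFrom v e = M.pos v :: (M.pos v + M.dir v e) :: l) :
    M.arc e = segment ℝ (M.pos v) (M.pos v + M.dir v e) ∪
      polyLine ((M.pos v + M.dir v e) :: l) := by
  rw [← polyLine_pathFrom v e, h, polyLine_cons_cons]

theorem segment_subset_arc (h : M.Inc v e) :
    segment ℝ (M.pos v) (M.pos v + M.dir v e) ⊆ M.arc e := by
  obtain ⟨l, hl, -, -⟩ := exists_pathFrom_dir h
  exact arc_eq_union hl ▸ subset_union_left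

theorem rightOf_of_eventually {f : M.Face} {s : ℝ} (h : M.Inc v e) (hs : s ∈ Ioo (0 : ℝ) 1)
    (hf : ∀ᶠ ε : ℝ in 𝓝[<] 0, M.pos v + M.dir v e * (s + ε * I) ∈ f.1) : M.RightOf v e f := by
  obtain ⟨l, hl, -, -⟩ := exists_pathFrom_dir h
  refine ⟨h, _, _, by rw [hl]; exact ⟨[], l, rfl⟩, M.pos v + s * M.dir v e, ?_, ?_⟩
  · rw [openSegment_eq_image']
    exact ⟨s, hs, by simp⟩
  · have hneg : Tendsto (fun ε : ℝ => -ε) (𝓝[>] 0) (𝓝[<] 0) := by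
      simpa only [neg_zero] using tendsto_neg_nhdsGT (a := (0 : ℝ))
    filter_upwards [hneg.eventually hf] with ε hε
    convert hε using 1
    push_cast
    ring

theorem leftOf_of_eventually {f : M.Face} {s : ℝ} (h : M.Inc v e) (hs : s ∈ Ioo (0 : ℝ) 1)
    (hf : ∀ᶠ ε : ℝ in 𝓝[>] 0, M.pos v + M.dir v e * (s + ε * I) ∈ f.1) : M.LeftOf v e f := by
  obtain ⟨l, hl, -, -⟩ := exists_pathFrom_dir h
  obtain ⟨v', hv', hinc, hrev⟩ := exists_other_end h
  refine ⟨h, v', hv', hinc, M.pos v + M.dir v e, M.pos v, ?_, M.pos v + s * M.dir v e, ?_, ?_⟩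
  · rw [hrev, hl]
    exact ⟨l.reverse, [], by simp⟩
  · rw [openSegment_symm, openSegment_eq_image']
    exact ⟨s, hs, by simp⟩
  · filter_upwards [hf] with ε hε
    convert hε using 1
    ring

namespace IsPlaneMap

theorem eventually_vertex (hM : M.IsPlaneMap) (v : M.V) :
    ∀ᶠ z in 𝓝 (M.pos v), z ∈ range M.pos → z = M.pos v := by
  have hfin := hM.finite_verts _ (isCompact_closedBall (M.pos v) 1)
  have hvert : ∀ u ∈ {u | M.pos u ∈ Metric.closedBall (M.pos v) 1},
      ∀ᶠ z in 𝓝 (M.pos v), z = M.pos u → z = M.pos v := by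
    intro u _
    by_cases h : M.pos v = M.pos u
    · exact .of_forall fun z hz => hz.trans h.symm
    · filter_upwards [isOpen_ne.mem_nhds h] with z hz hz'
      exact absurd hz' hz
  filter_upwards [(eventually_all_finite hfin).2 hvert,
    Metric.closedBall_mem_nhds (M.pos v) one_pos] with z hz hball
  rintro ⟨u, rfl⟩
  exact hz u hball rfl

theorem eventually_support (hM : M.IsPlaneMap) (v : M.V) :
    ∀ᶠ z in 𝓝 (M.pos v), z ∈ M.support → z = M.pos v ∨
      ∃ d, M.Inc v d ∧ z ∈ segment ℝ (M.pos v) (M.pos v + M.dir v d) := by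
  have hfin := hM.finite_edges _ (isCompact_closedBall (M.pos v) 1)
  have hedge : ∀ e ∈ {e | (M.arc e ∩ Metric.closedBall (M.pos v) 1).Nonempty},
      ∀ᶠ z in 𝓝 (M.pos v), z ∈ M.arc e →
        ∃ d, M.Inc v d ∧ z ∈ segment ℝ (M.pos v) (M.pos v + M.dir v d) := by
    intro e _
    by_cases h : M.Inc v e
    · obtain ⟨l, hl, -, hv⟩ := exists_pathFrom_dir h
      filter_upwards [(isCompact_polyLine _).isClosed.isOpen_compl.mem_nhds hv] with z hz hz'
      exact ⟨e, h, (arc_eq_union hl ▸ hz').resolve_right hz⟩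
    · filter_upwards [(isCompact_polyLine (M.path e)).isClosed.isOpen_compl.mem_nhds h]
        with z hz hz'
      exact absurd hz' hz
  filter_upwards [(eventually_all_finite hfin).2 hedge, hM.eventually_vertex v,
    Metric.closedBall_mem_nhds (M.pos v) one_pos] with z hz hvert hball
  rintro (hsupp | hsupp)
  · exact .inl (hvert hsupp)
  · obtain ⟨e, he⟩ := mem_iUnion.1 hsupp
    exact .inr (hz e ⟨z, he, hball⟩ he)

theorem eq_of_arg_eq (hM : M.IsPlaneMap) (hd : M.Inc v d) (he : M.Inc v e)
    (h : arg (M.dir v d) = arg (M.dir v e)) : d = e := by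
  by_contra hne
  have hd0 := dir_ne_zero hd
  have hlim : Tendsto (fun s : ℝ => M.pos v + s * M.dir v d) (𝓝[>] 0) (𝓝 (M.pos v)) := by
    have hcont : Continuous fun s : ℝ => M.pos v + s * M.dir v d := by fun_prop
    simpa using (hcont.tendsto 0).mono_left nhdsWithin_le_nhds
  obtain ⟨s, hs, hvert, hsd, hse⟩ := (eventually_mem_nhdsWithin.and
    ((hlim.eventually (hM.eventually_vertex v)).and
      ((eventually_mem_segment hd0 hd0 rfl (M.pos v)).and
        (eventually_mem_segment hd0 (dir_ne_zero he) h (M.pos v))))).exists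
  have hzero := hvert (M.inter d e hne ⟨segment_subset_arc hd hsd, segment_subset_arc he hse⟩)
  rw [add_eq_left, mul_eq_zero, ofReal_eq_zero] at hzero
  exact hzero.elim (mem_Ioi.1 hs).ne' hd0

theorem exists_sector_subset (hM : M.IsPlaneMap) {u : ℂ} {τ : ℝ} (hτ : τ ≤ 2 * Real.pi)
    (hmin : ∀ d, M.Inc v d → τ ≤ turnAngle u (M.dir v d)) :
    ∃ r > 0, sector (M.pos v) r (arg u) (arg u + τ) ⊆ M.supportᶜ := by
  obtain ⟨r, hr, hball⟩ := Metric.eventually_nhds_iff.1 (hM.eventually_support v)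
  refine ⟨r, hr, ?_⟩
  rintro _ ⟨⟨ρ, θ⟩, ⟨⟨hρ, hρr⟩, hθ⟩, rfl⟩ hz
  dsimp only at hρ hρr hθ hz
  have hne : (ρ : ℂ) * exp (θ * I) ≠ 0 := mul_ne_zero (ofReal_ne_zero.2 hρ.ne') (exp_ne_zero _)
  have hdist : dist (M.pos v + ρ * exp (θ * I)) (M.pos v) < r := by
    rwa [dist_eq_norm, add_sub_cancel_left, norm_mul, norm_exp_ofReal_mul_I, mul_one, norm_real,
      Real.norm_of_nonneg hρ.le]
  rcases hball hdist hz with h | ⟨d, hd, h⟩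
  · exact hne (add_eq_left.1 h)
  · rw [segment_eq_image'] at h
    obtain ⟨s, ⟨hs, -⟩, hsz⟩ := h
    simp only [add_sub_cancel_left, add_right_inj, real_smul] at hsz
    have hs0 : s ≠ 0 := by
      rintro rfl
      exact hne (by rw [← hsz, ofReal_zero, zero_mul])
    have hpolar : ((ρ / s : ℝ) : ℂ) * exp ((arg u + (θ - arg u) : ℝ) * I) = M.dir v d := by
      have hs1 : (s : ℂ) ≠ 0 := ofReal_ne_zero.2 hs0
      rw [add_sub_cancel, ofReal_div, div_mul_eq_mul_div, ← hsz]
      field_simp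
    have hturn := turnAngle_eq_of_polar (div_pos hρ (hs.lt_of_ne' hs0))
      ⟨sub_pos.2 hθ.1, by linarith [hθ.2]⟩ hpolar
    linarith [hmin d hd, hθ.2]

theorem exists_leftOf_rightOf (hM : M.IsPlaneMap) (he : M.Inc v e) (he' : M.Inc v e')
    (hmin : ∀ d, M.Inc v d → turnAngle (M.dir v e) (M.dir v e') ≤
      turnAngle (M.dir v e) (M.dir v d)) :
    ∃ f, M.LeftOf v e f ∧ M.RightOf v e' f := by
  set u := M.dir v e
  set u' := M.dir v e'
  set τ := turnAngle u u'
  obtain ⟨hτ0, hτ1⟩ := turnAngle_mem_Ioc u u'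
  obtain ⟨r, hr, hdisj⟩ := hM.exists_sector_subset hτ1 hmin
  obtain ⟨z, hz⟩ := sector_nonempty (z := M.pos v) hr (lt_add_of_pos_right (arg u) hτ0)
  have hsub := (isPreconnected_sector _ _ _ _).subset_connectedComponentIn hz hdisj
  obtain ⟨s, ⟨hs, hs1⟩, hsr, hsr'⟩ :
      ∃ s : ℝ, s ∈ Ioo 0 1 ∧ ‖u‖ * s < r ∧ ‖u'‖ * s < r := by
    have hlim (w : ℂ) : ∀ᶠ s : ℝ in 𝓝[>] 0, ‖w‖ * s < r := by
      have h : Tendsto (fun s : ℝ => ‖w‖ * s) (𝓝 0) (𝓝 (‖w‖ * 0)) :=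
        Continuous.tendsto (by fun_prop) 0
      exact mem_nhdsWithin_of_mem_nhds (h (Iio_mem_nhds (by rwa [mul_zero])))
    exact ((eventually_mem_set.2 (Ioo_mem_nhdsGT one_pos)).and ((hlim u).and (hlim u'))).exists
  refine ⟨⟨_, z, hdisj hz, rfl⟩, leftOf_of_eventually he ⟨hs, hs1⟩ ?_,
    rightOf_of_eventually he' ⟨hs, hs1⟩ ?_⟩
  · filter_upwards [eventually_mem_sector_left (norm_mul_exp_arg_mul_I u) (dir_ne_zero he) hs hsr
      (lt_add_of_pos_right _ hτ0)] with ε hε using hsub hε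
  · filter_upwards [eventually_mem_sector_right (norm_mul_exp_arg_add_turnAngle u u')
      (dir_ne_zero he') hs hsr' (lt_add_of_pos_right _ hτ0)] with ε hε using hsub hε

theorem exists_nextAt (hM : M.IsPlaneMap) (he : M.Inc v e) : ∃ e', M.NextAt v e e' := by
  have hfin : {d | M.Inc v d}.Finite :=
    (hM.finite_edges {M.pos v} isCompact_singleton).subset fun d hd => ⟨M.pos v, hd, rfl⟩
  obtain ⟨e', he', hmin⟩ := Set.exists_min_image _
    (fun d => turnAngle (M.dir v e) (M.dir v d)) hfin ⟨e, he⟩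
  refine ⟨e', he, he', ?_, fun d hd => ?_⟩
  · rintro rfl d hd
    have hle := hmin d hd
    rw [turnAngle_eq_two_pi_iff.2 (rfl : arg (M.dir v e') = _)] at hle
    exact hM.eq_of_arg_eq hd he
      (turnAngle_eq_two_pi_iff.1 ((turnAngle_mem_Ioc _ _).2.antisymm hle))
  · by_cases h : e' = e
    · exact h ▸ not_ccw_self _ _
    · exact (ccw_iff fun harg => h (hM.eq_of_arg_eq he' he harg)).not.2 (hmin d hd).not_gt

theorem exists_face_of_nextAt (hM : M.IsPlaneMap) (h : M.NextAt v e e') :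
    ∃ f, M.LeftOf v e f ∧ M.RightOf v e' f := by
  obtain ⟨he, he', honly, hccw⟩ := h
  refine hM.exists_leftOf_rightOf he he' fun d hd => ?_
  by_cases h : e' = e
  · rw [honly h d hd, h]
  · exact not_lt.1 ((ccw_iff fun harg => h (hM.eq_of_arg_eq he' he harg)).not.1 (hccw d hd))

theorem nextAt_iff (hM : M.IsPlaneMap)
    (hleft : ∀ v e f f', M.LeftOf v e f → M.LeftOf v e f' → f = f')
    (hright : ∀ v e e' f, M.RightOf v e f → M.RightOf v e' f → e = e') :
    M.NextAt v e e' ↔ ∃ f, M.LeftOf v e f ∧ M.RightOf v e' f := by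
  refine ⟨hM.exists_face_of_nextAt, ?_⟩
  rintro ⟨f, hef, hef'⟩
  obtain ⟨e'', hnext⟩ := hM.exists_nextAt hef.1
  obtain ⟨f', hleft', hright'⟩ := hM.exists_face_of_nextAt hnext
  rw [hleft v e f f' hef hleft'] at hef'
  rwa [hright v e' e'' f' hef' hright']

end IsPlaneMap

end PlaneGraph

/-! ### Uniqueness of the plane map and duality -/

open SquareTiling

namespace SquareTiling

variable {T : SquareTiling} {c : T.FaceChoice}

theorem FaceChoice.eq_of_singular_eq_empty (h : T.singular = ∅) (c c' : T.FaceChoice) :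
    c = c' := by
  obtain ⟨a, ha⟩ := c
  obtain ⟨b, hb⟩ := c'
  obtain rfl := subset_empty_iff.1 (h ▸ ha)
  obtain rfl := subset_empty_iff.1 (h ▸ hb)
  rfl

theorem singular_rotate_eq_empty (h : T.singular = ∅) : T.rotate.singular = ∅ := by
  refine eq_empty_of_forall_notMem fun z hz => ?_
  obtain ⟨p, rfl⟩ := mul_I_surjective z
  exact h.subset (mem_singular_rotate.1 hz)

theorem Regular.rotate (h : T.Regular) : T.rotate.Regular := by
  have hsing := singular_rotate_eq_empty h.2
  refine ⟨fun c' => ?_, hsing⟩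
  have c : T.FaceChoice := ⟨∅, empty_subset _⟩
  rw [FaceChoice.eq_of_singular_eq_empty hsing c' c.rotate]
  exact (h.1 c).rotate

theorem topFace_rotate (q : T.squares) :
    topFace c.rotate (T.rotateEquiv q) = vFaceRotate c (rightFace c q) := rfl

theorem bottomFace_rotate (q : T.squares) :
    bottomFace c.rotate (T.rotateEquiv q) = vFaceRotate c (leftFace c q) := rfl

theorem leftFace_rotate (q : T.squares) :
    leftFace c.rotate (T.rotateEquiv q) = hFaceRotate c (topFace c q) := rfl

theorem rightFace_rotate (q : T.squares) :
    rightFace c.rotate (T.rotateEquiv q) = hFaceRotate c (bottomFace c q) := rfl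

end SquareTiling

namespace Corresponds

variable {T : SquareTiling} {c : T.FaceChoice} {M M' : PlaneGraph} {w : M.Dart → ℝ}
  {v : M.V} {e e' : M.E} {f f' : M.Face}

theorem leftOf_iff (r : Corresponds c M w) : M.LeftOf v e f ↔
    (r.vert v = topFace c (r.edge e) ∧ r.face f = rightFace c (r.edge e)) ∨
    (r.vert v = bottomFace c (r.edge e) ∧ r.face f = leftFace c (r.edge e)) := by
  have hne := topFace_ne_bottomFace (c := c) (r.edge e)
  constructor
  · rintro ⟨hinc, v', hv', hright⟩
    have hne' : r.vert v' ≠ r.vert v := r.vert.injective.ne hv'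
    rcases (r.inc v e).1 hinc with hv | hv <;>
      rcases (r.right v' e f).1 hright with ⟨hv', hf⟩ | ⟨hv', hf⟩
    exacts [absurd (hv'.trans hv.symm) hne', .inl ⟨hv, hf⟩, .inr ⟨hv, hf⟩,
      absurd (hv'.trans hv.symm) hne']
  · rintro (⟨hv, hf⟩ | ⟨hv, hf⟩)
    · refine ⟨(r.inc v e).2 (.inl hv), r.vert.symm (bottomFace c (r.edge e)), ?_,
        (r.right _ _ _).2 (.inr ⟨r.vert.apply_symm_apply _, hf⟩)⟩
      exact fun h => hne (hv.symm.trans (r.vert.symm_apply_eq.1 h).symm)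
    · refine ⟨(r.inc v e).2 (.inr hv), r.vert.symm (topFace c (r.edge e)), ?_,
        (r.right _ _ _).2 (.inl ⟨r.vert.apply_symm_apply _, hf⟩)⟩
      exact fun h => hne ((r.vert.symm_apply_eq.1 h).trans hv)

theorem leftOf_unique (r : Corresponds c M w) (h : M.LeftOf v e f) (h' : M.LeftOf v e f') :
    f = f' := by
  have hne := topFace_ne_bottomFace (c := c) (r.edge e)
  refine r.face.injective ?_
  rcases r.leftOf_iff.1 h with ⟨hv, hf⟩ | ⟨hv, hf⟩ <;>
    rcases r.leftOf_iff.1 h' with ⟨hv', hf'⟩ | ⟨hv', hf'⟩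
  exacts [hf.trans hf'.symm, absurd (hv.symm.trans hv') hne, absurd (hv'.symm.trans hv) hne,
    hf.trans hf'.symm]

theorem edge_unique (r : Corresponds c M w) (h : M.RightOf v e f) (h' : M.RightOf v e' f) :
    e = e' := by
  refine r.edge.injective ?_
  rcases (r.right v e f).1 h with ⟨hv, hf⟩ | ⟨hv, hf⟩ <;>
    rcases (r.right v e' f).1 h' with ⟨hv', hf'⟩ | ⟨hv', hf'⟩
  exacts [eq_of_hFace_eq_of_vFace_eq (hv.symm.trans hv') (hf.symm.trans hf'),
    absurd (hf.symm.trans hf') (leftFace_ne_rightFace_of_topFace_eq (hv.symm.trans hv')),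
    absurd (hf'.symm.trans hf) (leftFace_ne_rightFace_of_topFace_eq (hv'.symm.trans hv)),
    eq_of_hFace_eq_of_vFace_eq (hv.symm.trans hv') (hf.symm.trans hf')]

theorem nextAt_iff (r : Corresponds c M w) (hM : M.IsPlaneMap) :
    M.NextAt v e e' ↔ ∃ f, M.LeftOf v e f ∧ M.RightOf v e' f :=
  hM.nextAt_iff (fun _ _ _ _ h h' => r.leftOf_unique h h') fun _ _ _ _ h h' => r.edge_unique h h'

section Iso

variable {w' : M'.Dart → ℝ} (r : Corresponds c M w) (r' : Corresponds c M' w')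

theorem leftOf_iff_leftOf (v : M.V) (e : M.E) (f : M.Face) :
    M.LeftOf v e f ↔ M'.LeftOf ((r.vert.trans r'.vert.symm) v) ((r.edge.trans r'.edge.symm) e)
      ((r.face.trans r'.face.symm) f) := by
  simp only [r.leftOf_iff, r'.leftOf_iff, Equiv.trans_apply, Equiv.apply_symm_apply]

theorem rightOf_iff_rightOf (v : M.V) (e : M.E) (f : M.Face) :
    M.RightOf v e f ↔ M'.RightOf ((r.vert.trans r'.vert.symm) v) ((r.edge.trans r'.edge.symm) e)
      ((r.face.trans r'.face.symm) f) := by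
  simp only [r.right, r'.right, Equiv.trans_apply, Equiv.apply_symm_apply]

/-- The isomorphism between two plane maps that correspond to the same tiling. -/
def iso (hM : M.IsPlaneMap) (hM' : M'.IsPlaneMap) : M.Iso M' where
  vert := r.vert.trans r'.vert.symm
  edge := r.edge.trans r'.edge.symm
  face := r.face.trans r'.face.symm
  inc v e := by simp only [r.inc, r'.inc, Equiv.trans_apply, Equiv.apply_symm_apply]
  right := r.rightOf_iff_rightOf r'
  next v e e' := by
    rw [r.nextAt_iff hM, r'.nextAt_iff hM', (r.face.trans r'.face.symm).surjective.exists]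
    exact exists_congr fun f =>
      and_congr (r.leftOf_iff_leftOf r' v e f) (r.rightOf_iff_rightOf r' v e' f)

theorem weight_eq (hM : M.IsPlaneMap) (hM' : M'.IsPlaneMap) (d : M.Dart) (d' : M'.Dart)
    (h : d'.1 = ((r.iso r' hM hM').vert d.1.1, (r.iso r' hM hM').edge d.1.2)) : w' d' = w d := by
  have hvert : r'.vert d'.1.1 = r.vert d.1.1 := by rw [h]; simp [iso]
  have hedge : r'.edge d'.1.2 = r.edge d.1.2 := by rw [h]; simp [iso]
  rcases (r.inc _ _).1 d.2 with hv | hv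
  · rw [r.weight_top d hv, r'.weight_top d' (by rw [hvert, hedge, hv]), hedge]
  · rw [r.weight_bottom d hv, r'.weight_bottom d' (by rw [hvert, hedge, hv]), hedge]

end Iso

section Dual

variable {w' : M'.Dart → ℝ} (r : Corresponds c M w) (r' : Corresponds c.rotate M' w')

/-- The vertices of the plane map of the rotated tiling, as faces of the original map. -/
def dualVert : M'.V ≃ M.Face := (r'.vert.trans (vFaceRotate c).symm).trans r.face.symm

/-- The edges of the plane map of the rotated tiling, as edges of the original map. -/
def dualEdge : M'.E ≃ M.E := (r'.edge.trans T.rotateEquiv.symm).trans r.edge.symm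

/-- The faces of the plane map of the rotated tiling, as vertices of the original map. -/
def dualFace : M'.Face ≃ M.V := (r'.face.trans (hFaceRotate c).symm).trans r.vert.symm

theorem vert_eq (f : M'.V) : r'.vert f = vFaceRotate c (r.face (r.dualVert r' f)) := by
  simp [dualVert]

theorem edge_eq (e : M'.E) : r'.edge e = T.rotateEquiv (r.edge (r.dualEdge r' e)) := by
  simp [dualEdge]

theorem face_eq (v : M'.Face) : r'.face v = hFaceRotate c (r.vert (r.dualFace r' v)) := by
  simp [dualFace]

theorem inc_dual (f : M'.V) (e : M'.E) :
    M'.Inc f e ↔ ∃ v, M.RightOf v (r.dualEdge r' e) (r.dualVert r' f) := by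
  simp only [r'.inc, r.right, r.vert_eq r', r.edge_eq r', topFace_rotate, bottomFace_rotate,
    EmbeddingLike.apply_eq_iff_eq]
  constructor
  · rintro (h | h)
    exacts [⟨r.vert.symm (bottomFace c _), .inr ⟨r.vert.apply_symm_apply _, h⟩⟩,
      ⟨r.vert.symm (topFace c _), .inl ⟨r.vert.apply_symm_apply _, h⟩⟩]
  · rintro ⟨v, ⟨-, h⟩ | ⟨-, h⟩⟩
    exacts [.inr h, .inl h]

theorem rightOf_dual (f : M'.V) (e : M'.E) (v : M'.Face) : M'.RightOf f e v ↔
    M.LeftOf (r.dualFace r' v) (r.dualEdge r' e) (r.dualVert r' f) := by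
  simp only [r'.right, r.leftOf_iff, r.vert_eq r', r.edge_eq r', r.face_eq r', topFace_rotate,
    bottomFace_rotate, leftFace_rotate, rightFace_rotate, EmbeddingLike.apply_eq_iff_eq]
  tauto

theorem leftOf_dual (f : M'.V) (e : M'.E) (v : M'.Face) : M'.LeftOf f e v ↔
    M.RightOf (r.dualFace r' v) (r.dualEdge r' e) (r.dualVert r' f) := by
  simp only [r'.leftOf_iff, r.right, r.vert_eq r', r.edge_eq r', r.face_eq r', topFace_rotate,
    bottomFace_rotate, leftFace_rotate, rightFace_rotate, EmbeddingLike.apply_eq_iff_eq]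
  tauto

/-- The plane map of the rotated tiling is the dual map. -/
def dualIso (hM : M.IsPlaneMap) (hM' : M'.IsPlaneMap) : M.DualIso M' where
  vert := r.dualVert r'
  edge := r.dualEdge r'
  face := r.dualFace r'
  inc := r.inc_dual r'
  right := r.rightOf_dual r'
  next f e e' := by
    rw [r'.nextAt_iff hM', (r.dualFace r').surjective.exists]
    refine exists_congr fun v => ?_
    rw [r.leftOf_dual r', r.rightOf_dual r', r.nextAt_iff hM]
    exact ⟨fun ⟨hr, hl⟩ => ⟨hr, hl, _, hl, hr⟩, fun ⟨hr, hl, _⟩ => ⟨hr, hl⟩⟩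

theorem edge_dualIso (hM : M.IsPlaneMap) (hM' : M'.IsPlaneMap) (e : M'.E) :
    (r'.edge e).1 = (r.edge ((r.dualIso r' hM hM').edge e)).1.rotate := by
  rw [r.edge_eq r' e, rotateEquiv_val]
  rfl

end Dual

end Corresponds

/-! ### Collapsing the horizontal faces to points -/

/-- An increasing piecewise linear map of `[a, b]` onto itself, multiplying the distance to the
midpoint by `t` except within `δ` of the ends. The map is the median of three affine functions: the
homothety with factor `t`, and the two lines that map `[a, a + δ]` and `[b - δ, b]` onto the left
and the right half of the interval. -/
def collapse (a b δ t x : ℝ) : ℝ :=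
  max (min ((a + b) / 2 + t * (x - (a + b) / 2)) (a + (b - a) / (2 * δ) * (x - a)))
    (b - (b - a) / (2 * δ) * (b - x))

section collapse

variable {a b δ t x x' : ℝ}

theorem two_le_collapse_slope (hδ : 0 < δ) (hab : a + 4 * δ ≤ b) : 2 ≤ (b - a) / (2 * δ) := by
  rw [le_div_iff₀ (by linarith)]
  linarith

theorem collapse_slope_mul (hδ : 0 < δ) : (b - a) / (2 * δ) * δ = (b - a) / 2 := by
  field_simp

theorem collapse_one (hδ : 0 < δ) (hab : a + 4 * δ ≤ b) (hx : a ≤ x) (hx' : x ≤ b) :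
    collapse a b δ 1 x = x := by
  have hslope := two_le_collapse_slope hδ hab
  rw [collapse]
  set K := (b - a) / (2 * δ)
  rw [min_eq_left, max_eq_left] <;> nlinarith

theorem collapse_left (hδ : 0 < δ) (hab : a + 4 * δ ≤ b) (ht : t ≤ 1) :
    collapse a b δ t a = a := by
  have hslope := two_le_collapse_slope hδ hab
  rw [collapse]
  set K := (b - a) / (2 * δ)
  rw [min_eq_right, max_eq_left] <;> nlinarith

theorem collapse_right (hδ : 0 < δ) (hab : a + 4 * δ ≤ b) (ht : t ≤ 1) :
    collapse a b δ t b = b := by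
  rw [collapse, sub_self, mul_zero, sub_zero, max_eq_right]
  refine (min_le_left _ _).trans ?_
  nlinarith

theorem collapse_mid (hδ : 0 < δ) (hab : a + 4 * δ ≤ b) (ht : 0 ≤ t) (ht' : t ≤ 1)
    (hx : a + δ ≤ x) (hx' : x ≤ b - δ) :
    collapse a b δ t x = (a + b) / 2 + t * (x - (a + b) / 2) := by
  have hslope := two_le_collapse_slope hδ hab
  have hmul := collapse_slope_mul (a := a) (b := b) hδ
  rw [collapse]
  set K := (b - a) / (2 * δ)
  have hmid_left : (a + b) / 2 ≤ a + K * (x - a) := by nlinarith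
  have hmid_right : b - K * (b - x) ≤ (a + b) / 2 := by nlinarith
  have hx_left : x ≤ a + K * (x - a) := by nlinarith
  have hx_right : b - K * (b - x) ≤ x := by nlinarith
  rcases le_total x ((a + b) / 2) with h | h <;>
    rw [min_eq_left, max_eq_left] <;> nlinarith

theorem collapse_lt_collapse (hδ : 0 < δ) (hab : a + 4 * δ ≤ b) (ht : 0 ≤ t) (h : x < x')
    (hend : t = 0 → x < a + δ ∨ b - δ < x') :
    collapse a b δ t x < collapse a b δ t x' := by
  have hslope := two_le_collapse_slope hδ hab
  have hmul := collapse_slope_mul (a := a) (b := b) hδ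
  rw [collapse, collapse]
  set K := (b - a) / (2 * δ)
  have hleft : a + K * (x - a) < a + K * (x' - a) := by nlinarith
  have hright : b - K * (b - x) < b - K * (b - x') := by nlinarith
  rcases ht.eq_or_lt with rfl | ht
  · simp only [zero_mul, add_zero]
    rcases hend rfl with hx | hx'
    · have hmid : a + K * (x - a) < (a + b) / 2 := by nlinarith
      exact max_lt_max ((min_le_right _ _).trans_lt (lt_min hmid hleft)) hright
    · have hmid : (a + b) / 2 < b - K * (b - x') := by nlinarith
      exact lt_max_of_lt_right (max_lt ((min_le_left _ _).trans_lt hmid) hright)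
  · refine max_lt_max (min_lt_min ?_ hleft) hright
    nlinarith

theorem collapse_mem_Ioo (hδ : 0 < δ) (hab : a + 4 * δ ≤ b) (ht : 0 ≤ t) (ht' : t ≤ 1)
    (hx : x ∈ Ioo a b) : collapse a b δ t x ∈ Ioo a b := by
  constructor
  · simpa only [collapse_left hδ hab ht'] using
      collapse_lt_collapse hδ hab ht hx.1 fun _ => .inl (by linarith)
  · simpa only [collapse_right hδ hab ht'] using
      collapse_lt_collapse hδ hab ht hx.2 fun _ => .inr (by linarith)

theorem continuous_collapse : Continuous (collapse a b δ t) := by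
  unfold collapse
  fun_prop

theorem surjOn_collapse (hδ : 0 < δ) (hab : a + 4 * δ ≤ b) (ht : t ≤ 1) :
    SurjOn (collapse a b δ t) (Ioo a b) (Ioo a b) := by
  have h := intermediate_value_Ioo (show a ≤ b by linarith)
    (continuous_collapse (a := a) (b := b) (δ := δ) (t := t)).continuousOn
  rwa [collapse_left hδ hab ht, collapse_right hδ hab ht] at h

end collapse

namespace SquareTiling

variable {T : SquareTiling} {c : T.FaceChoice}

/-- An open neighbourhood of a horizontal face without its ends. The boxes of the horizontal faces
are pairwise disjoint. -/
def HFace.box (h : HFace c) : Set ℂ := {p | p.re ∈ Ioo h.lo h.hi ∧ |p.im - h.y| < h.gap}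

/-- The part of a horizontal face that is collapsed to a point. It excludes only the parts near the
ends, so that the vertical mid-line of every square of the face ends in it. -/
def HFace.core (h : HFace c) : Set ℂ :=
  {p | p.re ∈ Icc (h.lo + h.gap) (h.hi - h.gap) ∧ p.im = h.y}

/-- The midpoint of a horizontal face, a vertex of the plane map. -/
def HFace.center (h : HFace c) : ℂ := ⟨(h.lo + h.hi) / 2, h.y⟩

theorem HFace.mem_box {h : HFace c} {p : ℂ} :
    p ∈ h.box ↔ p.re ∈ Ioo h.lo h.hi ∧ |p.im - h.y| < h.gap := Iff.rfl

theorem HFace.mem_core {h : HFace c} {p : ℂ} :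
    p ∈ h.core ↔ p.re ∈ Icc (h.lo + h.gap) (h.hi - h.gap) ∧ p.im = h.y := Iff.rfl

/-- The horizontal displacement, near a horizontal face, by the map that collapses its core. -/
def HFace.shift (h : HFace c) (p : ℂ) : ℝ :=
  collapse h.lo h.hi h.gap (min 1 (|p.im - h.y| / h.gap)) (max h.lo (min p.re h.hi)) -
    max h.lo (min p.re h.hi)

theorem HFace.continuous_shift (h : HFace c) : Continuous h.shift := by
  unfold HFace.shift collapse
  fun_prop

/-- The map of the plane that collapses the core of each horizontal face to its midpoint. -/
def squash (c : T.FaceChoice) (p : ℂ) : ℂ := p + ((∑ᶠ h : HFace c, h.shift p : ℝ) : ℂ)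

@[simp] theorem squash_im (p : ℂ) : (squash c p).im = p.im := by simp [squash]

theorem finite_squares_inter (T : SquareTiling) {K : Set ℂ} (hK : IsCompact K) :
    {q : T.squares | (q.1.region ∩ K).Nonempty}.Finite :=
  ((T.locallyFinite K hK).preimage Subtype.val_injective.injOn).subset fun q hq => ⟨q.2, hq⟩

namespace EdgeFiniteFor

theorem core_subset_box (hc : EdgeFiniteFor c) (h : HFace c) : h.core ⊆ h.box := by
  intro p ⟨hre, him⟩
  have hgap := hc.gap_pos h
  exact ⟨⟨by linarith [hre.1], by linarith [hre.2]⟩, by rwa [him, sub_self, abs_zero]⟩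

theorem center_mem_core (hc : EdgeFiniteFor c) (h : HFace c) : h.center ∈ h.core := by
  have hgap := hc.gap_pos h
  have hlen := hc.lo_add_four_gap_le_hi h
  refine ⟨⟨?_, ?_⟩, rfl⟩ <;> simp only [HFace.center] <;> linarith

theorem level_mem_Icc (hc : EdgeFiniteFor c) {h : HFace c} {p : ℂ} (hp : p ∈ h.box) :
    |p.im - h.y| / h.gap ∈ Icc 0 1 :=
  have hgap := hc.gap_pos h
  ⟨by positivity, ((div_lt_one hgap).2 hp.2).le⟩

theorem face_of_mem_box (hc : EdgeFiniteFor c) {h : HFace c} {p : ℂ} (hp : p ∈ h.box)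
    {q : T.squares} (hq : p ∈ q.1.region) :
    ∃ b, hFace c (q, b) = h ∧ |p.im - hEdgeY (q, b)| < h.gap := by
  obtain ⟨s, t, rfl⟩ := exists_eq_germ hq
  set p₀ : ℂ := ⟨p.re, h.y⟩
  have hx : HalfIn s h.lo h.hi p₀.re := halfIn_of_mem_Ioo s hp.1
  suffices hgerm : ∃ t', T.germ p s t = T.germ p₀ s t' by
    obtain ⟨t', ht'⟩ := hgerm
    have hface := hc.hFace_germ hx rfl t'
    refine ⟨!t', by rw [ht', hface], ?_⟩
    rw [ht', ← y_hFace (c := c), hface]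
    exact hp.2
  have him := abs_lt.1 hp.2
  have hy (t') : h.y = hEdgeY (T.germ p₀ s t', !t') := by
    rw [← y_hFace (c := c), hc.hFace_germ hx rfl t']
  have hside (t') : 4 * h.gap ≤ (T.germ p₀ s t').1.side :=
    hc.four_gap_le_side ⟨_, hc.hFace_germ hx rfl t'⟩
  rcases lt_trichotomy p.im h.y with hlt | heq | hgt
  · refine ⟨false, (eq_germ (p := p) ⟨(T.germ_spec p₀ s false).1, halfIn_of_mem_Ioo t ?_⟩).symm⟩
    have hy1 : h.y = (T.germ p₀ s false).1.y1 := hy false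
    constructor <;> linarith [(T.germ p₀ s false).1.y1_eq, hside false]
  · exact ⟨t, by rw [show p = p₀ from Complex.ext rfl heq]⟩
  · refine ⟨true, (eq_germ (p := p) ⟨(T.germ_spec p₀ s true).1, halfIn_of_mem_Ioo t ?_⟩).symm⟩
    have hy0 : h.y = (T.germ p₀ s true).1.y0 := hy true
    constructor <;> linarith [(T.germ p₀ s true).1.y1_eq, hside true]

theorem eq_of_mem_box (hc : EdgeFiniteFor c) {h h' : HFace c} {p : ℂ}
    (hp : p ∈ h.box) (hp' : p ∈ h'.box) : h = h' := by
  have hq := T.germ_region p true true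
  set q := T.germ p true true
  obtain ⟨b, hb, hy⟩ := hc.face_of_mem_box hp hq
  obtain ⟨b', hb', hy'⟩ := hc.face_of_mem_box hp' hq
  suffices hbb : b = b' by rw [← hb, ← hb', hbb]
  have hside := hc.four_gap_le_side (h := h) ⟨b, hb⟩
  have hside' := hc.four_gap_le_side (h := h') ⟨b', hb'⟩
  have hpos := q.1.side_pos
  rw [abs_lt] at hy hy'
  have hy1 := q.1.y1_eq
  cases b <;> cases b' <;> simp only [hEdgeY, endpoint, cond_true, cond_false] at hy hy' <;>
    first | rfl | linarith

theorem finite_box (hc : EdgeFiniteFor c) {K : Set ℂ} (hK : IsCompact K) :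
    {h : HFace c | (h.box ∩ K).Nonempty}.Finite := by
  refine (((T.finite_squares_inter hK).prod finite_univ).image (hFace c)).subset ?_
  rintro h ⟨p, hp, hpK⟩
  have hq := T.germ_region p true true
  obtain ⟨b, hb, -⟩ := hc.face_of_mem_box hp hq
  exact ⟨(_, b), ⟨⟨p, hq, hpK⟩, mem_univ b⟩, hb⟩

theorem shift_eq_zero (hc : EdgeFiniteFor c) {h : HFace c} {p : ℂ} (hp : p ∉ h.box) :
    h.shift p = 0 := by
  have hgap := hc.gap_pos h
  have hlen := hc.lo_add_four_gap_le_hi h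
  have hlt := hc.lo_lt_hi h
  have hlevel : min 1 (|p.im - h.y| / h.gap) ≤ 1 := min_le_left _ _
  rw [HFace.shift, sub_eq_zero]
  rcases le_or_gt p.re h.lo with hlo | hlo
  · rw [max_eq_left ((min_le_left _ _).trans hlo), collapse_left hgap hlen hlevel]
  rcases le_or_gt h.hi p.re with hhi | hhi
  · rw [min_eq_right hhi, max_eq_right hlt.le, collapse_right hgap hlen hlevel]
  have hfar : h.gap ≤ |p.im - h.y| := not_lt.1 fun him => hp ⟨⟨hlo, hhi⟩, him⟩
  rw [min_eq_left ((one_le_div hgap).2 hfar)]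
  exact collapse_one hgap hlen (le_max_left _ _) (max_le hlt.le (min_le_right _ _))

theorem squash_of_notMem (hc : EdgeFiniteFor c) {p : ℂ} (hp : ∀ h : HFace c, p ∉ h.box) :
    squash c p = p := by
  rw [squash, finsum_congr fun h => hc.shift_eq_zero (hp h), finsum_zero, ofReal_zero, add_zero]

theorem squash_re (hc : EdgeFiniteFor c) {h : HFace c} {p : ℂ} (hp : p ∈ h.box) :
    (squash c p).re = collapse h.lo h.hi h.gap (|p.im - h.y| / h.gap) p.re := by
  have hsum : ∑ᶠ h : HFace c, h.shift p = h.shift p :=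
    finsum_eq_single _ h fun h' hne => hc.shift_eq_zero fun hp' => hne (hc.eq_of_mem_box hp' hp)
  rw [squash, hsum, add_re, ofReal_re, HFace.shift, min_eq_left hp.1.2.le,
    max_eq_right hp.1.1.le, min_eq_right (hc.level_mem_Icc hp).2, add_sub_cancel]

theorem squash_mem_box (hc : EdgeFiniteFor c) {h : HFace c} {p : ℂ} (hp : p ∈ h.box) :
    squash c p ∈ h.box := by
  obtain ⟨ht, ht'⟩ := hc.level_mem_Icc hp
  rw [HFace.mem_box, squash_im, hc.squash_re hp]
  exact ⟨collapse_mem_Ioo (hc.gap_pos h) (hc.lo_add_four_gap_le_hi h) ht ht' hp.1, hp.2⟩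

theorem continuous_squash (hc : EdgeFiniteFor c) : Continuous (squash c) := by
  refine continuous_id.add (continuous_ofReal.comp (continuous_finsum
    (fun h => h.continuous_shift) fun p => ⟨Metric.closedBall p 1,
      Metric.closedBall_mem_nhds p one_pos, ?_⟩))
  refine (hc.finite_box (isCompact_closedBall p 1)).subset ?_
  rintro h ⟨z, hz, hz'⟩
  exact ⟨z, by_contra fun hb => hz (hc.shift_eq_zero hb), hz'⟩

theorem isCompact_preimage_squash (hc : EdgeFiniteFor c) {K : Set ℂ} (hK : IsCompact K) :
    IsCompact (squash c ⁻¹' K) := by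
  have hsub : squash c ⁻¹' K ⊆ K ∪ ⋃ h ∈ {h : HFace c | (h.box ∩ K).Nonempty},
      Icc h.lo h.hi ×ℂ Icc (h.y - h.gap) (h.y + h.gap) := by
    intro p hp
    by_cases hbox : ∃ h : HFace c, p ∈ h.box
    · obtain ⟨h, hbox⟩ := hbox
      refine .inr (mem_biUnion (x := h) ⟨_, hc.squash_mem_box hbox, hp⟩ ?_)
      exact ⟨Ioo_subset_Icc_self hbox.1, mem_Icc_iff_abs_le.1 (abs_sub_comm p.im h.y ▸ hbox.2.le)⟩
    · rw [mem_preimage, hc.squash_of_notMem (not_exists.1 hbox)] at hp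
      exact .inl hp
  refine IsCompact.of_isClosed_subset ?_ (hK.isClosed.preimage hc.continuous_squash) hsub
  exact hK.union ((hc.finite_box hK).isCompact_biUnion fun h _ =>
    isCompact_Icc.reProdIm isCompact_Icc)

theorem isClosedMap_squash (hc : EdgeFiniteFor c) : IsClosedMap (squash c) :=
  (isProperMap_iff_isCompact_preimage.2
    ⟨hc.continuous_squash, fun _ hK => hc.isCompact_preimage_squash hK⟩).isClosedMap

theorem squash_surjective (hc : EdgeFiniteFor c) : Function.Surjective (squash c) := by
  intro z
  by_cases hbox : ∃ h : HFace c, z ∈ h.box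
  · obtain ⟨h, hbox⟩ := hbox
    obtain ⟨x, hx, hxz⟩ := surjOn_collapse (hc.gap_pos h) (hc.lo_add_four_gap_le_hi h)
      (hc.level_mem_Icc hbox).2 hbox.1
    have hx_mem : (⟨x, z.im⟩ : ℂ) ∈ h.box := ⟨hx, hbox.2⟩
    exact ⟨⟨x, z.im⟩, Complex.ext ((hc.squash_re hx_mem).trans hxz) (squash_im _)⟩
  · exact ⟨z, hc.squash_of_notMem (not_exists.1 hbox)⟩

theorem hi_le_lo_of_mem_box (hc : EdgeFiniteFor c) {h h' : HFace c} {p p' : ℂ} (hp : p ∈ h.box)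
    (hp' : p' ∈ h'.box) (hne : h ≠ h') (him : p.im = p'.im) (hlt : p.re < p'.re) :
    h.hi ≤ h'.lo := by
  by_contra! hcon
  obtain ⟨x, hx, hx'⟩ := exists_between (show max h.lo h'.lo < min h.hi h'.hi from
    max_lt (lt_min (hc.lo_lt_hi h) ((hp.1.1.trans hlt).trans hp'.1.2))
      (lt_min hcon (hc.lo_lt_hi h')))
  rw [max_lt_iff] at hx
  rw [lt_min_iff] at hx'
  refine hne (hc.eq_of_mem_box (p := ⟨x, p.im⟩) ⟨⟨hx.1, hx'.1⟩, hp.2⟩ ⟨⟨hx.2, hx'.2⟩, ?_⟩)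
  rw [him]
  exact hp'.2

theorem squash_lt_of_mem_box (hc : EdgeFiniteFor c) {h : HFace c} {p p' : ℂ} (hp : p ∈ h.box)
    (hp' : p' ∈ h.box) (him : p.im = p'.im) (hlt : p.re < p'.re)
    (hcore : ¬ (p ∈ h.core ∧ p' ∈ h.core)) : (squash c p).re < (squash c p').re := by
  rw [hc.squash_re hp, hc.squash_re hp', ← him]
  refine collapse_lt_collapse (hc.gap_pos h) (hc.lo_add_four_gap_le_hi h) (hc.level_mem_Icc hp).1
    hlt fun hlevel => ?_
  by_contra! hcon
  have hy : p.im = h.y := by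
    rw [div_eq_zero_iff, abs_eq_zero, sub_eq_zero] at hlevel
    exact hlevel.resolve_right (hc.gap_pos h).ne'
  exact hcore ⟨⟨⟨hcon.1, hlt.le.trans hcon.2⟩, hy⟩, ⟨⟨hcon.1.trans hlt.le, hcon.2⟩, him ▸ hy⟩⟩

theorem squash_lt (hc : EdgeFiniteFor c) {p p' : ℂ} (him : p.im = p'.im) (hlt : p.re < p'.re)
    (hcore : ∀ h : HFace c, ¬ (p ∈ h.core ∧ p' ∈ h.core)) :
    (squash c p).re < (squash c p').re := by
  by_cases hbox : ∃ h : HFace c, p ∈ h.box <;> by_cases hbox' : ∃ h : HFace c, p' ∈ h.box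
  · obtain ⟨h, hbox⟩ := hbox
    obtain ⟨h', hbox'⟩ := hbox'
    by_cases heq : h = h'
    · exact hc.squash_lt_of_mem_box hbox (heq ▸ hbox') him hlt (hcore h)
    · exact ((hc.squash_mem_box hbox).1.2.trans_le
        (hc.hi_le_lo_of_mem_box hbox hbox' heq him hlt)).trans (hc.squash_mem_box hbox').1.1
  · obtain ⟨h, hbox⟩ := hbox
    rw [hc.squash_of_notMem (not_exists.1 hbox')]
    refine (hc.squash_mem_box hbox).1.2.trans_le (not_lt.1 fun hhi => hbox' ⟨h, ?_, ?_⟩)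
    exacts [⟨hbox.1.1.trans hlt, hhi⟩, him ▸ hbox.2]
  · obtain ⟨h', hbox'⟩ := hbox'
    rw [hc.squash_of_notMem (not_exists.1 hbox)]
    refine (not_lt.1 fun hlo => hbox ⟨h', ?_, ?_⟩ : p.re ≤ h'.lo).trans_lt
      (hc.squash_mem_box hbox').1.1
    exacts [⟨hlo, hlt.trans hbox'.1.2⟩, him ▸ hbox'.2]
  · rwa [hc.squash_of_notMem (not_exists.1 hbox), hc.squash_of_notMem (not_exists.1 hbox')]

theorem eq_or_mem_core_of_squash_eq (hc : EdgeFiniteFor c) {p p' : ℂ}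
    (h : squash c p = squash c p') : p = p' ∨ ∃ h : HFace c, p ∈ h.core ∧ p' ∈ h.core := by
  by_contra! hcon
  obtain ⟨hne, hcore⟩ := hcon
  have him : p.im = p'.im := by rw [← squash_im (c := c) p, h, squash_im]
  rcases lt_trichotomy p.re p'.re with hlt | heq | hgt
  · exact (hc.squash_lt him hlt fun h hp => hcore h hp.1 hp.2).ne (by rw [h])
  · exact hne (Complex.ext heq him)
  · exact (hc.squash_lt him.symm hgt fun h hp => hcore h hp.2 hp.1).ne (by rw [h])

theorem squash_of_mem_core (hc : EdgeFiniteFor c) {h : HFace c} {p : ℂ} (hp : p ∈ h.core) :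
    squash c p = h.center := by
  refine Complex.ext ?_ ((squash_im p).trans hp.2)
  rw [hc.squash_re (hc.core_subset_box h hp), hp.2, sub_self, abs_zero, zero_div,
    collapse_mid (hc.gap_pos h) (hc.lo_add_four_gap_le_hi h) le_rfl zero_le_one hp.1.1 hp.1.2,
    zero_mul, add_zero, HFace.center]

end EdgeFiniteFor

end SquareTiling

/-! ### The skeleton and the cells -/

namespace Square

variable {q : Square} {p : ℂ}

/-- The abscissa of the centre of a square. -/
def xc (q : Square) : ℝ := q.x0 + q.side / 2

/-- The vertical mid-line of a square, which becomes an edge of the plane map. -/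
def mid (q : Square) : Set ℂ := {p | p.re = q.xc ∧ p.im ∈ Icc q.y0 q.y1}

theorem xc_mem_Ioo (q : Square) : q.xc ∈ Ioo q.x0 q.x1 := by
  have hside := q.side_pos
  rw [xc]
  constructor <;> linarith [q.x1_eq]

theorem mid_subset_region (q : Square) : q.mid ⊆ q.region := fun _ hp =>
  ⟨Ioo_subset_Icc_self (hp.1 ▸ q.xc_mem_Ioo), hp.2⟩

theorem isClosed_mid (q : Square) : IsClosed q.mid := isClosed_singleton.reProdIm isClosed_Icc

end Square

namespace SquareTiling

variable {T : SquareTiling} {c : T.FaceChoice} {p : ℂ}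

theorem vEdgeX_ne_xc (a : T.squares × Bool) : vEdgeX a ≠ a.1.1.xc := by
  obtain ⟨q, _ | _⟩ := a
  exacts [q.1.xc_mem_Ioo.2.ne', q.1.xc_mem_Ioo.1.ne]

/-- The cores of the horizontal faces together with the mid-lines of the squares. Collapsing the
cores turns it into the union of the vertices and edges of the plane map. -/
def skeleton (c : T.FaceChoice) : Set ℂ := (⋃ h : HFace c, h.core) ∪ ⋃ q : T.squares, q.1.mid

theorem core_subset_skeleton (h : HFace c) : h.core ⊆ skeleton c :=
  fun _ hp => .inl (mem_iUnion_of_mem h hp)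

theorem mid_subset_skeleton (q : T.squares) : q.1.mid ⊆ skeleton c :=
  fun _ hp => .inr (mem_iUnion_of_mem q hp)

theorem HFace.isClosed_core (h : HFace c) : IsClosed h.core :=
  isClosed_Icc.reProdIm isClosed_singleton

/-- The half of a square next to one of its vertical edges. -/
def halfSquare (a : T.squares × Bool) : Set ℂ :=
  uIcc (vEdgeX a) a.1.1.xc ×ℂ Icc a.1.1.y0 a.1.1.y1

theorem isCompact_halfSquare (a : T.squares × Bool) : IsCompact (halfSquare a) :=
  isCompact_uIcc.reProdIm isCompact_Icc

theorem halfSquare_subset (a : T.squares × Bool) : halfSquare a ⊆ a.1.1.region := fun _ hp =>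
  ⟨uIcc_subset_Icc (endpoint_mem_Icc _ a.1.1.x0_lt_x1.le)
    (Ioo_subset_Icc_self a.1.1.xc_mem_Ioo) hp.1, hp.2⟩

theorem vEdge_subset_halfSquare (a : T.squares × Bool) : T.vEdge a ⊆ halfSquare a := fun p hp => by
  rw [mem_vEdge] at hp
  exact ⟨hp.1 ▸ left_mem_uIcc, hp.2⟩

theorem exists_mem_halfSquare (T : SquareTiling) (p : ℂ) :
    ∃ a : T.squares × Bool, p ∈ halfSquare a := by
  obtain ⟨q, hq, hp⟩ := T.cover p
  rcases le_total p.re q.xc with h | h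
  · exact ⟨(⟨q, hq⟩, true), Icc_subset_uIcc ⟨hp.1.1, h⟩, hp.2⟩
  · exact ⟨(⟨q, hq⟩, false), Icc_subset_uIcc' ⟨h, hp.1.2⟩, hp.2⟩

/-- The vertical face on whose side of the mid-line of the square `T.germ p s t` the point `p`
lies. Outside the skeleton it does not depend on `s` and `t`. -/
def sideFace (c : T.FaceChoice) (p : ℂ) (s t : Bool) : VFace c :=
  vFace c (T.germ p s t, decide (p.re < (T.germ p s t).1.xc))

theorem sideFace_eq {s t b : Bool}
    (h : |p.re - vEdgeX (T.germ p s t, b)| < (T.germ p s t).1.side / 2) :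
    sideFace c p s t = vFace c (T.germ p s t, b) := by
  have hx1 := (T.germ p s t).1.x1_eq
  rw [abs_lt] at h
  rw [sideFace, Square.xc]
  congr
  cases b
  · rw [show vEdgeX (T.germ p s t, false) = (T.germ p s t).1.x1 from rfl] at h
    exact decide_eq_false (by linarith)
  · rw [show vEdgeX (T.germ p s t, true) = (T.germ p s t).1.x0 from rfl] at h
    exact decide_eq_true (by linarith)

theorem sideFace_eq_not_left (p : ℂ) (s t : Bool) : sideFace c p s t = sideFace c p (!s) t := by
  by_cases hgerm : T.germ p s t = T.germ p (!s) t
  · rw [sideFace, sideFace, hgerm]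
  have hx := vEdgeX_germ hgerm
  have hx' : vEdgeX (T.germ p (!s) t, !s) = p.re :=
    vEdgeX_germ (by rw [Bool.not_not]; exact Ne.symm hgerm)
  rw [sideFace_eq (b := s), sideFace_eq (b := !s), vFace_germ_eq hgerm] <;>
    simp only [hx, hx', sub_self, abs_zero, half_pos (Square.side_pos _)]

theorem vFace_eq_sideFace {s t b : Bool} (hp : p ∈ halfSquare (T.germ p s t, b))
    (hpc : p ∉ skeleton c) : vFace c (T.germ p s t, b) = sideFace c p s t := by
  have hne : p.re ≠ (T.germ p s t).1.xc := fun h => hpc (mid_subset_skeleton _ ⟨h, hp.2⟩)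
  rw [sideFace]
  congr
  cases b
  · exact (decide_eq_false (not_lt.2
      (uIcc_of_ge (T.germ p s t).1.xc_mem_Ioo.2.le ▸ hp.1 :).1)).symm
  · exact (decide_eq_true (lt_of_le_of_ne
      (uIcc_of_le (T.germ p s t).1.xc_mem_Ioo.1.le ▸ hp.1 :).2 hne)).symm

/-- The part of the complement of the skeleton that belongs to a vertical face. Its image under
`squash` is the face of the plane map that corresponds to the vertical face. -/
def VFace.cell (f : VFace c) : Set ℂ :=
  {p | p ∉ skeleton c ∧ ∃ a, vFace c a = f ∧ p ∈ halfSquare a}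

theorem VFace.cell_eq_biUnion (f : VFace c) :
    f.cell = ⋃ a ∈ {a | vFace c a = f}, halfSquare a \ skeleton c := by
  ext p
  simp only [mem_iUnion, exists_prop]
  exact ⟨fun ⟨hp, a, ha, hpa⟩ => ⟨a, ha, hpa, hp⟩, fun ⟨a, ha, hpa, hp⟩ => ⟨hp, a, ha, hpa⟩⟩

theorem exists_mem_cell (hp : p ∉ skeleton c) : ∃ f : VFace c, p ∈ f.cell := by
  obtain ⟨a, ha⟩ := T.exists_mem_halfSquare p
  exact ⟨vFace c a, hp, a, rfl, ha⟩

theorem halfIn_of_mem_vEdge {a : T.squares × Bool} {t : Bool} (hp : p ∈ T.vEdge a)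
    (h : T.germ p true t = T.germ p false t) : HalfIn (!t) a.1.1.y0 a.1.1.y1 p.im := by
  obtain ⟨s, t', hgerm⟩ := exists_eq_germ (vEdge_subset a hp)
  rcases Bool.eq_or_eq_not t' (!t) with rfl | rfl
  · exact hgerm ▸ (T.germ_spec p s (!t)).2
  rw [Bool.not_not] at hgerm
  have hstraight (s') : T.germ p s' t = T.germ p (!s') t := by cases s' <;> simp [h]
  refine absurd (hstraight a.2) ?_
  have hs : T.germ p a.2 t = a.1 := by
    rcases Bool.eq_or_eq_not s a.2 with rfl | rfl
    exacts [hgerm.symm, (hstraight a.2).trans hgerm.symm]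
  refine germ_ne_of_vEdgeX_eq ?_
  rw [hs]
  exact (mem_vEdge.1 hp).1.symm

theorem HFace.exists_abs_sub_endX_lt {h : HFace c} (hx : p.re ∈ Icc h.lo h.hi)
    (hy : p.im = h.y) (hcore : p ∉ h.core) : ∃ b, |p.re - h.endX b| < h.gap := by
  by_contra! hcon
  refine hcore ⟨?_, hy⟩
  have hlo : h.gap ≤ |p.re - h.lo| := hcon true
  have hhi : h.gap ≤ |p.re - h.hi| := hcon false
  rw [abs_of_nonneg (sub_nonneg.2 hx.1)] at hlo
  rw [abs_of_nonpos (sub_nonpos.2 hx.2)] at hhi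
  constructor <;> linarith

namespace EdgeFiniteFor

theorem exists_of_mem_core (hc : EdgeFiniteFor c) {h : HFace c} (hp : p ∈ h.core) {q : T.squares}
    (hq : p ∈ q.1.region) : ∃ b, hFace c (q, b) = h ∧ p.im = hEdgeY (q, b) := by
  obtain ⟨b, rfl, -⟩ := hc.face_of_mem_box (hc.core_subset_box h hp) hq
  exact ⟨b, rfl, hp.2⟩

theorem mem_core_of_mem_squares (hc : EdgeFiniteFor c) {h : HFace c} {q : T.squares}
    (hq : q ∈ h.squares) (hx : p.re = q.1.xc) (hy : p.im = h.y) : p ∈ h.core := by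
  have hlo := hc.lo_le_x0 hq
  have hhi := hc.x1_le_hi hq
  have hgap := hc.gap_pos h
  have hside := hc.four_gap_le_side hq
  have hx1 := q.1.x1_eq
  rw [HFace.mem_core, hx, Square.xc]
  exact ⟨⟨by linarith, by linarith⟩, hy⟩

theorem exists_mem_core_of_mem_mid (hc : EdgeFiniteFor c) {q q' : T.squares}
    (hp : p ∈ q.1.mid) (hp' : p ∈ q'.1.region) (hne : q ≠ q') :
    ∃ b, p ∈ (hFace c (q, b)).core := by
  rcases hp.2.2.eq_or_lt with htop | htop
  · exact ⟨true, hc.mem_core_of_mem_squares ⟨true, rfl⟩ hp.1 htop⟩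
  rcases hp.2.1.eq_or_lt with hbot | hbot
  · exact ⟨false, hc.mem_core_of_mem_squares ⟨false, rfl⟩ hp.1 hbot.symm⟩
  obtain ⟨s, t, rfl⟩ := exists_eq_germ hp'
  refine absurd (eq_germ ⟨halfIn_of_mem_Ioo s ?_, halfIn_of_mem_Ioo t ⟨hbot, htop⟩⟩) hne
  exact hp.1 ▸ q.1.xc_mem_Ioo

theorem exists_mem_core_of_mem_skeleton (hc : EdgeFiniteFor c) {q : T.squares}
    (hp : p ∈ q.1.region) (hx : p.re ≠ q.1.xc) (hpc : p ∈ skeleton c) :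
    ∃ h : HFace c, p ∈ h.core := by
  rcases hpc with hcore | hmid
  · exact mem_iUnion.1 hcore
  · obtain ⟨q', hq'⟩ := mem_iUnion.1 hmid
    obtain ⟨b, hb⟩ := hc.exists_mem_core_of_mem_mid hq' hp fun h => hx (h ▸ hq'.1)
    exact ⟨_, hb⟩

theorem notMem_skeleton (hc : EdgeFiniteFor c) {q : T.squares} (hx : p.re ∈ Icc q.1.x0 q.1.x1)
    (hy : p.im ∈ Ioo q.1.y0 q.1.y1) (hne : p.re ≠ q.1.xc) : p ∉ skeleton c := fun hpc => by
  have hq : p ∈ q.1.region := ⟨hx, Ioo_subset_Icc_self hy⟩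
  obtain ⟨h, hh⟩ := hc.exists_mem_core_of_mem_skeleton hq hne hpc
  obtain ⟨_ | _, -, hb⟩ := hc.exists_of_mem_core hh hq
  exacts [hy.1.ne' hb, hy.2.ne hb]

theorem vEdge_notMem_skeleton (hc : EdgeFiniteFor c) {a : T.squares × Bool} (hx : p.re = vEdgeX a)
    (hy : p.im ∈ Ioo a.1.1.y0 a.1.1.y1) : p ∉ skeleton c :=
  hc.notMem_skeleton (hx ▸ endpoint_mem_Icc _ a.1.1.x0_lt_x1.le) hy (hx ▸ vEdgeX_ne_xc a)

theorem isClosed_skeleton (hc : EdgeFiniteFor c) : IsClosed (skeleton c) := by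
  refine IsClosed.union ?_ ?_
  · refine LocallyFinite.isClosed_iUnion (fun p => ⟨Metric.closedBall p 1,
      Metric.closedBall_mem_nhds p one_pos, ?_⟩) HFace.isClosed_core
    exact (hc.finite_box (isCompact_closedBall p 1)).subset
      fun h => Nonempty.mono (inter_subset_inter_left _ (hc.core_subset_box h))
  · exact T.isClosed_iUnion_of_subset_region id (fun q => finite_singleton q) _
      (fun q => q.1.mid_subset_region) fun q => q.1.isClosed_mid

theorem abs_vEdgeX_sub_endX_le (hc : EdgeFiniteFor c) {h : HFace c} {q : T.squares}
    (hq : q ∈ h.squares) (hp : p.re ∈ Icc q.1.x0 q.1.x1) (b : Bool) :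
    |vEdgeX (q, b) - h.endX b| ≤ |p.re - h.endX b| := by
  have hlo := hc.lo_le_x0 hq
  have hhi := hc.x1_le_hi hq
  cases b
  · change |q.1.x1 - h.hi| ≤ |p.re - h.hi|
    rw [abs_of_nonpos (by linarith), abs_of_nonpos (by linarith [hp.2])]
    linarith [hp.2]
  · change |q.1.x0 - h.lo| ≤ |p.re - h.lo|
    rw [abs_of_nonneg (by linarith), abs_of_nonneg (by linarith [hp.1])]
    linarith [hp.1]

theorem sideFace_eq_not_right (hc : EdgeFiniteFor c) (hp : p ∉ skeleton c) (s t : Bool) :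
    sideFace c p s t = sideFace c p s (!t) := by
  by_cases hgerm : T.germ p s t = T.germ p s (!t)
  · rw [sideFace, sideFace, hgerm]
  set h := hFace c (T.germ p s t, !t)
  have hq : T.germ p s t ∈ h.squares := ⟨!t, rfl⟩
  have hq' : T.germ p s (!t) ∈ h.squares := ⟨t, (hFace_germ_eq hgerm).symm⟩
  have hx := (T.germ_region p s t).1
  obtain ⟨b, hb⟩ := HFace.exists_abs_sub_endX_lt (h := h)
    ⟨(hc.lo_le_x0 hq).trans hx.1, hx.2.trans (hc.x1_le_hi hq)⟩
    (hEdgeY_germ hgerm).symm fun hcore => hp (core_subset_skeleton h hcore)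
  have hend {q : T.squares} (hq : q ∈ h.squares) (hpq : p ∈ q.1.region) :
      vEdgeX (q, b) = h.endX b :=
    hc.vEdgeX_eq_endX hq ((hc.abs_vEdgeX_sub_endX_le hq hpq.1 b).trans_lt hb)
  have hnear {q : T.squares} (hq : q ∈ h.squares) (hpq : p ∈ q.1.region) :
      |p.re - vEdgeX (q, b)| < q.1.side / 2 := by
    rw [hend hq hpq]
    linarith [hc.four_gap_le_side hq, hc.gap_pos h]
  rw [sideFace_eq (hnear hq (T.germ_region p s t)), sideFace_eq (hnear hq' (T.germ_region p s !t))]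
  exact hc.vFace_eq_of_endX hq hq' (hend hq (T.germ_region p s t))
    (hend hq' (T.germ_region p s !t))

theorem vFace_eq_of_mem_halfSquare (hc : EdgeFiniteFor c) (hp : p ∉ skeleton c)
    {a b : T.squares × Bool} (ha : p ∈ halfSquare a) (hb : p ∈ halfSquare b) :
    vFace c a = vFace c b := by
  have hside (s t s' t') : sideFace c p s t = sideFace c p s' t' := by
    rcases Bool.eq_or_eq_not s s' with rfl | rfl <;> rcases Bool.eq_or_eq_not t t' with rfl | rfl
    exacts [rfl, (hc.sideFace_eq_not_right hp _ _).symm, (sideFace_eq_not_left _ _ _).symm,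
      ((sideFace_eq_not_left _ _ _).trans (hc.sideFace_eq_not_right hp _ _)).symm]
  obtain ⟨q, i⟩ := a
  obtain ⟨q', i'⟩ := b
  obtain ⟨s, t, rfl⟩ := exists_eq_germ (halfSquare_subset _ ha)
  obtain ⟨s', t', rfl⟩ := exists_eq_germ (halfSquare_subset _ hb)
  rw [vFace_eq_sideFace ha hp, vFace_eq_sideFace hb hp, hside]

theorem isPreconnected_halfSquare_diff (hc : EdgeFiniteFor c) (a : T.squares × Bool) :
    IsPreconnected (halfSquare a \ skeleton c) := by
  have hx : uIoo (vEdgeX a) a.1.1.xc ⊆ Icc a.1.1.x0 a.1.1.x1 :=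
    uIoo_subset_uIcc_self.trans (uIcc_subset_Icc (endpoint_mem_Icc _ a.1.1.x0_lt_x1.le)
      (Ioo_subset_Icc_self a.1.1.xc_mem_Ioo))
  have hopen : IsPreconnected (uIoo (vEdgeX a) a.1.1.xc ×ℂ Ioo a.1.1.y0 a.1.1.y1) :=
    (((convex_Ioo _ _).linear_preimage reLm).inter
      ((convex_Ioo _ _).linear_preimage imLm)).isPreconnected
  refine hopen.subset_closure (fun p hp => ⟨?_, ?_⟩) (sdiff_subset.trans ?_)
  · exact ⟨uIoo_subset_uIcc_self hp.1, Ioo_subset_Icc_self hp.2⟩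
  · exact hc.notMem_skeleton (hx hp.1) hp.2 fun h => right_notMem_uIoo (h ▸ hp.1)
  · rw [closure_reProdIm, closure_uIoo (vEdgeX_ne_xc a), closure_Ioo a.1.1.y0_lt_y1.ne]
    exact Subset.rfl

theorem exists_germ_eq_of_mem_core (hc : EdgeFiniteFor c) {h : HFace c} (hp : p ∈ h.core)
    (hph : p ∉ c.horiz) : ∃ t, T.germ p true t = T.germ p false t := by
  by_contra! hcon
  have hhalf (s) : HalfIn s h.lo h.hi p.re := halfIn_of_mem_Ioo s (hc.core_subset_box h hp).1
  have hne (s t) : T.germ p s t ≠ T.germ p (!s) t := by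
    cases s
    exacts [(hcon t).symm, hcon t]
  have hsing : p ∈ T.singular :=
    mem_singular_of_ne hne fun s t => hc.germ_ne_germ_not (hhalf s) hp.2 t
  have hle := x1_le_re_of_hFace_eq ⟨hsing, hph⟩
    ((hc.hFace_germ (hhalf false) hp.2 true).trans (hc.hFace_germ (hhalf true) hp.2 true).symm)
    (hEdgeY_germ (hc.germ_ne_germ_not (hhalf false) hp.2 true)) (vEdgeX_germ (hne false true)).le
  exact hle.not_gt (T.germ_spec p true true).1.2

theorem exists_mem_of_vLink (hc : EdgeFiniteFor c) {a b : T.squares × Bool} (hab : VLink c a b) :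
    ∃ p, p ∈ T.vEdge a ∧ p ∈ T.vEdge b ∧ p ∉ skeleton c := by
  obtain ⟨p, ⟨hpa, hpb⟩, hph⟩ := hab
  by_cases hpc : p ∈ skeleton c
  swap
  · exact ⟨p, hpa, hpb, hpc⟩
  have hxa := (mem_vEdge.1 hpa).1
  have hxb := (mem_vEdge.1 hpb).1
  obtain ⟨h, hcore⟩ := hc.exists_mem_core_of_mem_skeleton (vEdge_subset a hpa)
    (hxa ▸ vEdgeX_ne_xc a) hpc
  obtain ⟨t, ht⟩ := hc.exists_germ_eq_of_mem_core hcore hph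
  obtain ⟨y, hya, hyb⟩ := ((halfIn_of_mem_vEdge hpa ht).eventually.and
    (halfIn_of_mem_vEdge hpb ht).eventually).exists
  exact ⟨⟨p.re, y⟩, mem_vEdge.2 ⟨hxa, Ioo_subset_Icc_self hya⟩,
    mem_vEdge.2 ⟨hxb, Ioo_subset_Icc_self hyb⟩, hc.vEdge_notMem_skeleton hxa hya⟩

theorem eq_of_mem_cell (hc : EdgeFiniteFor c) {f f' : VFace c} (h : p ∈ f.cell)
    (h' : p ∈ f'.cell) : f = f' := by
  obtain ⟨hp, a, rfl, ha⟩ := h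
  obtain ⟨-, b, rfl, hb⟩ := h'
  exact hc.vFace_eq_of_mem_halfSquare hp ha hb

theorem cell_nonempty (hc : EdgeFiniteFor c) (f : VFace c) : f.cell.Nonempty := by
  obtain ⟨a, rfl⟩ := exists_vFace f
  obtain ⟨y, hy⟩ := nonempty_Ioo.2 a.1.1.y0_lt_y1
  exact ⟨⟨vEdgeX a, y⟩, hc.vEdge_notMem_skeleton rfl hy, a, rfl,
    vEdge_subset_halfSquare a (mem_vEdge.2 ⟨rfl, Ioo_subset_Icc_self hy⟩)⟩

theorem isPreconnected_cell (hc : EdgeFiniteFor c) (f : VFace c) : IsPreconnected f.cell := by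
  rw [f.cell_eq_biUnion]
  refine .biUnion_of_reflTransGen (fun a _ => hc.isPreconnected_halfSquare_diff a)
    fun a ha b hb => ?_
  set R := fun a b : T.squares × Bool =>
    ((halfSquare a \ skeleton c) ∩ (halfSquare b \ skeleton c)).Nonempty ∧ a ∈ {a | vFace c a = f}
  have hstep (x y) (hxy : VLink c x y) (hx : vFace c x = f ∧ Relation.ReflTransGen R a x) :
      vFace c y = f ∧ Relation.ReflTransGen R a y := by
    obtain ⟨p, hpx, hpy, hp⟩ := hc.exists_mem_of_vLink hxy
    exact ⟨(Quot.sound hxy : vFace c x = vFace c y).symm.trans hx.1, hx.2.tail ⟨⟨p,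
      ⟨vEdge_subset_halfSquare x hpx, hp⟩, ⟨vEdge_subset_halfSquare y hpy, hp⟩⟩, hx.1⟩⟩
  exact ((iff_of_quot_mk_eq (fun x y hxy => ⟨hstep x y hxy, hstep y x hxy.symm⟩)
    ((ha : vFace c a = f).trans (hb : vFace c b = f).symm)).1 ⟨ha, .refl⟩).2

theorem isOpen_cell (hc : EdgeFiniteFor c) (f : VFace c) : IsOpen f.cell := by
  have hcompl : f.cellᶜ = skeleton c ∪ ⋃ a : {a : T.squares × Bool // vFace c a ≠ f},
      halfSquare a.1 := by
    ext p
    constructor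
    · intro hp
      by_cases hpc : p ∈ skeleton c
      · exact .inl hpc
      · obtain ⟨a, ha⟩ := T.exists_mem_halfSquare p
        exact .inr (mem_iUnion.2 ⟨⟨a, fun h => hp ⟨hpc, a, h, ha⟩⟩, ha⟩)
    · rintro (hpc | hhalf) ⟨hp, a, ha, hpa⟩
      · exact hp hpc
      · obtain ⟨⟨b, hb⟩, hpb⟩ := mem_iUnion.1 hhalf
        exact hb ((hc.vFace_eq_of_mem_halfSquare hp hpb hpa).trans ha)
  rw [← isClosed_compl_iff, hcompl]
  refine hc.isClosed_skeleton.union (T.isClosed_iUnion_of_subset_region (fun a => a.1.1) ?_ _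
    (fun a => halfSquare_subset a.1) fun a => (isCompact_halfSquare a.1).isClosed)
  refine fun q => .of_injOn (f := fun a => a.1.2) (fun _ _ => mem_univ _) ?_ finite_univ
  rintro ⟨a, _⟩ ha ⟨b, _⟩ hb hab
  exact Subtype.ext (Prod.ext (ha.trans hb.symm) hab)

theorem squash_mem_image_skeleton (hc : EdgeFiniteFor c) :
    squash c p ∈ squash c '' skeleton c ↔ p ∈ skeleton c := by
  refine ⟨?_, mem_image_of_mem _⟩
  rintro ⟨p', hp', h⟩
  rcases hc.eq_or_mem_core_of_squash_eq h with rfl | ⟨h, -, hcore⟩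
  exacts [hp', core_subset_skeleton h hcore]

theorem eq_of_squash_eq (hc : EdgeFiniteFor c) {p' : ℂ} (hp : p ∉ skeleton c)
    (h : squash c p = squash c p') : p = p' :=
  (hc.eq_or_mem_core_of_squash_eq h).resolve_right fun ⟨h, hcore, _⟩ =>
    hp (core_subset_skeleton h hcore)

theorem isOpen_image_cell (hc : EdgeFiniteFor c) (f : VFace c) : IsOpen (squash c '' f.cell) := by
  have hcompl : (squash c '' f.cell)ᶜ = squash c '' f.cellᶜ := by
    ext z
    obtain ⟨p, rfl⟩ := hc.squash_surjective z
    constructor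
    · exact fun h => ⟨p, fun hp => h ⟨p, hp, rfl⟩, rfl⟩
    · rintro ⟨p₁, hp₁, h₁⟩ ⟨p₂, hp₂, h₂⟩
      rw [hc.eq_of_squash_eq hp₂.1 (h₂.trans h₁.symm)] at hp₂
      exact hp₁ hp₂
  rw [← isClosed_compl_iff, hcompl]
  exact hc.isClosedMap_squash _ (hc.isOpen_cell f).isClosed_compl

theorem eq_of_mem_image_cell (hc : EdgeFiniteFor c) {f f' : VFace c} {z : ℂ}
    (h : z ∈ squash c '' f.cell) (h' : z ∈ squash c '' f'.cell) : f = f' := by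
  obtain ⟨p, hp, rfl⟩ := h
  obtain ⟨p', hp', heq⟩ := h'
  rw [hc.eq_of_squash_eq hp'.1 heq] at hp'
  exact hc.eq_of_mem_cell hp hp'

theorem connectedComponentIn_eq (hc : EdgeFiniteFor c) {f : VFace c} {z : ℂ}
    (hz : z ∈ squash c '' f.cell) :
    connectedComponentIn (squash c '' skeleton c)ᶜ z = squash c '' f.cell := by
  have hsub : squash c '' f.cell ⊆ (squash c '' skeleton c)ᶜ := by
    rintro _ ⟨p, hp, rfl⟩ h
    exact hp.1 (hc.squash_mem_image_skeleton.1 h)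
  refine Subset.antisymm ?_ (((hc.isPreconnected_cell f).image _
    hc.continuous_squash.continuousOn).subset_connectedComponentIn hz hsub)
  refine isPreconnected_connectedComponentIn.subset_left_of_subset_union
    (v := ⋃ f' : {f' : VFace c // f' ≠ f}, squash c '' f'.1.cell) (hc.isOpen_image_cell f)
    (isOpen_iUnion fun f' => hc.isOpen_image_cell f'.1) ?_ (fun x hx => ?_)
    ⟨z, mem_connectedComponentIn (hsub hz), hz⟩
  · refine Set.disjoint_left.2 fun x hx hx' => ?_
    obtain ⟨f', hx'⟩ := mem_iUnion.1 hx'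
    exact f'.2 (hc.eq_of_mem_image_cell hx' hx)
  · obtain ⟨p, rfl⟩ := hc.squash_surjective x
    obtain ⟨f', hf'⟩ := exists_mem_cell (c := c) fun h =>
      connectedComponentIn_subset _ _ hx (mem_image_of_mem _ h)
    by_cases hff' : f' = f
    · exact .inl (mem_image_of_mem _ (hff' ▸ hf'))
    · exact .inr (mem_iUnion.2 ⟨⟨f', hff'⟩, mem_image_of_mem _ hf'⟩)

end EdgeFiniteFor

end SquareTiling

/-! ### Drawing the plane map -/

theorem mem_segment_iff_of_im_ne {a b z : ℂ} (h : a.im ≠ b.im) : z ∈ segment ℝ a b ↔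
    z.im ∈ uIcc a.im b.im ∧
      z.re = a.re + (z.im - a.im) / (b.im - a.im) * (b.re - a.re) := by
  have hne : b.im - a.im ≠ 0 := sub_ne_zero.2 h.symm
  rw [segment_eq_image', ← segment_eq_uIcc, segment_eq_image']
  constructor
  · rintro ⟨θ, hθ, rfl⟩
    refine ⟨⟨θ, hθ, by simp⟩, ?_⟩
    simp [hne]
  · rintro ⟨⟨θ, hθ, him⟩, hre⟩
    refine ⟨θ, hθ, Complex.ext ?_ (by simpa using him)⟩
    rw [hre, ← him]
    simp [hne]

theorem im_le_of_mem_polyLine : ∀ {a : ℂ} {l : List ℂ},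
    (a :: l).IsChain (fun p p' => p'.im < p.im) → ∀ {z}, z ∈ polyLine (a :: l) → z.im ≤ a.im
  | a, [], _, _, hz => ((polyLine_singleton a).subset hz).elim
  | a, b :: l, h, z, hz => by
    obtain ⟨hab, h⟩ := List.isChain_cons_cons.1 h
    rw [polyLine_cons_cons] at hz
    rcases hz with hz | hz
    · have him := ((mem_segment_iff_of_im_ne hab.ne').1 hz).1
      exact (uIcc_of_ge hab.le ▸ him).2
    · exact (im_le_of_mem_polyLine h hz).trans hab.le

theorem isPolyArc_of_isChain_im : ∀ {l : List ℂ}, 2 ≤ l.length →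
    l.IsChain (fun p p' => p'.im < p.im) → IsPolyArc l
  | [], h, _ => by simp at h
  | [_], h, _ => by simp at h
  | [a, b], _, h => fun hab => (List.isChain_cons_cons.1 h).1.ne (hab ▸ rfl)
  | a :: b :: d :: l, _, h => by
    obtain ⟨hab, h⟩ := List.isChain_cons_cons.1 h
    refine ⟨fun h => hab.ne (h ▸ rfl), Subset.antisymm ?_ (singleton_subset_iff.2
      ⟨right_mem_segment ℝ a b, mem_polyLine_of_mem (by simp) (by simp)⟩),
      isPolyArc_of_isChain_im (by simp) h⟩
    rintro z ⟨hz, hz'⟩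
    obtain ⟨him, hre⟩ := (mem_segment_iff_of_im_ne hab.ne').1 hz
    have him : z.im = b.im :=
      (im_le_of_mem_polyLine h hz').antisymm (uIcc_of_ge hab.le ▸ him).1
    refine Complex.ext ?_ him
    rw [hre, him, div_self (sub_ne_zero.2 hab.ne)]
    ring

namespace SquareTiling

variable {T : SquareTiling} {c : T.FaceChoice} {q : T.squares} {a : T.squares × Bool}

/-- The point at which the edge of the plane map that belongs to a square leaves the mid-line of
the square and turns to the vertex of the given horizontal edge. -/
def bend (c : T.FaceChoice) (a : T.squares × Bool) : ℂ :=
  ⟨a.1.1.xc, endpoint a.2 (hEdgeY a + (hFace c a).gap) (hEdgeY a - (hFace c a).gap)⟩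

/-- The nodes of the edge of the plane map that belongs to a square, starting at the vertex of the
given horizontal edge. -/
def drawPath (c : T.FaceChoice) (a : T.squares × Bool) : List ℂ :=
  [(hFace c a).center, bend c a, bend c (a.1, !a.2), (hFace c (a.1, !a.2)).center]

theorem drawPath_reverse (c : T.FaceChoice) (a : T.squares × Bool) :
    (drawPath c a).reverse = drawPath c (a.1, !a.2) := by simp [drawPath]

/-- The image of the mid-line of a square under the collapsing map, as a graph over the
ordinate. -/
def curve (c : T.FaceChoice) (q : T.squares) (y : ℝ) : ℝ := (squash c ⟨q.1.xc, y⟩).re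

theorem mem_image_mid {z : ℂ} : z ∈ squash c '' q.1.mid ↔
    z.im ∈ Icc q.1.y0 q.1.y1 ∧ z.re = curve c q z.im := by
  constructor
  · rintro ⟨p, hp, rfl⟩
    rw [squash_im]
    exact ⟨hp.2, by rw [curve, ← hp.1]⟩
  · rintro ⟨him, hre⟩
    exact ⟨⟨q.1.xc, z.im⟩, ⟨rfl, him⟩, Complex.ext hre.symm (squash_im _)⟩

theorem abs_sub_hEdgeY_add {y : ℝ} (hy : y ∈ Icc a.1.1.y0 a.1.1.y1) :
    |y - hEdgeY a| + |y - hEdgeY (a.1, !a.2)| = a.1.1.side := by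
  obtain ⟨q, _ | _⟩ := a
  · change |y - q.1.y0| + |y - q.1.y1| = _
    rw [abs_of_nonneg (sub_nonneg.2 hy.1), abs_of_nonpos (sub_nonpos.2 hy.2)]
    linarith [q.1.y1_eq]
  · change |y - q.1.y1| + |y - q.1.y0| = _
    rw [abs_of_nonneg (sub_nonneg.2 hy.1), abs_of_nonpos (sub_nonpos.2 hy.2)]
    linarith [q.1.y1_eq]

/-- A straight piece of the edge that belongs to a square, directed away from the vertex of the
given horizontal edge. -/
structure IsPiece (c : T.FaceChoice) (a : T.squares × Bool) (p p' : ℂ) : Prop where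
  lt : cond a.2 (p'.im < p.im) (p.im < p'.im)
  im_mem : p.im ∈ Icc a.1.1.y0 a.1.1.y1
  im_mem' : p'.im ∈ Icc a.1.1.y0 a.1.1.y1
  mem_iff : ∀ z : ℂ, z ∈ segment ℝ p p' ↔ z.im ∈ uIcc p.im p'.im ∧ z.re = curve c a.1 z.im

namespace IsPiece

variable {p p' : ℂ}

theorem im_ne (hp : IsPiece c a p p') : p.im ≠ p'.im := by
  obtain ⟨q, _ | _⟩ := a
  exacts [hp.lt.ne, hp.lt.ne']

theorem symm (hp : IsPiece c a p p') : IsPiece c (a.1, !a.2) p' p where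
  lt := by
    obtain ⟨q, _ | _⟩ := a
    exacts [hp.lt, hp.lt]
  im_mem := hp.im_mem'
  im_mem' := hp.im_mem
  mem_iff z := by rw [segment_symm, uIcc_comm, hp.mem_iff]

theorem curve_eq (hp : IsPiece c a p p') {y : ℝ} (hy : y ∈ uIcc p.im p'.im) :
    curve c a.1 y = p.re + (y - p.im) / (p'.im - p.im) * (p'.re - p.re) :=
  (((hp.mem_iff ⟨_, y⟩).1 ((mem_segment_iff_of_im_ne hp.im_ne).2 ⟨hy, rfl⟩)).2).symm

theorem im_mem_uIoo (hp : IsPiece c a p p') {x : ℂ} (hx : x ∈ openSegment ℝ p p') :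
    x.im ∈ uIoo p.im p'.im := by
  rw [uIoo, ← openSegment_eq_Ioo' hp.im_ne]
  obtain ⟨r, s, hr, hs, hrs, rfl⟩ := hx
  exact ⟨r, s, hr, hs, hrs, by simp⟩

theorem re_sub_curve (hp : IsPiece c a p p') {x : ℂ} (hx : x ∈ segment ℝ p p') {ε : ℝ}
    (hε : (x - ε * (I * (p' - p))).im ∈ uIcc p.im p'.im) :
    (x - ε * (I * (p' - p))).re - curve c a.1 (x - ε * (I * (p' - p))).im =
      ε * ((p'.im - p.im) ^ 2 + (p'.re - p.re) ^ 2) / (p'.im - p.im) := by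
  have hne : p'.im - p.im ≠ 0 := sub_ne_zero.2 hp.im_ne.symm
  rw [hp.curve_eq hε]
  simp only [sub_re, sub_im, mul_re, mul_im, ofReal_re, ofReal_im, I_re, I_im,
    ((mem_segment_iff_of_im_ne hp.im_ne).1 hx).2]
  field_simp
  ring

end IsPiece

namespace EdgeFiniteFor

theorem four_gap_hFace_le_side (hc : EdgeFiniteFor c) (a : T.squares × Bool) :
    4 * (hFace c a).gap ≤ a.1.1.side :=
  hc.four_gap_le_side ⟨a.2, rfl⟩

theorem curve_of_gap_le (hc : EdgeFiniteFor c) {y : ℝ} (hy : y ∈ Icc q.1.y0 q.1.y1)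
    (hgap : ∀ b, (hFace c (q, b)).gap ≤ |y - hEdgeY (q, b)|) : curve c q y = q.1.xc := by
  rw [curve, hc.squash_of_notMem fun h hp => ?_]
  obtain ⟨b, rfl, hb⟩ := hc.face_of_mem_box hp ⟨Ioo_subset_Icc_self q.1.xc_mem_Ioo, hy⟩
  exact (hgap b).not_gt hb

theorem curve_of_le_gap (hc : EdgeFiniteFor c) {y : ℝ} (hy : y ∈ Icc a.1.1.y0 a.1.1.y1)
    (hgap : |y - hEdgeY a| ≤ (hFace c a).gap) :
    curve c a.1 y = (hFace c a).center.re +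
      |y - hEdgeY a| / (hFace c a).gap * (a.1.1.xc - (hFace c a).center.re) := by
  have hpos := hc.gap_pos (hFace c a)
  rcases hgap.eq_or_lt with hgap | hgap
  · rw [hgap, div_self hpos.ne', hc.curve_of_gap_le hy fun b => ?_]
    · ring
    obtain ⟨q, b'⟩ := a
    rcases Bool.eq_or_eq_not b b' with rfl | rfl
    · exact hgap.ge
    · linarith [abs_sub_hEdgeY_add hy, hc.four_gap_hFace_le_side (q, b'),
        hc.four_gap_hFace_le_side (q, !b'), hc.gap_pos (hFace c (q, !b'))]
  · have hcore := hc.mem_core_of_mem_squares (h := hFace c a) (p := ⟨a.1.1.xc, hEdgeY a⟩)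
      ⟨a.2, rfl⟩ rfl rfl
    have hbox : (⟨a.1.1.xc, y⟩ : ℂ) ∈ (hFace c a).box :=
      ⟨(hc.core_subset_box _ hcore).1, hgap⟩
    obtain ⟨hlevel, hlevel'⟩ := hc.level_mem_Icc hbox
    rw [curve, hc.squash_re hbox, collapse_mid hpos (hc.lo_add_four_gap_le_hi _) hlevel hlevel'
      hcore.1.1 hcore.1.2]
    rfl

theorem bend_im_mem_Icc (hc : EdgeFiniteFor c) (a : T.squares × Bool) :
    (bend c a).im ∈ Icc a.1.1.y0 a.1.1.y1 := by
  have hpos := hc.gap_pos (hFace c a)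
  have hgap := hc.four_gap_hFace_le_side a
  have hside := a.1.1.y1_eq
  obtain ⟨q, _ | _⟩ := a
  · change q.1.y0 + _ ∈ _
    constructor <;> linarith
  · change q.1.y1 - _ ∈ _
    constructor <;> linarith

theorem isPiece_center_bend (hc : EdgeFiniteFor c) (a : T.squares × Bool) :
    IsPiece c a (hFace c a).center (bend c a) := by
  have hpos := hc.gap_pos (hFace c a)
  have hlt : cond a.2 ((bend c a).im < hEdgeY a) (hEdgeY a < (bend c a).im) := by
    obtain ⟨q, _ | _⟩ := a
    exacts [lt_add_of_pos_right _ hpos, sub_lt_self _ hpos]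
  have hbend : |(bend c a).im - hEdgeY a| = (hFace c a).gap := by
    obtain ⟨q, _ | _⟩ := a
    · exact (abs_of_pos (sub_pos.2 hlt)).trans (add_sub_cancel_left _ _)
    · exact (abs_of_neg (sub_neg.2 hlt)).trans (neg_eq_iff_eq_neg.2 (sub_sub_cancel_left _ _))
  have hne : (bend c a).im - hEdgeY a ≠ 0 := abs_pos.1 (hpos.trans_eq hbend.symm)
  have hmem : hEdgeY a ∈ Icc a.1.1.y0 a.1.1.y1 := endpoint_mem_Icc _ a.1.1.y0_lt_y1.le
  have hslope : ∀ y ∈ uIcc (hEdgeY a) (bend c a).im,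
      |y - hEdgeY a| / (hFace c a).gap = (y - hEdgeY a) / ((bend c a).im - hEdgeY a) := by
    intro y hy
    rw [← segment_eq_uIcc, segment_eq_image'] at hy
    obtain ⟨t, ht, rfl⟩ := hy
    rw [add_sub_cancel_left, smul_eq_mul, abs_mul, abs_of_nonneg ht.1, hbend,
      mul_div_cancel_right₀ _ hpos.ne', mul_div_cancel_right₀ _ hne]
  refine ⟨hlt, hmem, hc.bend_im_mem_Icc a, fun z => (mem_segment_iff_of_im_ne
    (sub_ne_zero.1 hne).symm).trans (and_congr_right fun hz => ?_)⟩
  rw [hc.curve_of_le_gap (uIcc_subset_Icc hmem (hc.bend_im_mem_Icc a) hz)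
    ((abs_sub_left_of_mem_uIcc hz).trans_eq hbend), hslope _ hz]
  rfl

theorem isPiece_bend_bend (hc : EdgeFiniteFor c) (a : T.squares × Bool) :
    IsPiece c a (bend c a) (bend c (a.1, !a.2)) := by
  have hpos := hc.gap_pos
  have hgap := hc.four_gap_hFace_le_side
  have hlt : (bend c (a.1, false)).im < (bend c (a.1, true)).im := by
    change a.1.1.y0 + (hFace c (a.1, false)).gap < a.1.1.y1 - (hFace c (a.1, true)).gap
    linarith [hgap (a.1, false), hgap (a.1, true), hpos (hFace c (a.1, false)),
      hpos (hFace c (a.1, true)), a.1.1.y1_eq]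
  have hcurve : ∀ y ∈ Icc (bend c (a.1, false)).im (bend c (a.1, true)).im,
      curve c a.1 y = a.1.1.xc := fun y hy => by
    refine hc.curve_of_gap_le ⟨(hc.bend_im_mem_Icc (a.1, false)).1.trans hy.1,
      hy.2.trans (hc.bend_im_mem_Icc (a.1, true)).2⟩ fun b => ?_
    obtain _ | _ := b
    · exact (le_sub_iff_add_le'.2 hy.1).trans (le_abs_self _)
    · rw [abs_sub_comm]
      exact (le_sub_comm.1 hy.2).trans (le_abs_self _)
  have hlt' : cond a.2 ((bend c (a.1, !a.2)).im < (bend c a).im)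
      ((bend c a).im < (bend c (a.1, !a.2)).im) := by
    obtain ⟨q, _ | _⟩ := a
    exacts [hlt, hlt]
  have hne : (bend c a).im ≠ (bend c (a.1, !a.2)).im := by
    obtain ⟨q, _ | _⟩ := a
    exacts [hlt.ne, hlt.ne']
  refine ⟨hlt', hc.bend_im_mem_Icc a, hc.bend_im_mem_Icc (a.1, !a.2), fun z =>
    (mem_segment_iff_of_im_ne hne).trans (and_congr_right fun hz => ?_)⟩
  rw [hcurve]
  · simp [bend]
  · obtain ⟨q, _ | _⟩ := a
    exacts [uIcc_of_le hlt.le ▸ hz, uIcc_of_ge hlt.le ▸ hz]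

theorem isPiece_of_infix_drawPath (hc : EdgeFiniteFor c) {p p' : ℂ}
    (h : [p, p'] <:+: drawPath c a) : IsPiece c a p p' := by
  have hpieces : (p = (hFace c a).center ∧ p' = bend c a) ∨
      (p = bend c a ∧ p' = bend c (a.1, !a.2)) ∨
      (p = bend c (a.1, !a.2) ∧ p' = (hFace c (a.1, !a.2)).center) := by
    simpa [drawPath, List.infix_cons_iff, List.cons_prefix_cons] using h
  rcases hpieces with ⟨rfl, rfl⟩ | ⟨rfl, rfl⟩ | ⟨rfl, rfl⟩
  · exact hc.isPiece_center_bend a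
  · exact hc.isPiece_bend_bend a
  · simpa only [Bool.not_not] using (hc.isPiece_center_bend (a.1, !a.2)).symm

theorem isChain_drawPath (hc : EdgeFiniteFor c) (q : T.squares) :
    (drawPath c (q, true)).IsChain fun p p' => p'.im < p.im :=
  List.isChain_iff_forall_rel_of_append_cons_cons.2 fun p p' l l' h =>
    (hc.isPiece_of_infix_drawPath (a := (q, true)) ⟨l, l', by rw [h, List.append_assoc]; rfl⟩).lt

theorem polyLine_drawPath (hc : EdgeFiniteFor c) (q : T.squares) :
    polyLine (drawPath c (q, true)) = squash c '' q.1.mid := by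
  have htop := hc.isPiece_center_bend (q, true)
  have hmid := hc.isPiece_bend_bend (q, true)
  have hbot := (hc.isPiece_center_bend (q, false)).symm
  have hIcc : Icc q.1.y0 q.1.y1 = Icc (bend c (q, true)).im q.1.y1 ∪
      (Icc (bend c (q, false)).im (bend c (q, true)).im ∪ Icc q.1.y0 (bend c (q, false)).im) := by
    have hbot_le : q.1.y0 ≤ (bend c (q, false)).im := hbot.lt.le
    have htop_le : (bend c (q, true)).im ≤ q.1.y1 := htop.lt.le
    rw [union_comm, union_comm (Icc _ (bend c (q, true)).im),
      Icc_union_Icc_eq_Icc hbot_le hmid.lt.le,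
      Icc_union_Icc_eq_Icc (hbot_le.trans hmid.lt.le) htop_le]
  ext z
  rw [mem_image_mid, hIcc, mem_union, mem_union, or_and_right, or_and_right, drawPath,
    polyLine_cons_cons, polyLine_cons_cons, polyLine_cons_cons, polyLine_singleton, union_empty,
    mem_union, mem_union, htop.mem_iff, hmid.mem_iff, uIcc_of_ge htop.lt.le, uIcc_of_ge hmid.lt.le]
  exact or_congr_right (or_congr_right
    ((hbot.mem_iff z).trans (by rw [uIcc_of_ge hbot.lt.le]; rfl)))

theorem mem_squares_of_squash_eq_center (hc : EdgeFiniteFor c) {h : HFace c} {p : ℂ}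
    (hp : p ∈ q.1.region) (heq : squash c p = h.center) : q ∈ h.squares := by
  have hcore : p ∈ h.core := by
    rcases hc.eq_or_mem_core_of_squash_eq
      (heq.trans (hc.squash_of_mem_core (hc.center_mem_core h)).symm) with rfl | ⟨h', hp', hh'⟩
    · exact hc.center_mem_core h
    · rwa [hc.eq_of_mem_box (hc.core_subset_box _ (hc.center_mem_core h))
        (hc.core_subset_box _ hh')]
  exact (hc.exists_of_mem_core hcore hp).imp fun _ => And.left

/-- The plane graph of a tiling: the vertices are the centers of the horizontal faces and the
edges the images of the mid-lines of the squares under the collapsing map. -/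
def drawing (hc : EdgeFiniteFor c) : PlaneGraph where
  V := HFace c
  E := T.squares
  pos := HFace.center
  path q := drawPath c (q, true)
  pos_injective h h' heq := hc.eq_of_mem_box (hc.core_subset_box _ (hc.center_mem_core h))
    (heq ▸ hc.core_subset_box _ (hc.center_mem_core h'))
  isPolyArc q := isPolyArc_of_isChain_im (by simp [drawPath]) (hc.isChain_drawPath q)
  ends q := by
    refine ⟨topFace c q, bottomFace c q, rfl, rfl, fun h hh => ?_⟩
    rw [hc.polyLine_drawPath] at hh
    obtain ⟨p, hp, heq⟩ := hh
    obtain ⟨_ | _, rfl⟩ := hc.mem_squares_of_squash_eq_center (q.1.mid_subset_region hp) heq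
    exacts [Or.inr rfl, Or.inl rfl]
  inter q q' hne := by
    rw [hc.polyLine_drawPath, hc.polyLine_drawPath]
    rintro z ⟨⟨p, hp, rfl⟩, p', hp', heq⟩
    rcases hc.eq_or_mem_core_of_squash_eq heq with rfl | ⟨h, -, hcore⟩
    · obtain ⟨b, hcore⟩ := hc.exists_mem_core_of_mem_mid hp (q'.1.mid_subset_region hp') hne
      exact ⟨_, (hc.squash_of_mem_core hcore).symm⟩
    · exact ⟨h, (hc.squash_of_mem_core hcore).symm⟩

theorem inc_drawing (hc : EdgeFiniteFor c) {h : HFace c} : hc.drawing.Inc h q ↔ q ∈ h.squares := by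
  constructor
  · intro hinc
    obtain ⟨p, hp, heq⟩ := (hc.polyLine_drawPath q).subset hinc
    exact hc.mem_squares_of_squash_eq_center (q.1.mid_subset_region hp) heq
  · rintro ⟨b, rfl⟩
    refine mem_polyLine_of_mem (l := drawPath c (q, true)) (by simp [drawPath]) ?_
    cases b <;> simp [drawPath, drawing]

theorem support_drawing (hc : EdgeFiniteFor c) :
    hc.drawing.support = squash c '' skeleton c := by
  have hpos : range hc.drawing.pos = ⋃ h : HFace c, squash c '' h.core := by
    ext z
    rw [mem_iUnion]
    constructor
    · rintro ⟨h, rfl⟩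
      exact ⟨h, h.center, hc.center_mem_core h, hc.squash_of_mem_core (hc.center_mem_core h)⟩
    · rintro ⟨h, p, hp, rfl⟩
      exact ⟨h, (hc.squash_of_mem_core hp).symm⟩
  rw [PlaneGraph.support, hpos, skeleton, image_union, image_iUnion, image_iUnion]
  exact congrArg _ (iUnion_congr hc.polyLine_drawPath)

/-- The face of the drawing that belongs to a vertical face: the image of its cell. -/
def faceOf (hc : EdgeFiniteFor c) (f : VFace c) : hc.drawing.Face :=
  ⟨squash c '' f.cell, by
    obtain ⟨p, hp⟩ := hc.cell_nonempty f
    rw [hc.support_drawing]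
    exact ⟨squash c p, fun h => hp.1 (hc.squash_mem_image_skeleton.1 h),
      (hc.connectedComponentIn_eq (mem_image_of_mem _ hp)).symm⟩⟩

theorem eq_faceOf (hc : EdgeFiniteFor c) {F : hc.drawing.Face} {f : VFace c} {z : ℂ}
    (hz : z ∈ F.1) (hz' : z ∈ squash c '' f.cell) : F = hc.faceOf f := by
  obtain ⟨S, x, hx, rfl⟩ := F
  have hcomp : connectedComponentIn hc.drawing.supportᶜ z = squash c '' f.cell := by
    rw [hc.support_drawing, hc.connectedComponentIn_eq hz']
  exact Subtype.ext ((_root_.connectedComponentIn_eq hz).trans hcomp)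

theorem faceOf_bijective (hc : EdgeFiniteFor c) : Function.Bijective hc.faceOf := by
  constructor
  · intro f f' heq
    obtain ⟨p, hp⟩ := hc.cell_nonempty f
    have hmem : squash c p ∈ squash c '' f.cell := mem_image_of_mem _ hp
    exact hc.eq_of_mem_image_cell hmem ((congrArg Subtype.val heq).subset hmem)
  · rintro ⟨S, x, hx, rfl⟩
    obtain ⟨p, rfl⟩ := hc.squash_surjective x
    obtain ⟨f, hf⟩ := exists_mem_cell (c := c) fun hp =>
      hx (hc.support_drawing ▸ mem_image_of_mem _ hp)
    exact ⟨f, (hc.eq_faceOf (mem_connectedComponentIn hx) (mem_image_of_mem _ hf)).symm⟩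

/-- The correspondence of the vertical faces of a tiling with the faces of its drawing. -/
def faceEquiv (hc : EdgeFiniteFor c) : VFace c ≃ hc.drawing.Face :=
  Equiv.ofBijective _ hc.faceOf_bijective

theorem continuous_squash_mk (hc : EdgeFiniteFor c) :
    Continuous fun p : ℝ × ℝ => (squash c ⟨p.1, p.2⟩).re :=
  continuous_re.comp (hc.continuous_squash.comp equivRealProdCLM.symm.continuous)

theorem mem_image_cell (hc : EdgeFiniteFor c) {z : ℂ} (hy : z.im ∈ Ioo a.1.1.y0 a.1.1.y1)
    (hx : z.re ∈ uIcc (squash c ⟨vEdgeX a, z.im⟩).re (curve c a.1 z.im))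
    (hne : z.re ≠ curve c a.1 z.im) : z ∈ squash c '' (vFace c a).cell := by
  have hcont : Continuous fun x : ℝ => (squash c ⟨x, z.im⟩).re :=
    hc.continuous_squash_mk.comp (continuous_id.prodMk continuous_const)
  obtain ⟨x, hmem, hre⟩ := intermediate_value_uIcc hcont.continuousOn hx
  have hhalf : (⟨x, z.im⟩ : ℂ) ∈ halfSquare a := ⟨hmem, Ioo_subset_Icc_self hy⟩
  refine ⟨⟨x, z.im⟩, ⟨hc.notMem_skeleton (halfSquare_subset a hhalf).1 hy ?_, a, rfl, hhalf⟩,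
    Complex.ext hre (squash_im _)⟩
  rintro rfl
  exact hne hre.symm

theorem squash_re_lt_squash_re (hc : EdgeFiniteFor c) {x x' y : ℝ} (hx : x ∈ Icc q.1.x0 q.1.x1)
    (hlt : x < x') (hy : y ∈ Ioo q.1.y0 q.1.y1) :
    (squash c ⟨x, y⟩).re < (squash c ⟨x', y⟩).re := by
  refine hc.squash_lt rfl hlt fun h ⟨hcore, _⟩ => ?_
  obtain ⟨_ | _, -, hb⟩ := hc.exists_of_mem_core hcore (q := q) ⟨hx, Ioo_subset_Icc_self hy⟩
  exacts [hy.1.ne' hb, hy.2.ne hb]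

theorem eventually_mem_image_cell (hc : EdgeFiniteFor c) {p p' x : ℂ} (hp : IsPiece c a p p')
    (hx : x ∈ openSegment ℝ p p') :
    ∀ᶠ ε : ℝ in 𝓝[>] 0, x - ε * (I * (p' - p)) ∈ squash c '' (vFace c a).cell := by
  have hxseg := openSegment_subset_segment ℝ _ _ hx
  have hsub : uIoo p.im p'.im ⊆ Ioo a.1.1.y0 a.1.1.y1 :=
    Ioo_subset_Ioo (le_inf hp.im_mem.1 hp.im_mem'.1) (sup_le hp.im_mem.2 hp.im_mem'.2)
  have hxim := hsub (hp.im_mem_uIoo hx)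
  have hxre : x.re = curve c a.1 x.im := ((hp.mem_iff x).1 hxseg).2
  have htend : Tendsto (fun ε : ℝ => x - ε * (I * (p' - p))) (𝓝[>] 0) (𝓝 x) :=
    tendsto_nhdsWithin_of_tendsto_nhds (Continuous.tendsto' (by fun_prop) _ _ (by simp))
  have him : ∀ᶠ z : ℂ in 𝓝 x, z.im ∈ uIoo p.im p'.im :=
    continuous_im.continuousAt.eventually_mem (isOpen_Ioo.mem_nhds (hp.im_mem_uIoo hx))
  have hcont : Continuous fun z : ℂ => (squash c ⟨vEdgeX a, z.im⟩).re :=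
    hc.continuous_squash_mk.comp (continuous_const.prodMk continuous_im)
  have hpos : 0 < (p'.im - p.im) ^ 2 + (p'.re - p.re) ^ 2 :=
    add_pos_of_pos_of_nonneg (sq_pos_of_ne_zero (sub_ne_zero.2 hp.im_ne.symm)) (sq_nonneg _)
  obtain ⟨q, _ | _⟩ := a
  · have hedge : x.re < (squash c ⟨q.1.x1, x.im⟩).re := hxre ▸
      hc.squash_re_lt_squash_re (Ioo_subset_Icc_self q.1.xc_mem_Ioo) q.1.xc_mem_Ioo.2 hxim
    filter_upwards [htend.eventually (him.and (continuous_re.continuousAt.eventually_lt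
      hcont.continuousAt hedge)), self_mem_nhdsWithin] with ε ⟨hz, hlt⟩ hε
    have hside := hp.re_sub_curve hxseg (Ioo_subset_Icc_self hz)
    have hcurve := sub_pos.1 (hside ▸ div_pos (mul_pos hε hpos) (sub_pos.2 hp.lt))
    exact hc.mem_image_cell (hsub hz) (mem_uIcc_of_ge hcurve.le hlt.le) hcurve.ne'
  · have hedge : (squash c ⟨q.1.x0, x.im⟩).re < x.re := hxre ▸
      hc.squash_re_lt_squash_re (left_mem_Icc.2 q.1.x0_lt_x1.le) q.1.xc_mem_Ioo.1 hxim
    filter_upwards [htend.eventually (him.and (hcont.continuousAt.eventually_lt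
      continuous_re.continuousAt hedge)), self_mem_nhdsWithin] with ε ⟨hz, hlt⟩ hε
    have hside := hp.re_sub_curve hxseg (Ioo_subset_Icc_self hz)
    have hcurve := sub_neg.1
      (hside ▸ div_neg_of_pos_of_neg (mul_pos hε hpos) (sub_neg.2 hp.lt))
    exact hc.mem_image_cell (hsub hz) (mem_uIcc_of_le hlt.le hcurve.le) hcurve.ne

theorem pathFrom_drawing (hc : EdgeFiniteFor c) (a : T.squares × Bool) :
    hc.drawing.pathFrom (hFace c a) a.1 = drawPath c a := by
  obtain ⟨q, _ | _⟩ := a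
  · exact (hc.drawing.pathFrom_of_getLast (e := q) rfl).trans (drawPath_reverse c (q, true))
  · exact hc.drawing.pathFrom_of_head (e := q) rfl

theorem rightOf_drawing (hc : EdgeFiniteFor c) (a : T.squares × Bool) (F : hc.drawing.Face) :
    hc.drawing.RightOf (hFace c a) a.1 F ↔ F = hc.faceOf (vFace c a) := by
  constructor
  · rintro ⟨-, p, p', hpp, x, hx, hF⟩
    rw [hc.pathFrom_drawing] at hpp
    obtain ⟨ε, hmem, hmem'⟩ :=
      (hF.and (hc.eventually_mem_image_cell (hc.isPiece_of_infix_drawPath hpp) hx)).exists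
    exact hc.eq_faceOf hmem hmem'
  · rintro rfl
    refine ⟨hc.inc_drawing.2 ⟨a.2, rfl⟩, bend c a, bend c (a.1, !a.2), ?_, _,
      midpoint_mem_openSegment _ _,
      hc.eventually_mem_image_cell (hc.isPiece_bend_bend a) (midpoint_mem_openSegment _ _)⟩
    rw [hc.pathFrom_drawing]
    exact ⟨[(hFace c a).center], [(hFace c (a.1, !a.2)).center], rfl⟩

end EdgeFiniteFor
end SquareTiling

/-! ### The drawing is a plane map -/

namespace SquareTiling

variable {T : SquareTiling} {c : T.FaceChoice}

namespace EdgeFiniteFor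

theorem connected_drawing (hc : EdgeFiniteFor c) (u v : HFace c) :
    Relation.ReflTransGen (fun a b => ∃ e, hc.drawing.Inc a e ∧ hc.drawing.Inc b e) u v := by
  set R : HFace c → HFace c → Prop :=
    Relation.ReflTransGen fun a b => ∃ e, hc.drawing.Inc a e ∧ hc.drawing.Inc b e
  have : Std.Symm fun a b : HFace c => ∃ e, hc.drawing.Inc a e ∧ hc.drawing.Inc b e :=
    ⟨fun _ _ ⟨e, ha, hb⟩ => ⟨e, hb, ha⟩⟩
  have hsymm {a b : HFace c} (h : R a b) : R b a := Relation.ReflTransGen.stdSymm.symm _ _ h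
  have hstep (a : T.squares × Bool) : R (topFace c a.1) (hFace c a) :=
    .single ⟨a.1, hc.inc_drawing.2 ⟨true, rfl⟩, hc.inc_drawing.2 ⟨a.2, rfl⟩⟩
  have hequiv : Equivalence fun q q' : T.squares => R (topFace c q) (topFace c q') :=
    ⟨fun _ => .refl, hsymm, .trans⟩
  have hsquares := hc.rel_of_hFace_rel hequiv fun a b hab =>
    (hab ▸ hstep a : R (topFace c a.1) (hFace c b)).trans (hsymm (hstep b))
  obtain ⟨a, rfl⟩ := exists_hFace u
  obtain ⟨b, rfl⟩ := exists_hFace v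
  exact (hsymm (hstep a)).trans ((hsquares a.1 b.1).trans (hstep b))

theorem isPlaneMap_drawing (hc : EdgeFiniteFor c) : hc.drawing.IsPlaneMap where
  nonempty := ⟨topFace c (T.germ 0 true true)⟩
  connected := hc.connected_drawing
  bounded F := by
    obtain ⟨f, rfl⟩ := hc.faceOf_bijective.2 F
    have hfin : {a : T.squares × Bool | vFace c a = f}.Finite := hc.2 f
    have hcompact : IsCompact (squash c '' ⋃ a ∈ {a | vFace c a = f}, halfSquare a) :=
      (hfin.isCompact_biUnion fun a _ => isCompact_halfSquare a).image hc.continuous_squash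
    refine hcompact.isBounded.subset (image_mono ?_)
    rintro p ⟨-, a, ha, hpa⟩
    exact mem_biUnion ha hpa
  finite_verts K hK := (hc.finite_box hK).subset fun h hh =>
    ⟨h.center, hc.core_subset_box h (hc.center_mem_core h), hh⟩
  finite_edges K hK := by
    refine (T.finite_squares_inter (hc.isCompact_preimage_squash hK)).subset ?_
    rintro q ⟨z, hz, hzK⟩
    obtain ⟨p, hp, rfl⟩ := (hc.polyLine_drawPath q).subset hz
    exact ⟨p, q.1.mid_subset_region hp, hzK⟩

/-! ### The harmonic vector -/

/-- The directed edge of the drawing that starts at the horizontal face of a horizontal edge and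
belongs to the square of this edge. -/
def dart (hc : EdgeFiniteFor c) (a : T.squares × Bool) : hc.drawing.Dart :=
  ⟨(hFace c a, a.1), hc.inc_drawing.2 ⟨a.2, rfl⟩⟩

theorem dart_bijective (hc : EdgeFiniteFor c) : Function.Bijective hc.dart := by
  constructor
  · rintro ⟨q, b⟩ ⟨q', b'⟩ h
    have hface : hFace c (q, b) = hFace c (q', b') := congrArg (fun d => d.1.1) h
    obtain rfl : q = q' := congrArg (fun d => d.1.2) h
    rcases Bool.eq_or_eq_not b b' with rfl | rfl
    · rfl
    · exact absurd hface.symm (hFace_ne_hFace_not q b')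
  · rintro ⟨⟨h, q⟩, hinc⟩
    obtain ⟨b, hb⟩ := hc.inc_drawing.1 hinc
    exact ⟨(q, b), Subtype.ext (Prod.ext hb rfl)⟩

open Classical in
/-- The harmonic vector of the drawing: the size of the square on directed edges that run
downwards and minus the size on those that run upwards. -/
def weight (hc : EdgeFiniteFor c) (d : hc.drawing.Dart) : ℝ :=
  if d.1.1 = topFace c d.1.2 then (d.1.2 : T.squares).1.side else -(d.1.2 : T.squares).1.side

theorem weight_dart_true (hc : EdgeFiniteFor c) (q : T.squares) :
    hc.weight (hc.dart (q, true)) = q.1.side := if_pos rfl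

theorem weight_dart_false (hc : EdgeFiniteFor c) (q : T.squares) :
    hc.weight (hc.dart (q, false)) = -q.1.side := if_neg (topFace_ne_bottomFace q).symm

theorem finsum_weight (hc : EdgeFiniteFor c) {P : hc.drawing.Dart → Prop}
    (hP : {a | P (hc.dart a)}.Finite) :
    ∑ᶠ (d : hc.drawing.Dart) (_ : P d), hc.weight d =
      ∑ᶠ (q : T.squares) (_ : P (hc.dart (q, true))), q.1.side -
        ∑ᶠ (q : T.squares) (_ : P (hc.dart (q, false))), q.1.side := by
  have hinj (b : Bool) : Function.Injective fun q => hc.dart (q, b) :=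
    hc.dart_bijective.1.comp fun _ _ => congrArg Prod.fst
  have hfin (b : Bool) : {q : T.squares | P (hc.dart (q, b))}.Finite :=
    Set.Finite.preimage (f := fun q => (q, b)) (fun _ _ _ _ => congrArg Prod.fst) hP
  have hunion : {d | P d} = (fun q => hc.dart (q, true)) '' {q | P (hc.dart (q, true))} ∪
      (fun q => hc.dart (q, false)) '' {q | P (hc.dart (q, false))} := by
    ext d
    obtain ⟨⟨q, b⟩, rfl⟩ := hc.dart_bijective.2 d
    cases b <;> simp [hc.dart_bijective.1.eq_iff]
  have hdisj : Disjoint ((fun q => hc.dart (q, true)) '' {q | P (hc.dart (q, true))})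
      ((fun q => hc.dart (q, false)) '' {q | P (hc.dart (q, false))}) := by
    refine Set.disjoint_left.2 ?_
    rintro _ ⟨q, -, rfl⟩ ⟨q', -, h⟩
    simpa using hc.dart_bijective.1 h
  change ∑ᶠ d ∈ {d | P d}, hc.weight d = _
  rw [hunion, finsum_mem_union hdisj ((hfin true).image _) ((hfin false).image _),
    finsum_mem_image (hinj true).injOn, finsum_mem_image (hinj false).injOn, sub_eq_add_neg]
  simp only [hc.weight_dart_true, hc.weight_dart_false]
  rw [finsum_mem_neg_distrib _ (hfin false)]
  rfl

theorem rightOf_dart (hc : EdgeFiniteFor c) (a : T.squares × Bool) (f : VFace c) :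
    hc.drawing.RightOf (hc.dart a).1.1 (hc.dart a).1.2 (hc.faceOf f) ↔ vFace c a = f :=
  (hc.rightOf_drawing a _).trans (hc.faceOf_bijective.1.eq_iff.trans eq_comm)

theorem isHarmonic_weight (hc : EdgeFiniteFor c) : hc.drawing.IsHarmonic hc.weight where
  vert h := by
    rw [hc.finsum_weight (hc.1 h)]
    exact sub_eq_zero.2 ((hc.finsum_side h true).trans (hc.finsum_side h false).symm)
  edge q := by
    have hfin : {a : T.squares × Bool | a.1 = q}.Finite :=
      ((Set.finite_singleton q).prod finite_univ).subset fun a ha => ⟨ha, mem_univ a.2⟩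
    rw [hc.finsum_weight hfin]
    exact sub_self _
  face F := by
    obtain ⟨f, rfl⟩ := hc.faceOf_bijective.2 F
    have hfin : {a : T.squares × Bool | vFace c a = f}.Finite := hc.2 f
    rw [hc.finsum_weight (by simpa only [hc.rightOf_dart] using hfin)]
    simp only [hc.rightOf_dart, hc.finsum_side_vFace, sub_self]

/-- The correspondence between a tiling and its drawing. -/
def corresponds (hc : EdgeFiniteFor c) : Corresponds c hc.drawing hc.weight where
  vert := Equiv.refl _
  edge := Equiv.refl _
  face := hc.faceEquiv.symm
  inc h q := by
    constructor
    · intro hinc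
      obtain ⟨_ | _, rfl⟩ := hc.inc_drawing.1 hinc
      exacts [Or.inr rfl, Or.inl rfl]
    · rintro (rfl | rfl)
      exacts [hc.inc_drawing.2 ⟨true, rfl⟩, hc.inc_drawing.2 ⟨false, rfl⟩]
  right h q F := by
    obtain ⟨f, rfl⟩ := hc.faceEquiv.surjective F
    rw [Equiv.symm_apply_apply]
    constructor
    · intro hright
      obtain ⟨_ | _, rfl⟩ := hc.inc_drawing.1 hright.1
      · exact Or.inr ⟨rfl, ((hc.rightOf_dart (q, false) f).1 hright).symm⟩
      · exact Or.inl ⟨rfl, ((hc.rightOf_dart (q, true) f).1 hright).symm⟩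
    · rintro (⟨rfl, rfl⟩ | ⟨rfl, rfl⟩)
      exacts [(hc.rightOf_dart (q, true) _).2 rfl, (hc.rightOf_dart (q, false) _).2 rfl]
  weight_top d h := if_pos h
  weight_bottom d h := if_neg fun h' => topFace_ne_bottomFace d.1.2 (h'.symm.trans h)

end EdgeFiniteFor
end SquareTiling

/-! ### Translations -/

section Translate

variable {t : ℂ}

theorem polyLine_map_add (t : ℂ) :
    ∀ l : List ℂ, polyLine (l.map (· + t)) = (fun z => z + t) '' polyLine l
  | [] => by rw [List.map_nil, polyLine_eq_empty zero_le_one, image_empty]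
  | [a] => by rw [List.map_singleton, polyLine_singleton, polyLine_singleton, image_empty]
  | a :: b :: l => by
    have hsegment : segment ℝ (a + t) (b + t) = (fun z => z + t) '' segment ℝ a b := by
      simpa only [add_comm t] using (segment_translate_image ℝ t a b).symm
    have htail := polyLine_map_add t (b :: l)
    rw [List.map_cons] at htail
    rw [List.map_cons, List.map_cons, polyLine_cons_cons, polyLine_cons_cons, image_union,
      hsegment, htail]

namespace Square

theorem translate_injective (t : ℂ) : Function.Injective (translate t) := fun q q' h =>
  Square.ext (add_right_cancel (congrArg corner h : q.corner + t = q'.corner + t))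
    (congrArg side h :)

@[simp] theorem x0_translate (q : Square) : (q.translate t).x0 = q.x0 + t.re := rfl

@[simp] theorem y0_translate (q : Square) : (q.translate t).y0 = q.y0 + t.im := rfl

@[simp] theorem side_translate (q : Square) : (q.translate t).side = q.side := rfl

@[simp] theorem x1_translate (q : Square) : (q.translate t).x1 = q.x1 + t.re := by
  rw [x1_eq, x1_eq, x0_translate, side_translate, add_right_comm]

@[simp] theorem y1_translate (q : Square) : (q.translate t).y1 = q.y1 + t.im := by
  rw [y1_eq, y1_eq, y0_translate, side_translate, add_right_comm]

@[simp] theorem xc_translate (q : Square) : (q.translate t).xc = q.xc + t.re := by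
  rw [xc, xc, x0_translate, side_translate, add_right_comm]

theorem add_mem_region_translate {q : Square} {p : ℂ} :
    p + t ∈ (q.translate t).region ↔ p ∈ q.region := by
  simp [mem_region]

end Square

namespace SquareTiling

variable {T : SquareTiling} {c : T.FaceChoice}

namespace IsPeriod

/-- The action of a period on the squares. -/
def squareEquiv (ht : IsPeriod c t) : T.squares ≃ T.squares :=
  (Equiv.Set.image _ T.squares (Square.translate_injective t)).trans (Equiv.setCongr ht.1)

theorem coe_squareEquiv (ht : IsPeriod c t) (q : T.squares) :
    (ht.squareEquiv q).1 = q.1.translate t := rfl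

theorem add_mem_horiz (ht : IsPeriod c t) {p : ℂ} : p + t ∈ c.horiz ↔ p ∈ c.horiz := by
  conv_lhs => rw [← ht.2]
  exact (add_left_injective t).mem_set_image

theorem add_mem_singular (ht : IsPeriod c t) {p : ℂ} : p + t ∈ T.singular ↔ p ∈ T.singular := by
  have hsquares : {q ∈ T.squares | p + t ∈ q.region} =
      Square.translate t '' {q ∈ T.squares | p ∈ q.region} := by
    conv_lhs => rw [← ht.1]
    ext q
    constructor
    · rintro ⟨⟨q, hq, rfl⟩, hp⟩
      exact ⟨q, ⟨hq, Square.add_mem_region_translate.1 hp⟩, rfl⟩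
    · rintro ⟨q, ⟨hq, hp⟩, rfl⟩
      exact ⟨mem_image_of_mem _ hq, Square.add_mem_region_translate.2 hp⟩
  rw [singular, mem_ofPred_eq, mem_ofPred_eq, hsquares,
    Set.ncard_image_of_injective _ (Square.translate_injective t)]

theorem hEdgeY_squareEquiv (ht : IsPeriod c t) (q : T.squares) (b : Bool) :
    hEdgeY (ht.squareEquiv q, b) = hEdgeY (q, b) + t.im := by
  cases b
  exacts [q.1.y0_translate, q.1.y1_translate]

theorem add_mem_hEdge (ht : IsPeriod c t) {q : T.squares} {b : Bool} {p : ℂ} :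
    p + t ∈ T.hEdge (ht.squareEquiv q, b) ↔ p ∈ T.hEdge (q, b) := by
  simp [mem_hEdge, ht.hEdgeY_squareEquiv, ht.coe_squareEquiv]

theorem hLink_squareEquiv (ht : IsPeriod c t) (a b : T.squares × Bool) :
    HLink c (ht.squareEquiv a.1, a.2) (ht.squareEquiv b.1, b.2) ↔ HLink c a b := by
  rw [HLink, HLink, (Equiv.addRight t).surjective.exists]
  simp only [Equiv.coe_addRight, mem_inter_iff, Set.mem_sdiff, ht.add_mem_hEdge,
    ht.add_mem_singular, ht.add_mem_horiz]

/-- The action of a period on the horizontal faces. -/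
def faceEquiv (ht : IsPeriod c t) : HFace c ≃ HFace c :=
  Quot.congr (ht.squareEquiv.prodCongr (Equiv.refl Bool)) fun a b => (ht.hLink_squareEquiv a b).symm

theorem squares_faceEquiv (ht : IsPeriod c t) (h : HFace c) :
    (ht.faceEquiv h).squares = ht.squareEquiv '' h.squares := by
  ext q
  obtain ⟨q, rfl⟩ := ht.squareEquiv.surjective q
  rw [ht.squareEquiv.injective.mem_set_image]
  exact exists_congr fun b => ht.faceEquiv.injective.eq_iff (a := hFace c (q, b))

theorem gap_faceEquiv (ht : IsPeriod c t) (h : HFace c) : (ht.faceEquiv h).gap = h.gap := by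
  rw [HFace.gap, ht.squares_faceEquiv, image_image]
  rfl

theorem lo_faceEquiv (ht : IsPeriod c t) (hc : EdgeFiniteFor c) (h : HFace c) :
    (ht.faceEquiv h).lo = h.lo + t.re := by
  have himage : (fun q => q.1.x0) '' (ht.faceEquiv h).squares =
      OrderIso.addRight t.re '' ((fun q => q.1.x0) '' h.squares) := by
    rw [ht.squares_faceEquiv, image_image, image_image]
    rfl
  rw [HFace.lo, himage, ← OrderIso.map_csInf' _ (h.squares_nonempty.image _)
    ((hc.finite_squares h).image _).bddBelow]
  rfl

theorem hi_faceEquiv (ht : IsPeriod c t) (hc : EdgeFiniteFor c) (h : HFace c) :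
    (ht.faceEquiv h).hi = h.hi + t.re := by
  have himage : (fun q => q.1.x1) '' (ht.faceEquiv h).squares =
      OrderIso.addRight t.re '' ((fun q => q.1.x1) '' h.squares) := by
    rw [ht.squares_faceEquiv, image_image, image_image]
    exact image_congr fun q _ => q.1.x1_translate
  rw [HFace.hi, himage, ← OrderIso.map_csSup' _ (h.squares_nonempty.image _)
    ((hc.finite_squares h).image _).bddAbove]
  rfl

theorem y_faceEquiv (ht : IsPeriod c t) (h : HFace c) : (ht.faceEquiv h).y = h.y + t.im := by
  obtain ⟨⟨q, b⟩, rfl⟩ := exists_hFace h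
  exact ht.hEdgeY_squareEquiv q b

theorem center_faceEquiv (ht : IsPeriod c t) (hc : EdgeFiniteFor c) (h : HFace c) :
    (ht.faceEquiv h).center = h.center + t := by
  refine Complex.ext ?_ (ht.y_faceEquiv h)
  simp only [HFace.center, add_re, ht.lo_faceEquiv hc, ht.hi_faceEquiv hc]
  ring

theorem bend_squareEquiv (ht : IsPeriod c t) (q : T.squares) (b : Bool) :
    bend c (ht.squareEquiv q, b) = bend c (q, b) + t := by
  have hgap : (hFace c (ht.squareEquiv q, b)).gap = (hFace c (q, b)).gap :=
    ht.gap_faceEquiv (hFace c (q, b))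
  refine Complex.ext q.1.xc_translate ?_
  simp only [bend, hgap, ht.hEdgeY_squareEquiv, add_im]
  cases b
  exacts [add_right_comm _ _ _, add_sub_right_comm _ _ _]

theorem drawPath_squareEquiv (ht : IsPeriod c t) (hc : EdgeFiniteFor c) (q : T.squares) (b : Bool) :
    drawPath c (ht.squareEquiv q, b) = (drawPath c (q, b)).map (· + t) := by
  have hcenter (b : Bool) : (hFace c (ht.squareEquiv q, b)).center = (hFace c (q, b)).center + t :=
    ht.center_faceEquiv hc (hFace c (q, b))
  simp only [drawPath, List.map_cons, List.map_nil, hcenter, ht.bend_squareEquiv]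

theorem drawing (ht : IsPeriod c t) (hc : EdgeFiniteFor c) :
    hc.drawing.IsPeriod hc.weight t := by
  refine ⟨ht.faceEquiv, ht.squareEquiv, ht.center_faceEquiv hc, fun q => ?_, fun d d' h => ?_⟩
  · exact (congrArg polyLine (ht.drawPath_squareEquiv hc q true)).trans (polyLine_map_add t _)
  · obtain ⟨⟨q, b⟩, rfl⟩ := hc.dart_bijective.2 d
    obtain rfl : d' = hc.dart (ht.squareEquiv q, b) := Subtype.ext h
    cases b
    · rw [hc.weight_dart_false, hc.weight_dart_false, ht.coe_squareEquiv, Square.side_translate]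
    · rw [hc.weight_dart_true, hc.weight_dart_true, ht.coe_squareEquiv, Square.side_translate]

end IsPeriod

end SquareTiling

end Translate

end

theorem mainTheorem1 (T : SquareTiling) :
    -- every choice of faces for which the tiling is edge finite
    (∀ c : T.FaceChoice, SquareTiling.EdgeFiniteFor c →
      -- existence, correspondence of squares, horizontal and vertical faces, and periodicity
      (∃ (M : PlaneGraph) (w : M.Dart → ℝ),
        M.IsPlaneMap ∧ M.IsHarmonic w ∧ Nonempty (Corresponds c M w) ∧
        (∀ t : ℂ, SquareTiling.IsPeriod c t → M.IsPeriod w t) ∧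
        (TwoPeriods (SquareTiling.IsPeriod c) → TwoPeriods (M.IsPeriod w))) ∧
      -- uniqueness for the given choice
      (∀ (M M' : PlaneGraph) (w : M.Dart → ℝ) (w' : M'.Dart → ℝ),
        M.IsPlaneMap → M'.IsPlaneMap →
        ∀ (r : Corresponds c M w) (r' : Corresponds c M' w'),
          ∃ Φ : M.Iso M',
            (∀ v, r'.vert (Φ.vert v) = r.vert v) ∧
            (∀ e, r'.edge (Φ.edge e) = r.edge e) ∧
            (∀ f, r'.face (Φ.face f) = r.face f) ∧
            (∀ (d : M.Dart) (d' : M'.Dart),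
              d'.1 = (Φ.vert d.1.1, Φ.edge d.1.2) → w' d' = w d))) ∧
    -- regular tilings
    (T.Regular →
      (∀ (c c' : T.FaceChoice) (M M' : PlaneGraph) (w : M.Dart → ℝ) (w' : M'.Dart → ℝ),
        M.IsPlaneMap → M'.IsPlaneMap →
        ∀ (r : Corresponds c M w) (r' : Corresponds c' M' w'),
          ∃ Φ : M.Iso M',
            (∀ e, r'.edge (Φ.edge e) = r.edge e) ∧
            (∀ (d : M.Dart) (d' : M'.Dart),
              d'.1 = (Φ.vert d.1.1, Φ.edge d.1.2) → w' d' = w d)) ∧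
      T.rotate.Regular ∧
      (∀ (c : T.FaceChoice) (c' : T.rotate.FaceChoice) (M M' : PlaneGraph)
        (w : M.Dart → ℝ) (w' : M'.Dart → ℝ),
        M.IsPlaneMap → M'.IsPlaneMap →
        ∀ (r : Corresponds c M w) (r' : Corresponds c' M' w'),
          ∃ Δ : M.DualIso M', ∀ e, (r'.edge e).1 = (r.edge (Δ.edge e)).1.rotate)) := by
  refine ⟨fun c hc => ⟨⟨hc.drawing, hc.weight, hc.isPlaneMap_drawing, hc.isHarmonic_weight,
    ⟨hc.corresponds⟩, fun t ht => ht.drawing hc, ?_⟩, ?_⟩, fun hT => ⟨?_, hT.rotate, ?_⟩⟩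
  · rintro ⟨t₁, t₂, hli, h₁, h₂⟩
    exact ⟨t₁, t₂, hli, h₁.drawing hc, h₂.drawing hc⟩
  · intro M M' w w' hM hM' r r'
    exact ⟨r.iso r' hM hM', fun v => r'.vert.apply_symm_apply _,
      fun e => r'.edge.apply_symm_apply _, fun f => r'.face.apply_symm_apply _,
      r.weight_eq r' hM hM'⟩
  · intro c c' M M' w w' hM hM' r r'
    obtain rfl := SquareTiling.FaceChoice.eq_of_singular_eq_empty hT.2 c c'
    exact ⟨r.iso r' hM hM', fun e => r'.edge.apply_symm_apply _, r.weight_eq r' hM hM'⟩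
  · intro c c' M M' w w' hM hM' r r'
    obtain rfl := SquareTiling.FaceChoice.eq_of_singular_eq_empty hT.rotate.2 c' c.rotate
    exact ⟨r.dualIso r' hM hM', r.edge_dualIso r' hM hM'⟩
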